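/- Let $n\in\mathbb N=\{1,2,\dots\}$. For $0<p\le u<\infty$ the Morrey space $\mathcal M^u_p(\mathbb R^n)$ is the set of all (classes modulo a.e. equality of) measurable functions $f:\mathbb R^n\to\mathbb C$ with $|f|^p$ locally integrable and $$\|f\|_{\mathcal M^u_p}:=\sup_B |B|^{1/u-1/p}\Big(\int_B|f(x)|^p\,dx\Big)^{1/p}<\infty,$$ where $B$ runs over all balls of $\mathbb R^n$. For spaces $X_0,X_1$ of such functions with norms $\|\cdot\|_{X_0},\|\cdot\|_{X_1}$, $\Theta\in(0,1)$ and $q\in(0,\infty]$, the real interpolation space $(X_0,X_1)_{\Theta,q}$ is the set of all $f\in X_0+X_1$ with $$\|f\|_{(X_0,X_1)_{\Theta,q}}:=\Big(\int_0^\infty\big[t^{-\Theta}K(t,f)\big]^q\,\frac{dt}{t}\Big)^{1/q}<\infty,\qquad K(t,f):=\inf\big\{\|f_0\|_{X_0}+t\|f_1\|_{X_1}:\ f=f_0+f_1,\ f_i\in X_i\big\},$$ with $\sup_{t>0}t^{-\Theta}K(t,f)$ in place of the integral expression if $q=\infty$. Theorem. Let $1\le p_i\le u_i<\infty$ for $i\in\{0,1\}$,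 let $\Theta\in(0,1)$, $q\in(0,\infty]$, and put $$\frac1p:=\frac{1-\Theta}{p_0}+\frac{\Theta}{p_1},\qquad \frac1u:=\frac{1-\Theta}{u_0}+\frac{\Theta}{u_1}.$$ Then $$\big(\mathcal M^{u_0}_{p_0}(\mathbb R^n),\mathcal M^{u_1}_{p_1}(\mathbb R^n)\big)_{\Theta,q}\neq\mathcal M^u_p(\mathbb R^n)$$ (as sets, hence also as quasi-normed spaces), except in the trivial cases (a) $p_0=p_1$ and $u_0=u_1$, or (b) $p_0=u_0$, $p_1=u_1$ and $q=p$; in each of these cases the two spaces coincide as sets and their quasi-norms are equivalent. -/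

import Mathlib

open MeasureTheory Set
open scoped ENNReal

noncomputable section

/-- The ambient space: complex-valued measurable functions on `ℝⁿ` (with its Euclidean norm),
modulo equality almost everywhere. -/
abbrev FunSpace (n : ℕ) : Type :=
  EuclideanSpace ℝ (Fin n) →ₘ[volume] ℂ

/-- The (extended) Morrey norm
`‖f‖ = sup_B |B|^(1/u - 1/p) (∫_B |f|^p)^(1/p)`, the supremum being over all balls `B` of `ℝⁿ`. -/
def morreyNorm {n : ℕ} (p u : ℝ) (f : FunSpace n) : ℝ≥0∞ :=
  ⨆ (x : EuclideanSpace ℝ (Fin n)) (r : ℝ) (_ : 0 < r),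
    (volume (Metric.ball x r)) ^ (1 / u - 1 / p) *
      (∫⁻ y in Metric.ball x r, ‖f y‖ₑ ^ p) ^ (1 / p)

/-- The Morrey space `M^u_p(ℝⁿ)`: all `f` for which `|f|^p` is locally integrable and the
Morrey norm is finite. -/
def morreySpace (n : ℕ) (p u : ℝ) : Set (FunSpace n) :=
  {f | LocallyIntegrable (fun y => ‖f y‖ ^ p) volume ∧ morreyNorm p u f < ∞}

section RealMethod

variable {V : Type*} [AddCommGroup V]

/-- Peetre's functional `K(t, x, X₀, X₁)` of two spaces `X₀, X₁ ⊆ V` with quasi-norms `N₀, N₁`. -/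
def peetreK (X₀ X₁ : Set V) (N₀ N₁ : V → ℝ≥0∞) (t : ℝ) (x : V) : ℝ≥0∞ :=
  ⨅ (x₀ ∈ X₀) (x₁ ∈ X₁) (_ : x = x₀ + x₁), N₀ x₀ + ENNReal.ofReal t * N₁ x₁

open Classical in
/-- The quasi-norm `(∫₀^∞ [t^(-θ) K(t, x)]^q dt/t)^(1/q)` of real interpolation, to be read as
`sup_{t > 0} t^(-θ) K(t, x)` when `q = ∞`. -/
def realInterpNorm (X₀ X₁ : Set V) (N₀ N₁ : V → ℝ≥0∞) (θ : ℝ) (q : ℝ≥0∞) (x : V) : ℝ≥0∞ :=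
  if q = ∞ then
    ⨆ (t : ℝ) (_ : 0 < t), ENNReal.ofReal (t ^ (-θ)) * peetreK X₀ X₁ N₀ N₁ t x
  else
    (∫⁻ t in Ioi (0 : ℝ),
      (ENNReal.ofReal (t ^ (-θ)) * peetreK X₀ X₁ N₀ N₁ t x) ^ q.toReal / ENNReal.ofReal t) ^
        (1 / q.toReal)

/-- The real interpolation space `(X₀, X₁)_{θ,q}`: all `x ∈ X₀ + X₁` of finite quasi-norm. -/
def realInterpSpace (X₀ X₁ : Set V) (N₀ N₁ : V → ℝ≥0∞) (θ : ℝ) (q : ℝ≥0∞) : Set V :=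
  {x | (∃ x₀ ∈ X₀, ∃ x₁ ∈ X₁, x = x₀ + x₁) ∧ realInterpNorm X₀ X₁ N₀ N₁ θ q x < ∞}

end RealMethod

/-- The quasi-norm of `(M^{u₀}_{p₀}(ℝⁿ), M^{u₁}_{p₁}(ℝⁿ))_{θ,q}`. -/
def morreyInterpNorm {n : ℕ} (p₀ u₀ p₁ u₁ θ : ℝ) (q : ℝ≥0∞) (f : FunSpace n) : ℝ≥0∞ :=
  realInterpNorm (morreySpace n p₀ u₀) (morreySpace n p₁ u₁)
    (morreyNorm p₀ u₀) (morreyNorm p₁ u₁) θ q f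

/-- The real interpolation space `(M^{u₀}_{p₀}(ℝⁿ), M^{u₁}_{p₁}(ℝⁿ))_{θ,q}`. -/
def morreyInterpSpace (n : ℕ) (p₀ u₀ p₁ u₁ θ : ℝ) (q : ℝ≥0∞) : Set (FunSpace n) :=
  realInterpSpace (morreySpace n p₀ u₀) (morreySpace n p₁ u₁)
    (morreyNorm p₀ u₀) (morreyNorm p₁ u₁) θ q

end

/-! The ratio `p / u` says how sparse a set may be: the indicator of a set of dimension `n(1 - p/u)`
at large scales is borderline for `M^u_p`. The number `u` alone governs dilations, since the norm
scales with degree `-n/u`. The exponents `1/p` and `1/u` are interpolated separately, so `p/u` is a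
weighted mean of `p₀/u₀` and `p₁/u₁`. Every non-coincidence comes from one explicit function.

Different ratios. Then `p/u` is smaller than one endpoint ratio. Let `E` have dimension exactly `n(1
- p/u)` at scales at least 1 (`exists_sparse_set`). Its indicator lies in `M^u_p`, but an element of
that endpoint space has vanishing density along `E` at large scales. Hence the other summand of any
decomposition keeps a fixed amount of norm (`le_morreyNorm_of_sparse`), `K(t)` is bounded below by a
constant or by a multiple of `t`, and the interpolation norm is infinite.

Equal ratios with `u₀ ≠ u₁`. Now `p/u` is the common ratio and the parameter `t = 2^m` corresponds
to the length `2^(mκ)`, where `κ = 1/(n(1/u₀ - 1/u₁))`. The radial function `|x|^(-n/u)`, damped by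
a power of the logarithm when `p = u`, lies in `M^u_p`. Testing it on annuli
(`le_peetreK_of_dyadic`) bounds `2^(-mθ) K(2^m)` below by a sequence outside `ℓ^q`. This excludes
all finite `q` if `p < u`, and `q < p` if `p = u`. Conversely, for `q > p` the dilates of the
indicator of `E`, with coefficients `(1 + |k|)^(-1/p)`, add up to an element of the interpolation
space (`peetreK_dilates_le`). The integral of its `p`-th power over one ball dominates the harmonic
series, so it is not in `M^u_p`. Only `p = u` with `q = p`, which is case (b), escapes.

In case (a), `K(t, f)` is comparable with `min(1, t)` times the norm. In case (b), the functional `∫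
min(|f|^p₀, s|f|^p₁)` replaces `K`: at a suitable `t` it is a power of `K` up to constants
(`peetreK_lebesgue_equiv`), and its weighted sum over `s = 2^k` is comparable with `∫ |f|^p`. -/

noncomputable section

/-! ### Morrey norms of nonnegative functions: Minkowski, Hölder, dilations -/

/-- The Morrey norm of a nonnegative function, `sup_B |B|^(1/u - 1/p) (∫_B g^p)^(1/p)`. -/
def morreyFun {n : ℕ} (p u : ℝ) (g : EuclideanSpace ℝ (Fin n) → ℝ≥0∞) : ℝ≥0∞ :=
  ⨆ (x : EuclideanSpace ℝ (Fin n)) (r : ℝ) (_ : 0 < r),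
    (volume (Metric.ball x r)) ^ (1 / u - 1 / p) *
      (∫⁻ y in Metric.ball x r, g y ^ p) ^ (1 / p)

theorem morreyNorm_eq {n : ℕ} (p u : ℝ) (f : FunSpace n) :
    morreyNorm p u f = morreyFun p u (fun y => ‖f y‖ₑ) := rfl

theorem le_morreyFun {n : ℕ} (p u : ℝ) (g : EuclideanSpace ℝ (Fin n) → ℝ≥0∞)
    (x : EuclideanSpace ℝ (Fin n)) {r : ℝ} (hr : 0 < r) :
    (volume (Metric.ball x r)) ^ (1 / u - 1 / p) *
      (∫⁻ y in Metric.ball x r, g y ^ p) ^ (1 / p) ≤ morreyFun p u g :=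
  le_iSup_of_le x (le_iSup_of_le r (le_iSup_of_le hr le_rfl))

theorem morreyFun_mono_ae {n : ℕ} {p : ℝ} (hp : 0 < p) (u : ℝ)
    {g h : EuclideanSpace ℝ (Fin n) → ℝ≥0∞} (hgh : g ≤ᵐ[volume] h) :
    morreyFun p u g ≤ morreyFun p u h := by
  refine iSup_mono fun x => iSup_mono fun r => iSup_mono fun hr => ?_
  gcongr 2
  refine lintegral_mono_ae ?_
  filter_upwards [ae_restrict_of_ae hgh] with y hy
  gcongr

theorem morreyFun_congr_ae {n : ℕ} {p : ℝ} (hp : 0 < p) (u : ℝ)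
    {g h : EuclideanSpace ℝ (Fin n) → ℝ≥0∞} (hgh : g =ᵐ[volume] h) :
    morreyFun p u g = morreyFun p u h :=
  le_antisymm (morreyFun_mono_ae hp u hgh.le) (morreyFun_mono_ae hp u hgh.symm.le)

theorem morreyFun_mono {n : ℕ} {p : ℝ} (hp : 0 < p) (u : ℝ)
    {g h : EuclideanSpace ℝ (Fin n) → ℝ≥0∞} (hgh : ∀ x, g x ≤ h x) :
    morreyFun p u g ≤ morreyFun p u h :=
  morreyFun_mono_ae hp u (Filter.Eventually.of_forall hgh)

theorem morreyFun_add_le {n : ℕ} {p : ℝ} (hp : 1 ≤ p) (u : ℝ)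
    {g h : EuclideanSpace ℝ (Fin n) → ℝ≥0∞} (hg : AEMeasurable g) (hh : AEMeasurable h) :
    morreyFun p u (fun x => g x + h x) ≤ morreyFun p u g + morreyFun p u h := by
  refine iSup_le fun x => iSup_le fun r => iSup_le fun hr => ?_
  calc _ ≤ (volume (Metric.ball x r)) ^ (1 / u - 1 / p) *
        ((∫⁻ y in Metric.ball x r, g y ^ p) ^ (1 / p)
          + (∫⁻ y in Metric.ball x r, h y ^ p) ^ (1 / p)) := by
        gcongr
        exact ENNReal.lintegral_Lp_add_le hg.restrict hh.restrict hp
    _ ≤ _ := by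
        rw [mul_add]
        exact add_le_add (le_morreyFun p u g x hr) (le_morreyFun p u h x hr)

theorem morreyFun_const_mul {n : ℕ} {p : ℝ} (hp : 0 < p) (u : ℝ)
    (c : ℝ≥0∞) {g : EuclideanSpace ℝ (Fin n) → ℝ≥0∞} (hg : AEMeasurable g) :
    morreyFun p u (fun x => c * g x) = c * morreyFun p u g := by
  unfold morreyFun
  simp only [ENNReal.mul_iSup]
  refine iSup_congr fun x => iSup_congr fun r => iSup_congr fun hr => ?_
  have : ∀ y, (c * g y) ^ p = c ^ p * g y ^ p := fun y => ENNReal.mul_rpow_of_nonneg _ _ hp.le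
  simp only [this]
  rw [lintegral_const_mul'' _ (hg.pow_const p).restrict,
    ENNReal.mul_rpow_of_nonneg _ _ (by positivity), ← ENNReal.rpow_mul,
    mul_one_div_cancel hp.ne', ENNReal.rpow_one]
  ring

theorem morreyFun_zero {n : ℕ} {p : ℝ} (hp : 0 < p) (u : ℝ) :
    morreyFun (n := n) p u (fun _ => 0) = 0 := by
  have := morreyFun_const_mul (n := n) hp u 0 (g := fun _ => 0) aemeasurable_const
  simpa using this

theorem morreyFun_sum_le {n : ℕ} {p : ℝ} (hp : 1 ≤ p) (u : ℝ) {ι : Type*} (s : Finset ι)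
    {g : ι → EuclideanSpace ℝ (Fin n) → ℝ≥0∞} (hg : ∀ i, AEMeasurable (g i)) :
    morreyFun p u (fun x => ∑ i ∈ s, g i x) ≤ ∑ i ∈ s, morreyFun p u (g i) := by
  classical
  induction s using Finset.induction_on with
  | empty => simp [morreyFun_zero (n := n) (by linarith : 0 < p) u]
  | insert a s ha ih =>
    simp only [Finset.sum_insert ha]
    refine (morreyFun_add_le hp u (hg a) (Finset.aemeasurable_fun_sum s fun i _ => hg i)).trans ?_
    gcongr

/-- Raising to a positive power is an order isomorphism of `[0, ∞]`, hence commutes with the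
supremum over finite partial sums. Monotone convergence then reduces the claim to Minkowski's
inequality for finite sums. -/
theorem morreyFun_tsum_le {n : ℕ} {p : ℝ} (hp : 1 ≤ p) (u : ℝ) {ι : Type*} [Countable ι]
    {g : ι → EuclideanSpace ℝ (Fin n) → ℝ≥0∞} (hg : ∀ i, AEMeasurable (g i)) :
    morreyFun p u (fun x => ∑' i, g i x) ≤ ∑' i, morreyFun p u (g i) := by
  have hp0 : 0 < p := by linarith
  refine iSup_le fun x => iSup_le fun r => iSup_le fun hr => ?_
  have e : ∀ y, (∑' i, g i y) ^ p = ⨆ s : Finset ι, (∑ i ∈ s, g i y) ^ p := fun y => by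
    rw [ENNReal.tsum_eq_iSup_sum]
    exact (ENNReal.orderIsoRpow p hp0).map_iSup _
  simp only [e]
  rw [lintegral_iSup_directed]
  · have : ∀ F : Finset ι → ℝ≥0∞, (⨆ s, F s) ^ (1 / p) = ⨆ s, (F s) ^ (1 / p) := fun F =>
      (ENNReal.orderIsoRpow (1 / p) (by positivity)).map_iSup _
    rw [this, ENNReal.mul_iSup]
    refine iSup_le fun s => ?_
    calc _ ≤ morreyFun p u (fun x => ∑ i ∈ s, g i x) := le_morreyFun p u _ x hr
      _ ≤ _ := morreyFun_sum_le hp u s hg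
      _ ≤ _ := ENNReal.sum_le_tsum s
  · exact fun s => ((Finset.aemeasurable_fun_sum s fun i _ => hg i).pow_const p).restrict
  · refine Monotone.directed_le fun s t hst y => ?_
    dsimp only
    gcongr

theorem volume_ball_pos {n : ℕ} (x : EuclideanSpace ℝ (Fin n)) {r : ℝ} (hr : 0 < r) :
    volume (Metric.ball x r) ≠ 0 := (Metric.measure_ball_pos volume x hr).ne'

theorem volume_ball_ne_top {n : ℕ} (x : EuclideanSpace ℝ (Fin n)) (r : ℝ) :
    volume (Metric.ball x r) ≠ ∞ := measure_ball_lt_top.ne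

theorem volume_ball_scale {n : ℕ} (x : EuclideanSpace ℝ (Fin n)) {r : ℝ} (hr : 0 < r) :
    volume (Metric.ball x r) =
      ENNReal.ofReal (r ^ (n : ℝ)) * volume (Metric.ball (0 : EuclideanSpace ℝ (Fin n)) 1) := by
  rw [Measure.addHaar_ball_of_pos _ _ hr, finrank_euclideanSpace_fin, Real.rpow_natCast]

theorem volume_ball_rpow {n : ℕ} (x : EuclideanSpace ℝ (Fin n)) {r : ℝ} (hr : 0 < r) (a : ℝ) :
    volume (Metric.ball x r) ^ a =
      ENNReal.ofReal (r ^ (n * a)) *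
        volume (Metric.ball (0 : EuclideanSpace ℝ (Fin n)) 1) ^ a := by
  rw [volume_ball_scale x hr, ENNReal.mul_rpow_of_ne_top ENNReal.ofReal_ne_top
    (volume_ball_ne_top _ _), ENNReal.ofReal_rpow_of_pos (by positivity), Real.rpow_mul hr.le]

theorem setLIntegral_rpow_le_morreyFun {n : ℕ} (p u : ℝ)
    (g : EuclideanSpace ℝ (Fin n) → ℝ≥0∞) (x : EuclideanSpace ℝ (Fin n)) {r : ℝ} (hr : 0 < r) :
    (∫⁻ y in Metric.ball x r, g y ^ p) ^ (1 / p) ≤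
      volume (Metric.ball x r) ^ (1 / p - 1 / u) * morreyFun p u g := by
  have h := le_morreyFun p u g x hr
  have h0 := volume_ball_pos x hr
  have h1 := volume_ball_ne_top x r
  calc _ = volume (Metric.ball x r) ^ (1 / p - 1 / u) *
        (volume (Metric.ball x r) ^ (1 / u - 1 / p) *
          (∫⁻ y in Metric.ball x r, g y ^ p) ^ (1 / p)) := by
        rw [← mul_assoc, ← ENNReal.rpow_add _ _ h0 h1]
        simp
    _ ≤ _ := by gcongr

/-- Hölder's inequality on a subset of a ball. -/
theorem setLIntegral_le_morreyFun {n : ℕ} {p : ℝ} (hp : 1 ≤ p) (u : ℝ)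
    {g : EuclideanSpace ℝ (Fin n) → ℝ≥0∞} (hg : AEMeasurable g)
    (x : EuclideanSpace ℝ (Fin n)) {r : ℝ} (hr : 0 < r)
    {S : Set (EuclideanSpace ℝ (Fin n))} (hS : S ⊆ Metric.ball x r) :
    ∫⁻ y in S, g y ≤ volume S ^ (1 - 1 / p) *
      (volume (Metric.ball x r) ^ (1 / p - 1 / u) * morreyFun p u g) := by
  have hp0 : 0 < p := by linarith
  have h := ENNReal.lintegral_mul_norm_pow_le (μ := volume.restrict S) (f := fun y => g y ^ p)
    (g := fun _ => 1) (hg.pow_const p).restrict aemeasurable_const (p := 1 / p) (q := 1 - 1 / p)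
    (by positivity) (by rw [sub_nonneg, div_le_one hp0]; exact hp) (by ring)
  simp only [← ENNReal.rpow_mul, mul_one_div_cancel hp0.ne', ENNReal.rpow_one, ENNReal.one_rpow,
    mul_one, lintegral_const, Measure.restrict_apply_univ, one_mul] at h
  refine h.trans ?_
  rw [mul_comm]
  gcongr
  refine le_trans ?_ (setLIntegral_rpow_le_morreyFun p u g x hr)
  gcongr

/-- A finite norm bounds the integral over every unit ball, so local integrability is automatic and
membership becomes a pure norm condition. -/
theorem mem_morreySpace_iff {n : ℕ} {p : ℝ} (hp : 0 < p) (u : ℝ) (f : FunSpace n) :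
    f ∈ morreySpace n p u ↔ morreyNorm p u f < ∞ := by
  refine ⟨fun h => h.2, fun h => ⟨?_, h⟩⟩
  intro x
  refine ⟨Metric.ball x 1, Metric.ball_mem_nhds x one_pos, ?_, ?_⟩
  · exact (f.aestronglyMeasurable.norm.aemeasurable.pow_const p).aestronglyMeasurable.restrict
  · have h1 := setLIntegral_rpow_le_morreyFun p u (fun y => ‖f y‖ₑ) x one_pos
    have h2 : (∫⁻ y in Metric.ball x 1, ‖f y‖ₑ ^ p) ^ (1 / p) < ∞ := by
      refine h1.trans_lt (ENNReal.mul_lt_top ?_ h)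
      exact lt_top_iff_ne_top.2
        (ENNReal.rpow_ne_top_of_ne_zero (volume_ball_pos x one_pos) (volume_ball_ne_top x 1))
    rw [ENNReal.rpow_lt_top_iff_of_pos (by positivity)] at h2
    refine lt_of_le_of_lt (le_of_eq ?_) h2
    refine lintegral_congr fun y => ?_
    rw [Real.enorm_rpow_of_nonneg (norm_nonneg _) hp.le, enorm_norm]

/-- Allows `[0, ∞]`-valued candidates, such as infinite series, to be realized as elements of
`FunSpace n`. -/
theorem ae_lt_top_of_morreyFun {n : ℕ} {p : ℝ} (hp : 0 < p) (u : ℝ)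
    {g : EuclideanSpace ℝ (Fin n) → ℝ≥0∞} (hg : AEMeasurable g) (h : morreyFun p u g < ∞) :
    ∀ᵐ y, g y < ∞ := by
  have key : ∀ k : ℕ, ∀ᵐ y ∂(volume.restrict
      (Metric.ball (0 : EuclideanSpace ℝ (Fin n)) (k + 1))), g y < ∞ := fun k => by
    have hk : (0 : ℝ) < k + 1 := by positivity
    have h2 : (∫⁻ y in Metric.ball (0 : EuclideanSpace ℝ (Fin n)) (k + 1), g y ^ p) ^ (1 / p)
        < ∞ := by
      refine (setLIntegral_rpow_le_morreyFun p u g 0 hk).trans_lt (ENNReal.mul_lt_top ?_ h)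
      exact lt_top_iff_ne_top.2
        (ENNReal.rpow_ne_top_of_ne_zero (volume_ball_pos _ hk) (volume_ball_ne_top _ _))
    rw [ENNReal.rpow_lt_top_iff_of_pos (by positivity)] at h2
    filter_upwards [ae_lt_top' (hg.pow_const p).restrict h2.ne] with y hy
    rwa [ENNReal.rpow_lt_top_iff_of_pos hp] at hy
  rw [← ae_restrict_iUnion_iff] at key
  have hU : (⋃ k : ℕ, Metric.ball (0 : EuclideanSpace ℝ (Fin n)) (k + 1)) = univ := by
    refine eq_univ_of_forall fun y => mem_iUnion.2 ?_
    obtain ⟨k, hk⟩ := exists_nat_gt ‖y‖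
    exact ⟨k, by rw [mem_ball_zero_iff]; linarith⟩
  rwa [hU, Measure.restrict_univ] at key

/-- A nonnegative function that is finite almost everywhere, as an element of `FunSpace n`. -/
theorem exists_funSpace {n : ℕ} {g : EuclideanSpace ℝ (Fin n) → ℝ≥0∞} (hg : Measurable g)
    (h : ∀ᵐ y, g y < ∞) : ∃ f : FunSpace n, (fun y => ‖f y‖ₑ) =ᵐ[volume] g := by
  have hm : AEStronglyMeasurable
      (fun y => ((g y).toReal : ℂ)) (volume : Measure (EuclideanSpace ℝ (Fin n))) :=
    (Complex.measurable_ofReal.comp hg.ennreal_toReal).aestronglyMeasurable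
  refine ⟨AEEqFun.mk _ hm, ?_⟩
  filter_upwards [AEEqFun.coeFn_mk _ hm, h] with y hy hy2
  rw [hy, ← ofReal_norm, Complex.norm_of_nonneg ENNReal.toReal_nonneg,
    ENNReal.ofReal_toReal hy2.ne]

theorem lintegral_ball_comp_smul {n : ℕ} {b : ℝ} (hb : 0 < b)
    {g : EuclideanSpace ℝ (Fin n) → ℝ≥0∞} (hg : Measurable g)
    (x : EuclideanSpace ℝ (Fin n)) (r : ℝ) :
    ∫⁻ y in Metric.ball x r, g (b • y) =
      ENNReal.ofReal (b ^ (-(n : ℝ))) * ∫⁻ y in Metric.ball (b • x) (b * r), g y := by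
  have hpre : Metric.ball x r = (fun y => b • y) ⁻¹' (Metric.ball (b • x) (b * r)) := by
    ext y
    simp only [Metric.mem_ball, mem_preimage, dist_smul₀, Real.norm_of_nonneg hb.le]
    exact (mul_lt_mul_iff_right₀ hb).symm
  rw [hpre, ← setLIntegral_map measurableSet_ball hg (measurable_const_smul b),
    Measure.map_addHaar_smul _ hb.ne', Measure.restrict_smul, lintegral_smul_measure,
    finrank_euclideanSpace_fin, abs_of_nonneg (by positivity), Real.rpow_neg hb.le,
    Real.rpow_natCast, smul_eq_mul]

/-- Dilations permute the balls, and the powers of `b` containing `p` cancel. Only `u` is left in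
the degree of homogeneity. -/
theorem morreyFun_comp_smul_le {n : ℕ} {p : ℝ} (hp : 0 < p) (u : ℝ) {b : ℝ} (hb : 0 < b)
    {g : EuclideanSpace ℝ (Fin n) → ℝ≥0∞} (hg : Measurable g) :
    morreyFun p u (fun y => g (b • y)) ≤ ENNReal.ofReal (b ^ (-(n / u))) * morreyFun p u g := by
  refine iSup_le fun x => iSup_le fun r => iSup_le fun hr => ?_
  rw [lintegral_ball_comp_smul hb (hg.pow_const p), ENNReal.mul_rpow_of_nonneg _ _ (by positivity)]
  refine le_trans (le_of_eq ?_) (mul_le_mul_right (le_morreyFun p u g (b • x) (mul_pos hb hr)) _)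
  rw [volume_ball_rpow x hr, volume_ball_rpow (b • x) (mul_pos hb hr),
    ENNReal.ofReal_rpow_of_pos (by positivity), ← Real.rpow_mul hb.le,
    Real.mul_rpow hb.le hr.le, ENNReal.ofReal_mul (by positivity)]
  have : ENNReal.ofReal (b ^ (-(n : ℝ) * (1 / p))) =
      ENNReal.ofReal (b ^ (-(n / u))) * ENNReal.ofReal (b ^ (n * (1 / u - 1 / p))) := by
    rw [← ENNReal.ofReal_mul (by positivity), ← Real.rpow_add hb]
    congr 2; ring
  rw [this]
  ring

/-! ### The K-functional and discretization of the interpolation norm -/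

section RealMethodLemmas

variable {V : Type*} [AddCommGroup V]

theorem peetreK_le (X₀ X₁ : Set V) (N₀ N₁ : V → ℝ≥0∞) (t : ℝ) {x x₀ x₁ : V}
    (h₀ : x₀ ∈ X₀) (h₁ : x₁ ∈ X₁) (hx : x = x₀ + x₁) :
    peetreK X₀ X₁ N₀ N₁ t x ≤ N₀ x₀ + ENNReal.ofReal t * N₁ x₁ :=
  iInf₂_le_of_le x₀ h₀ (iInf₂_le_of_le x₁ h₁ (iInf_le _ hx))

theorem le_peetreK (X₀ X₁ : Set V) (N₀ N₁ : V → ℝ≥0∞) (t : ℝ) {x : V} {c : ℝ≥0∞}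
    (h : ∀ x₀ ∈ X₀, ∀ x₁ ∈ X₁, x = x₀ + x₁ → c ≤ N₀ x₀ + ENNReal.ofReal t * N₁ x₁) :
    c ≤ peetreK X₀ X₁ N₀ N₁ t x :=
  le_iInf₂ fun x₀ h₀ => le_iInf₂ fun x₁ h₁ => le_iInf fun hx => h x₀ h₀ x₁ h₁ hx

theorem peetreK_mono (X₀ X₁ : Set V) (N₀ N₁ : V → ℝ≥0∞) {s t : ℝ} (hst : s ≤ t) (x : V) :
    peetreK X₀ X₁ N₀ N₁ s x ≤ peetreK X₀ X₁ N₀ N₁ t x :=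
  le_peetreK _ _ _ _ _ fun x₀ h₀ x₁ h₁ hx =>
    (peetreK_le X₀ X₁ N₀ N₁ s h₀ h₁ hx).trans (by gcongr)

theorem peetreK_le_mul (X₀ X₁ : Set V) (N₀ N₁ : V → ℝ≥0∞) {s t c : ℝ} (hc : 1 ≤ c)
    (hst : t ≤ c * s) (x : V) :
    peetreK X₀ X₁ N₀ N₁ t x ≤ ENNReal.ofReal c * peetreK X₀ X₁ N₀ N₁ s x := by
  have hc0 : ENNReal.ofReal c ≠ 0 := (ENNReal.ofReal_pos.2 (by linarith)).ne'
  rw [← ENNReal.div_le_iff' hc0 ENNReal.ofReal_ne_top]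
  refine le_peetreK _ _ _ _ _ fun x₀ h₀ x₁ h₁ hx => ?_
  rw [ENNReal.div_le_iff' hc0 ENNReal.ofReal_ne_top]
  refine (peetreK_le X₀ X₁ N₀ N₁ t h₀ h₁ hx).trans ?_
  rw [mul_add, ← mul_assoc, ← ENNReal.ofReal_mul (by linarith)]
  gcongr
  exact le_mul_of_one_le_left' (ENNReal.one_le_ofReal.2 hc)

open Classical in
/-- The norm of `ℓ^q(ℤ)`. -/
def lqNorm (q : ℝ≥0∞) (a : ℤ → ℝ≥0∞) : ℝ≥0∞ :=
  if q = ∞ then ⨆ k, a k else (∑' k, a k ^ q.toReal) ^ (1 / q.toReal)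

theorem lqNorm_mono {q : ℝ≥0∞} {a b : ℤ → ℝ≥0∞} (h : ∀ k, a k ≤ b k) :
    lqNorm q a ≤ lqNorm q b := by
  unfold lqNorm
  split_ifs
  · exact iSup_mono h
  · gcongr with k
    exact h k

theorem lqNorm_const_mul {q : ℝ≥0∞} (hq : 0 < q) (c : ℝ≥0∞) (a : ℤ → ℝ≥0∞) :
    lqNorm q (fun k => c * a k) = c * lqNorm q a := by
  unfold lqNorm
  split_ifs with h
  · rw [ENNReal.mul_iSup]
  · have hq' : 0 < q.toReal := ENNReal.toReal_pos hq.ne' h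
    simp only [ENNReal.mul_rpow_of_nonneg _ _ hq'.le]
    rw [ENNReal.tsum_mul_left, ENNReal.mul_rpow_of_nonneg _ _ (by positivity), ← ENNReal.rpow_mul,
      mul_one_div_cancel hq'.ne', ENNReal.rpow_one]

/-- Geometric growth forces the sequence to `∞` on the right and to `0` on the left, so its
consecutive intervals exhaust the positive half-line. -/
theorem exists_int_mem_Ico {τ : ℤ → ℝ} {l : ℝ} (hτ : ∀ k, 0 < τ k) (hl : 1 < l)
    (hτl : ∀ k, l * τ k ≤ τ (k + 1)) {t : ℝ} (ht : 0 < t) :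
    ∃ k, τ k ≤ t ∧ t < τ (k + 1) := by
  have hl0 : 0 < l := by linarith
  have hup : ∀ m : ℕ, ∀ k, l ^ m * τ k ≤ τ (k + m) := fun m => by
    induction m with
    | zero => intro k; simp
    | succ m ih =>
      intro k
      have h1 := ih k
      have h2 := hτl (k + m)
      have e : k + ((m + 1 : ℕ) : ℤ) = k + m + 1 := by push_cast; ring
      rw [e]
      refine le_trans ?_ h2
      rw [pow_succ', mul_assoc]
      gcongr
  have hmono : StrictMono τ := strictMono_int_of_lt_succ fun k =>
    lt_of_lt_of_le (by nlinarith [hτ k]) (hτl k)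
  obtain ⟨m, hm⟩ := pow_unbounded_of_one_lt (t / τ 0) hl
  obtain ⟨m', hm'⟩ := pow_unbounded_of_one_lt (τ 0 / t) hl
  have hM : t < τ m := by
    rw [div_lt_iff₀ (hτ 0)] at hm
    refine hm.trans_le ?_
    simpa using hup m 0
  have hm0 : τ (-m') ≤ t := by
    rw [div_lt_iff₀ ht] at hm'
    have := hup m' (-m')
    rw [neg_add_cancel] at this
    exact le_of_mul_le_mul_left (this.trans hm'.le) (by positivity)
  obtain ⟨k, hk, hk2⟩ := Int.exists_greatest_of_bdd (P := fun k => τ k ≤ t)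
    ⟨m, fun z hz => (hmono.lt_iff_lt.1 (hz.trans_lt hM)).le⟩ ⟨_, hm0⟩
  exact ⟨k, hk, by
    by_contra hcon
    have := hk2 (k + 1) (not_lt.1 hcon)
    omega⟩

/-- Together with the reverse bound below: between neighbouring sample points `t^(-θ) K(t)` changes
by at most a constant factor, because `K(t)` increases while `K(t)/t` decreases. -/
theorem interpWeight_le {X₀ X₁ : Set V} {N₀ N₁ : V → ℝ≥0∞} {θ : ℝ} (hθ₀ : 0 < θ)
    {s t c : ℝ} (hs : 0 < s) (hst : s ≤ t) (hc : t ≤ c * s) (x : V) :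
    ENNReal.ofReal (t ^ (-θ)) * peetreK X₀ X₁ N₀ N₁ t x ≤
      ENNReal.ofReal c * (ENNReal.ofReal (s ^ (-θ)) * peetreK X₀ X₁ N₀ N₁ s x) := by
  have hc1 : 1 ≤ c := by
    by_contra h
    nlinarith
  calc _ ≤ ENNReal.ofReal (s ^ (-θ)) * (ENNReal.ofReal c * peetreK X₀ X₁ N₀ N₁ s x) := by
        refine mul_le_mul' (ENNReal.ofReal_le_ofReal ?_) (peetreK_le_mul _ _ _ _ hc1 hc x)
        exact Real.rpow_le_rpow_of_nonpos hs hst (by linarith)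
    _ = _ := by ring

theorem le_interpWeight {X₀ X₁ : Set V} {N₀ N₁ : V → ℝ≥0∞} {θ : ℝ} (hθ₀ : 0 < θ) (hθ₁ : θ < 1)
    {s t c : ℝ} (hs : 0 < s) (hst : s ≤ t) (hc : t ≤ c * s) (x : V) :
    ENNReal.ofReal (s ^ (-θ)) * peetreK X₀ X₁ N₀ N₁ s x ≤
      ENNReal.ofReal c * (ENNReal.ofReal (t ^ (-θ)) * peetreK X₀ X₁ N₀ N₁ t x) := by
  have hc1 : 1 ≤ c := by
    by_contra h
    nlinarith
  have ht : 0 < t := by linarith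
  rw [← mul_assoc, ← ENNReal.ofReal_mul (by linarith)]
  gcongr
  · have h1 : (t / s) ^ θ ≤ c := by
      calc (t / s) ^ θ ≤ c ^ θ := by
            gcongr
            rwa [div_le_iff₀ hs]
        _ ≤ c ^ (1 : ℝ) := Real.rpow_le_rpow_of_exponent_le hc1 hθ₁.le
        _ = c := Real.rpow_one c
    calc s ^ (-θ) = (t / s) ^ θ * t ^ (-θ) := by
          rw [Real.div_rpow ht.le hs.le, Real.rpow_neg hs.le, Real.rpow_neg ht.le]
          field_simp
      _ ≤ _ := by gcongr
  · exact peetreK_mono _ _ _ _ hst x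

/-- Discretization of the interpolation norm along a sequence of geometric growth. -/
theorem realInterpNorm_discrete {θ : ℝ} (hθ₀ : 0 < θ) (hθ₁ : θ < 1) {q : ℝ≥0∞} (hq : 0 < q)
    {l L : ℝ} (hl : 1 < l) :
    ∃ C : ℝ, 0 < C ∧ ∀ (X₀ X₁ : Set V) (N₀ N₁ : V → ℝ≥0∞) (τ : ℤ → ℝ) (x : V), (∀ k, 0 < τ k) →
      (∀ k, l * τ k ≤ τ (k + 1)) → (∀ k, τ (k + 1) ≤ L * τ k) →
      realInterpNorm X₀ X₁ N₀ N₁ θ q x ≤ ENNReal.ofReal C *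
        lqNorm q (fun k => ENNReal.ofReal (τ k ^ (-θ)) * peetreK X₀ X₁ N₀ N₁ (τ k) x) ∧
      lqNorm q (fun k => ENNReal.ofReal (τ k ^ (-θ)) * peetreK X₀ X₁ N₀ N₁ (τ k) x) ≤
        ENNReal.ofReal C * realInterpNorm X₀ X₁ N₀ N₁ θ q x := by
  -- For `L < 1` no positive sequence satisfies both growth conditions, and the claim is vacuous.
  by_cases hL : 1 ≤ L
  swap
  · refine ⟨1, one_pos, fun X₀ X₁ N₀ N₁ τ x hτ h1 h2 => ?_⟩
    have := h1 0
    have := h2 0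
    nlinarith [hτ 0]
  have hL0 : 0 < L := by linarith
  by_cases hqt : q = ∞
  · refine ⟨L, hL0, fun X₀ X₁ N₀ N₁ τ x hτ h1 h2 => ⟨?_, ?_⟩⟩
    · simp only [realInterpNorm, lqNorm, hqt, if_true]
      refine iSup₂_le fun t ht => ?_
      obtain ⟨k, hk1, hk2⟩ := exists_int_mem_Ico hτ hl h1 ht
      refine (interpWeight_le hθ₀ (hτ k) hk1 (hk2.le.trans (h2 k)) x).trans ?_
      gcongr
      exact le_iSup (fun k => ENNReal.ofReal (τ k ^ (-θ)) * peetreK X₀ X₁ N₀ N₁ (τ k) x) k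
    · simp only [realInterpNorm, lqNorm, hqt, if_true]
      refine iSup_le fun k => ?_
      refine (le_iSup₂ (f := fun (t : ℝ) (_ : 0 < t) =>
        ENNReal.ofReal (t ^ (-θ)) * peetreK X₀ X₁ N₀ N₁ t x) (τ k) (hτ k)).trans ?_
      exact le_mul_of_one_le_left' (ENNReal.one_le_ofReal.2 hL)
  have hq' : 0 < q.toReal := ENNReal.toReal_pos hq.ne' hqt
  set r := q.toReal
  have hl1 : 0 < 1 - 1 / l := by
    rw [sub_pos, div_lt_one (by linarith)]; exact hl
  have hc : 0 < (1 - 1 / l)⁻¹ := by positivity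
  -- On each interval the weight varies by a factor of at most `L`. The `dt/t`-measure of the
  -- interval is at most `L` and at least `1 - 1/l`. The two entries of the maximum are the
  -- resulting constants for the two directions.
  refine ⟨max (L * L ^ (1 / r)) (L * ((1 - 1 / l)⁻¹) ^ (1 / r)), by positivity,
    fun X₀ X₁ N₀ N₁ τ x hτ h1 h2 => ?_⟩
  simp only [realInterpNorm, lqNorm, hqt, if_false]
  change (∫⁻ t in Ioi (0 : ℝ), (ENNReal.ofReal (t ^ (-θ)) * peetreK X₀ X₁ N₀ N₁ t x) ^ r /
    ENNReal.ofReal t) ^ (1 / r) ≤ _ ∧ _ ≤ _ * (∫⁻ t in Ioi (0 : ℝ), (ENNReal.ofReal (t ^ (-θ)) *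
      peetreK X₀ X₁ N₀ N₁ t x) ^ r / ENNReal.ofReal t) ^ (1 / r)
  have hmono : StrictMono τ := strictMono_int_of_lt_succ fun k =>
    lt_of_lt_of_le (by nlinarith [hτ k]) (h1 k)
  have hU : Ioi (0 : ℝ) = ⋃ k, Ico (τ k) (τ (k + 1)) := by
    ext t
    simp only [mem_Ioi, mem_iUnion, mem_Ico]
    exact ⟨fun ht => exists_int_mem_Ico hτ hl h1 ht, fun ⟨k, hk, _⟩ => (hτ k).trans_le hk⟩
  have hD : Pairwise (Function.onFun Disjoint fun k => Ico (τ k) (τ (k + 1))) :=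
    hmono.monotone.pairwise_disjoint_on_Ico_succ
  rw [hU, lintegral_iUnion (fun k => measurableSet_Ico) hD]
  set w := fun t => ENNReal.ofReal (t ^ (-θ)) * peetreK X₀ X₁ N₀ N₁ t x with hw
  have up : ∀ k, ∫⁻ t in Ico (τ k) (τ (k + 1)), w t ^ r / ENNReal.ofReal t ≤
      ENNReal.ofReal (L ^ r * L) * w (τ k) ^ r := fun k => by
    calc _ ≤ ∫⁻ t in Ico (τ k) (τ (k + 1)), (ENNReal.ofReal L * w (τ k)) ^ r /
          ENNReal.ofReal (τ k) := by
          refine setLIntegral_mono' measurableSet_Ico fun t ht => ?_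
          gcongr
          · exact interpWeight_le hθ₀ (hτ k) ht.1 (ht.2.le.trans (h2 k)) x
          · exact ht.1
      _ = (ENNReal.ofReal L * w (τ k)) ^ r * ENNReal.ofReal ((τ (k + 1) - τ k) / τ k) := by
          rw [setLIntegral_const, Real.volume_Ico, ENNReal.ofReal_div_of_pos (hτ k),
            div_eq_mul_inv, div_eq_mul_inv]
          ring
      _ ≤ (ENNReal.ofReal L * w (τ k)) ^ r * ENNReal.ofReal L := by
          gcongr
          rw [div_le_iff₀ (hτ k)]
          linarith [h2 k, hτ k]
      _ = _ := by
          rw [ENNReal.mul_rpow_of_nonneg _ _ hq'.le, ENNReal.ofReal_rpow_of_pos hL0,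
            ENNReal.ofReal_mul (by positivity)]
          ring
  have lo : ∀ k, w (τ k) ^ r ≤ ENNReal.ofReal (L ^ r * (1 - 1 / l)⁻¹) *
      ∫⁻ t in Ico (τ k) (τ (k + 1)), w t ^ r / ENNReal.ofReal t := fun k => by
    have hk1 := hτ (k + 1)
    have step : w (τ k) ^ r * ENNReal.ofReal ((τ (k + 1) - τ k) / τ (k + 1)) ≤
        ENNReal.ofReal (L ^ r) * ∫⁻ t in Ico (τ k) (τ (k + 1)), w t ^ r / ENNReal.ofReal t := by
      calc _ = ∫⁻ t in Ico (τ k) (τ (k + 1)), w (τ k) ^ r / ENNReal.ofReal (τ (k + 1)) := by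
            rw [setLIntegral_const, Real.volume_Ico, ENNReal.ofReal_div_of_pos hk1,
              div_eq_mul_inv, div_eq_mul_inv]
            ring
        _ ≤ ∫⁻ t in Ico (τ k) (τ (k + 1)), ENNReal.ofReal (L ^ r) *
              (w t ^ r / ENNReal.ofReal t) := by
            refine setLIntegral_mono' measurableSet_Ico fun t ht => ?_
            rw [← mul_div_assoc, ← ENNReal.ofReal_rpow_of_pos hL0,
              ← ENNReal.mul_rpow_of_nonneg _ _ hq'.le]
            gcongr
            · exact le_interpWeight hθ₀ hθ₁ (hτ k) ht.1 (ht.2.le.trans (h2 k)) x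
            · exact ht.2.le
        _ = _ := lintegral_const_mul' _ _ ENNReal.ofReal_ne_top
    have hge : 1 - 1 / l ≤ (τ (k + 1) - τ k) / τ (k + 1) := by
      rw [sub_div, div_self hk1.ne']
      refine sub_le_sub_left ?_ _
      rw [div_le_div_iff₀ hk1 (by linarith)]
      linarith [h1 k]
    calc w (τ k) ^ r = ENNReal.ofReal ((1 - 1 / l)⁻¹) *
          (w (τ k) ^ r * ENNReal.ofReal (1 - 1 / l)) := by
          rw [mul_left_comm, ← ENNReal.ofReal_mul hc.le, inv_mul_cancel₀ hl1.ne']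
          simp
      _ ≤ ENNReal.ofReal ((1 - 1 / l)⁻¹) *
          (w (τ k) ^ r * ENNReal.ofReal ((τ (k + 1) - τ k) / τ (k + 1))) := by gcongr
      _ ≤ ENNReal.ofReal ((1 - 1 / l)⁻¹) * (ENNReal.ofReal (L ^ r) *
          ∫⁻ t in Ico (τ k) (τ (k + 1)), w t ^ r / ENNReal.ofReal t) := by gcongr
      _ = _ := by rw [ENNReal.ofReal_mul (by positivity)]; ring
  have rt : ∀ {c : ℝ}, 0 < c → (ENNReal.ofReal (L ^ r * c)) ^ (1 / r) =
      ENNReal.ofReal (L * c ^ (1 / r)) := fun {c} hc => by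
    rw [ENNReal.ofReal_rpow_of_pos (by positivity), Real.mul_rpow (by positivity) hc.le,
      ← Real.rpow_mul hL0.le, mul_one_div_cancel hq'.ne', Real.rpow_one]
  constructor
  · calc _ ≤ (∑' k, ENNReal.ofReal (L ^ r * L) * w (τ k) ^ r) ^ (1 / r) := by
          gcongr with k; exact up k
      _ = ENNReal.ofReal (L * L ^ (1 / r)) * (∑' k, w (τ k) ^ r) ^ (1 / r) := by
          rw [ENNReal.tsum_mul_left, ENNReal.mul_rpow_of_nonneg _ _ (by positivity), rt hL0]
      _ ≤ _ := by gcongr; exact le_max_left _ _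
  · calc _ ≤ (∑' k, ENNReal.ofReal (L ^ r * (1 - 1 / l)⁻¹) *
          ∫⁻ t in Ico (τ k) (τ (k + 1)), w t ^ r / ENNReal.ofReal t) ^ (1 / r) := by
          gcongr with k; exact lo k
      _ = ENNReal.ofReal (L * ((1 - 1 / l)⁻¹) ^ (1 / r)) *
          (∑' k, ∫⁻ t in Ico (τ k) (τ (k + 1)), w t ^ r / ENNReal.ofReal t) ^ (1 / r) := by
          rw [ENNReal.tsum_mul_left, ENNReal.mul_rpow_of_nonneg _ _ (by positivity), rt hc]
      _ ≤ _ := by gcongr; exact le_max_right _ _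

end RealMethodLemmas

/-! ### Decompositions of a function and its K-functional -/

theorem morreyNorm_add_le {n : ℕ} {p : ℝ} (hp : 1 ≤ p) (u : ℝ) (f g : FunSpace n) :
    morreyNorm p u (f + g) ≤ morreyNorm p u f + morreyNorm p u g := by
  rw [morreyNorm_eq, morreyNorm_eq, morreyNorm_eq]
  refine le_trans (morreyFun_mono_ae (by linarith) u ?_) (morreyFun_add_le hp u
    f.aestronglyMeasurable.enorm g.aestronglyMeasurable.enorm)
  filter_upwards [AEEqFun.coeFn_add f g] with y hy
  rw [hy]
  exact enorm_add_le _ _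

/-- A function dominated by a sum of two nonnegative functions splits accordingly. -/
theorem exists_decomposition {n : ℕ} {p₀ p₁ : ℝ} (hp₀ : 0 < p₀) (hp₁ : 0 < p₁) (u₀ u₁ : ℝ)
    (f : FunSpace n) {g₀ g₁ : EuclideanSpace ℝ (Fin n) → ℝ≥0∞}
    (hg₀ : Measurable g₀) (hg₁ : Measurable g₁)
    (hf : ∀ᵐ y, ‖f y‖ₑ ≤ g₀ y + g₁ y) :
    ∃ f₀ f₁ : FunSpace n, f = f₀ + f₁ ∧ morreyNorm p₀ u₀ f₀ ≤ 2 * morreyFun p₀ u₀ g₀ ∧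
      morreyNorm p₁ u₁ f₁ ≤ 2 * morreyFun p₁ u₁ g₁ := by
  -- At each point the whole value of `f` is given to the larger majorant, which doubled still
  -- dominates it.
  set S := {y | g₁ y ≤ g₀ y}
  have hS : MeasurableSet S := measurableSet_le hg₁ hg₀
  have m₀ : AEStronglyMeasurable (S.indicator f) (volume : Measure (EuclideanSpace ℝ (Fin n))) :=
    f.aestronglyMeasurable.indicator hS
  have m₁ : AEStronglyMeasurable (Sᶜ.indicator f) (volume : Measure (EuclideanSpace ℝ (Fin n))) :=
    f.aestronglyMeasurable.indicator hS.compl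
  refine ⟨AEEqFun.mk _ m₀, AEEqFun.mk _ m₁, ?_, ?_, ?_⟩
  · refine AEEqFun.ext ?_
    filter_upwards [AEEqFun.coeFn_add (AEEqFun.mk _ m₀) (AEEqFun.mk _ m₁),
      AEEqFun.coeFn_mk _ m₀, AEEqFun.coeFn_mk _ m₁] with y h1 h2 h3
    rw [h1, Pi.add_apply, h2, h3]
    exact (congrFun (indicator_self_add_compl S f) y).symm
  · rw [morreyNorm_eq, ← morreyFun_const_mul hp₀ u₀ 2 hg₀.aemeasurable]
    refine morreyFun_mono_ae hp₀ u₀ ?_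
    filter_upwards [hf, AEEqFun.coeFn_mk _ m₀] with y h1 h2
    rw [h2]
    by_cases hy : y ∈ S
    · rw [indicator_of_mem hy, two_mul]
      exact h1.trans (by gcongr; exact hy)
    · simp [indicator_of_notMem hy]
  · rw [morreyNorm_eq, ← morreyFun_const_mul hp₁ u₁ 2 hg₁.aemeasurable]
    refine morreyFun_mono_ae hp₁ u₁ ?_
    filter_upwards [hf, AEEqFun.coeFn_mk _ m₁] with y h1 h2
    rw [h2]
    by_cases hy : y ∈ S
    · simp [indicator_of_notMem (show y ∉ Sᶜ from fun h => h hy)]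
    · rw [indicator_of_mem (show y ∈ Sᶜ from hy), two_mul]
      refine h1.trans ?_
      gcongr
      exact (not_le.1 hy).le

/-- Reduces upper bounds for `K` to pointwise majorants. One pair `g₀`, `g₁` serves all `t` at once.
-/
theorem morrey_peetreK_le {n : ℕ} {p₀ p₁ : ℝ} (hp₀ : 0 < p₀) (hp₁ : 0 < p₁) (u₀ u₁ : ℝ)
    (f : FunSpace n) {g₀ g₁ : EuclideanSpace ℝ (Fin n) → ℝ≥0∞}
    (hg₀ : Measurable g₀) (hg₁ : Measurable g₁)
    (hf : ∀ᵐ y, ‖f y‖ₑ ≤ g₀ y + g₁ y)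
    (h₀ : morreyFun p₀ u₀ g₀ < ∞) (h₁ : morreyFun p₁ u₁ g₁ < ∞) :
    (∃ x₀ ∈ morreySpace n p₀ u₀, ∃ x₁ ∈ morreySpace n p₁ u₁, f = x₀ + x₁) ∧ ∀ t : ℝ,
    peetreK (morreySpace n p₀ u₀) (morreySpace n p₁ u₁) (morreyNorm p₀ u₀) (morreyNorm p₁ u₁) t f
      ≤ 2 * (morreyFun p₀ u₀ g₀ + ENNReal.ofReal t * morreyFun p₁ u₁ g₁) := by
  obtain ⟨f₀, f₁, hf, e₀, e₁⟩ := exists_decomposition hp₀ hp₁ u₀ u₁ f hg₀ hg₁ hf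
  have m₀ : f₀ ∈ morreySpace n p₀ u₀ :=
    (mem_morreySpace_iff hp₀ u₀ f₀).2 (e₀.trans_lt (ENNReal.mul_lt_top (by simp) h₀))
  have m₁ : f₁ ∈ morreySpace n p₁ u₁ :=
    (mem_morreySpace_iff hp₁ u₁ f₁).2 (e₁.trans_lt (ENNReal.mul_lt_top (by simp) h₁))
  refine ⟨⟨f₀, m₀, f₁, m₁, hf⟩, fun t => ?_⟩
  refine (peetreK_le _ _ _ _ t m₀ m₁ hf).trans ?_
  calc _ ≤ 2 * morreyFun p₀ u₀ g₀ + ENNReal.ofReal t * (2 * morreyFun p₁ u₁ g₁) := by gcongr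
    _ = _ := by ring

theorem setLIntegral_enorm_add_le {n : ℕ} (f₀ f₁ : FunSpace n)
    (S : Set (EuclideanSpace ℝ (Fin n))) :
    ∫⁻ y in S, ‖(f₀ + f₁) y‖ₑ ≤ (∫⁻ y in S, ‖f₀ y‖ₑ) + ∫⁻ y in S, ‖f₁ y‖ₑ := by
  rw [← lintegral_add_left' f₀.aestronglyMeasurable.enorm.restrict]
  refine lintegral_mono_ae (ae_restrict_of_ae ?_)
  filter_upwards [AEEqFun.coeFn_add f₀ f₁] with y hy
  rw [hy]
  exact enorm_add_le _ _

/-! ### Sequence norms and geometric sums over the integers -/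

theorem le_lqNorm {q : ℝ≥0∞} (hq : 0 < q) (a : ℤ → ℝ≥0∞) (k : ℤ) : a k ≤ lqNorm q a := by
  unfold lqNorm
  split_ifs with h
  · exact le_iSup a k
  · have hq' : 0 < q.toReal := ENNReal.toReal_pos hq.ne' h
    calc a k = (a k ^ q.toReal) ^ (1 / q.toReal) := by
          rw [← ENNReal.rpow_mul, mul_one_div_cancel hq'.ne', ENNReal.rpow_one]
      _ ≤ _ := by
          gcongr
          exact ENNReal.le_tsum k

theorem tsum_natAbs_le (F : ℕ → ℝ≥0∞) : ∑' k : ℤ, F k.natAbs ≤ 2 * ∑' m, F m := by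
  rw [tsum_of_nat_of_neg_add_one ENNReal.summable ENNReal.summable, two_mul]
  refine add_le_add ?_ ?_
  · simp
  · calc ∑' m : ℕ, F (-((m : ℤ) + 1)).natAbs = ∑' m : ℕ, F (m + 1) := by
          refine tsum_congr fun m => ?_
          congr 1
      _ ≤ _ := ENNReal.tsum_comp_le_tsum_of_injective (add_left_injective 1) F

theorem tsum_pow_natAbs_lt_top {x : ℝ} (hx : x < 1) :
    ∑' k : ℤ, ENNReal.ofReal x ^ k.natAbs < ∞ := by
  refine (tsum_natAbs_le _).trans_lt (ENNReal.mul_lt_top (by simp) ?_)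
  rw [ENNReal.tsum_geometric]
  refine ENNReal.inv_lt_top.2 (tsub_pos_of_lt ?_)
  rwa [← ENNReal.ofReal_one, ENNReal.ofReal_lt_ofReal_iff one_pos]

/-- The minimum is bounded by `1` for `k ≥ 0`, leaving decay at rate `η`, and by `2^k` for `k ≤ 0`,
leaving decay at rate `1 - η`. The worse rate serves both sides. -/
theorem two_rpow_mul_min_le {η : ℝ} (hη₀ : 0 < η) (hη₁ : η < 1) (k : ℤ) :
    (2 : ℝ) ^ (-(k * η)) * min 1 (2 ^ (k : ℝ)) ≤
      (2 ^ (-min η (1 - η)) : ℝ) ^ k.natAbs := by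
  have e : ((2 ^ (-min η (1 - η)) : ℝ)) ^ k.natAbs = 2 ^ (-min η (1 - η) * |(k : ℝ)|) := by
    rw [Real.rpow_mul (by norm_num), ← Int.cast_abs, Int.abs_eq_natAbs, Int.cast_natCast,
      Real.rpow_natCast]
  rw [e]
  rcases le_total 0 k with hk | hk
  · have hk' : (0 : ℝ) ≤ k := by exact_mod_cast hk
    calc _ ≤ (2 : ℝ) ^ (-(k * η)) * 1 := by gcongr; exact min_le_left _ _
      _ ≤ _ := by
        rw [mul_one, abs_of_nonneg hk']
        refine Real.rpow_le_rpow_of_exponent_le (by norm_num) ?_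
        nlinarith [min_le_left η (1 - η)]
  · have hk' : (k : ℝ) ≤ 0 := by exact_mod_cast hk
    calc _ ≤ (2 : ℝ) ^ (-(k * η)) * 2 ^ (k : ℝ) := by gcongr; exact min_le_right _ _
      _ ≤ _ := by
        rw [← Real.rpow_add (by norm_num), abs_of_nonpos hk']
        refine Real.rpow_le_rpow_of_exponent_le (by norm_num) ?_
        nlinarith [min_le_right η (1 - η)]

theorem two_rpow_neg_min_lt_one {η : ℝ} (hη₀ : 0 < η) (hη₁ : η < 1) :
    (2 ^ (-min η (1 - η)) : ℝ) < 1 :=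
  Real.rpow_lt_one_of_one_lt_of_neg (by norm_num)
    (by rw [neg_lt_zero]; exact lt_min hη₀ (by linarith))

theorem tsum_two_rpow_mul_min_lt_top {η : ℝ} (hη₀ : 0 < η) (hη₁ : η < 1) :
    ∑' k : ℤ, ENNReal.ofReal ((2 : ℝ) ^ (-(k * η)) * min 1 (2 ^ (k : ℝ))) < ∞ := by
  refine lt_of_le_of_lt (ENNReal.tsum_le_tsum fun k => ?_)
    (tsum_pow_natAbs_lt_top (two_rpow_neg_min_lt_one hη₀ hη₁))
  rw [← ENNReal.ofReal_pow (by positivity)]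
  exact ENNReal.ofReal_le_ofReal (two_rpow_mul_min_le hη₀ hη₁ k)

theorem lqNorm_two_rpow_mul_min_lt_top {θ : ℝ} (hθ₀ : 0 < θ) (hθ₁ : θ < 1) {q : ℝ≥0∞}
    (hq : 0 < q) :
    lqNorm q (fun k : ℤ => ENNReal.ofReal ((2 : ℝ) ^ (-(k * θ)) * min 1 (2 ^ (k : ℝ)))) < ∞ := by
  set x : ℝ := 2 ^ (-min θ (1 - θ))
  have hx0 : 0 < x := by positivity
  have hx1 : x < 1 := two_rpow_neg_min_lt_one hθ₀ hθ₁
  have hle : ∀ k : ℤ, ENNReal.ofReal ((2 : ℝ) ^ (-(k * θ)) * min 1 (2 ^ (k : ℝ))) ≤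
      ENNReal.ofReal (x ^ k.natAbs) :=
    fun k => ENNReal.ofReal_le_ofReal (two_rpow_mul_min_le hθ₀ hθ₁ k)
  refine (lqNorm_mono hle).trans_lt ?_
  unfold lqNorm
  split_ifs with h
  · refine lt_of_le_of_lt (iSup_le fun k => ?_) ENNReal.one_lt_top
    exact ENNReal.ofReal_le_one.2 (pow_le_one₀ hx0.le hx1.le)
  · have hq' : 0 < q.toReal := ENNReal.toReal_pos hq.ne' h
    refine ENNReal.rpow_lt_top_of_nonneg (by positivity) (ne_of_lt ?_)
    have e : ∀ k : ℤ, ENNReal.ofReal (x ^ k.natAbs) ^ q.toReal =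
        ENNReal.ofReal (x ^ q.toReal) ^ k.natAbs := fun k => by
      rw [ENNReal.ofReal_rpow_of_pos (by positivity), ← ENNReal.ofReal_pow (by positivity),
        ← Real.rpow_natCast, ← Real.rpow_mul hx0.le, mul_comm, Real.rpow_mul hx0.le,
        Real.rpow_natCast]
    simp only [e]
    exact tsum_pow_natAbs_lt_top (Real.rpow_lt_one hx0.le hx1 hq')

/-! ### Case (a): a space interpolated with itself -/

theorem zero_mem_morreySpace {n : ℕ} {p : ℝ} (hp : 0 < p) (u : ℝ) :
    (0 : FunSpace n) ∈ morreySpace n p u ∧ morreyNorm p u (0 : FunSpace n) = 0 := by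
  have : morreyNorm p u (0 : FunSpace n) = 0 := by
    rw [morreyNorm_eq, ← morreyFun_zero (n := n) hp u]
    refine morreyFun_congr_ae hp u ?_
    filter_upwards [AEEqFun.coeFn_zero (α := EuclideanSpace ℝ (Fin n)) (β := ℂ) (μ := volume)]
      with y hy
    rw [hy]
    simp
  exact ⟨(mem_morreySpace_iff hp u 0).2 (by rw [this]; exact ENNReal.zero_lt_top), this⟩

theorem two_zpow_discrete (k : ℤ) : (2 : ℝ) * 2 ^ (k : ℝ) = 2 ^ ((k + 1 : ℤ) : ℝ) := by
  push_cast
  rw [Real.rpow_add (by norm_num), Real.rpow_one]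
  ring

/-- Interpolating a Morrey space with itself. -/
theorem morreyInterpNorm_self {n : ℕ} {p u θ : ℝ} (hp : 1 ≤ p) (hθ₀ : 0 < θ) (hθ₁ : θ < 1)
    {q : ℝ≥0∞} (hq : 0 < q) :
    ∃ C : ℝ, 0 < C ∧ ∀ f : FunSpace n,
      ((∃ x₀ ∈ morreySpace n p u, ∃ x₁ ∈ morreySpace n p u, f = x₀ + x₁) ∨
        morreyNorm p u f < ∞) →
      (∃ x₀ ∈ morreySpace n p u, ∃ x₁ ∈ morreySpace n p u, f = x₀ + x₁) ∧
      morreyInterpNorm p u p u θ q f ≤ ENNReal.ofReal C * morreyNorm p u f ∧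
      morreyNorm p u f ≤ ENNReal.ofReal C * morreyInterpNorm p u p u θ q f := by
  have hp0 : 0 < p := by linarith
  obtain ⟨C, hC, hd⟩ := realInterpNorm_discrete (V := FunSpace n) hθ₀ hθ₁ hq
    (l := 2) (L := 2) (by norm_num)
  set D := lqNorm q
    (fun k : ℤ => ENNReal.ofReal ((2 : ℝ) ^ (-(k * θ)) * min 1 (2 ^ (k : ℝ)))) with hD
  have hDt : D < ∞ := lqNorm_two_rpow_mul_min_lt_top hθ₀ hθ₁ hq
  -- `D` is the `ℓ^q` norm of the model sequence produced by `K(t, f) ≤ min(1, t) ‖f‖`. The summand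
  -- `1` makes the same constant dominate `C`, which is what the reverse estimate needs.
  refine ⟨C * (D.toReal + 1), by positivity, fun f hf => ?_⟩
  obtain ⟨z, z0⟩ := zero_mem_morreySpace (n := n) hp0 u
  have hfin : f ∈ morreySpace n p u := by
    rw [mem_morreySpace_iff hp0]
    rcases hf with ⟨x₀, h₀, x₁, h₁, rfl⟩ | hf
    · exact (morreyNorm_add_le hp u x₀ x₁).trans_lt (ENNReal.add_lt_top.2 ⟨h₀.2, h₁.2⟩)
    · exact hf
  obtain ⟨up, lo⟩ := hd (morreySpace n p u) (morreySpace n p u) (morreyNorm p u) (morreyNorm p u)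
    (fun k => 2 ^ (k : ℝ)) f (fun k => by positivity) (fun k => (two_zpow_discrete k).le)
    (fun k => (two_zpow_discrete k).ge)
  refine ⟨⟨f, hfin, 0, z, by simp⟩, ?_, ?_⟩
  · refine up.trans ?_
    rw [ENNReal.ofReal_mul hC.le, mul_assoc]
    gcongr
    calc _ ≤ lqNorm q (fun k : ℤ => morreyNorm p u f *
          ENNReal.ofReal ((2 : ℝ) ^ (-(k * θ)) * min 1 (2 ^ (k : ℝ)))) := by
          refine lqNorm_mono fun k => ?_
          have h1 := peetreK_le (morreySpace n p u) (morreySpace n p u) (morreyNorm p u)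
            (morreyNorm p u) (2 ^ (k : ℝ)) hfin z (show f = f + 0 by simp)
          have h2 := peetreK_le (morreySpace n p u) (morreySpace n p u) (morreyNorm p u)
            (morreyNorm p u) (2 ^ (k : ℝ)) z hfin (show f = 0 + f by simp)
          rw [z0, mul_zero, add_zero] at h1
          rw [z0, zero_add] at h2
          rw [ENNReal.ofReal_mul (by positivity), ← Real.rpow_mul (by norm_num), mul_neg]
          rw [mul_left_comm]
          gcongr
          rcases min_choice (1 : ℝ) (2 ^ (k : ℝ)) with h | h <;> rw [h]
          · simpa using h1
          · rwa [mul_comm]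
      _ = D * morreyNorm p u f := by rw [lqNorm_const_mul hq, mul_comm]
      _ ≤ _ := by
          gcongr
          rw [ENNReal.le_ofReal_iff_toReal_le hDt.ne (by positivity)]
          linarith
  -- By the triangle inequality the norm is at most `K(1, f)`, which is the sample with index `0`.
  · calc morreyNorm p u f ≤ peetreK (morreySpace n p u) (morreySpace n p u) (morreyNorm p u)
          (morreyNorm p u) 1 f := by
          refine le_peetreK _ _ _ _ _ fun x₀ _ x₁ _ hx => ?_
          rw [hx]
          simpa using morreyNorm_add_le hp u x₀ x₁
      _ ≤ _ := by
          have := le_lqNorm hq (fun k : ℤ => ENNReal.ofReal (((2 : ℝ) ^ (k : ℝ)) ^ (-θ)) *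
            peetreK (morreySpace n p u) (morreySpace n p u) (morreyNorm p u)
            (morreyNorm p u) (2 ^ (k : ℝ)) f) 0
          simpa using this
      _ ≤ _ := lo
      _ ≤ _ := by
          unfold morreyInterpNorm
          gcongr
          nlinarith [ENNReal.toReal_nonneg (a := D)]

/-! ### Case (b): Lebesgue spaces and the power form of the K-functional -/

theorem morreyFun_self {n : ℕ} {p : ℝ} (hp : 0 < p)
    (g : EuclideanSpace ℝ (Fin n) → ℝ≥0∞) :
    morreyFun p p g = (∫⁻ y, g y ^ p) ^ (1 / p) := by
  apply le_antisymm
  · refine iSup_le fun x => iSup_le fun r => iSup_le fun hr => ?_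
    rw [sub_self, ENNReal.rpow_zero, one_mul]
    gcongr
    exact Measure.restrict_le_self
  · have hU : (⋃ k : ℕ, Metric.ball (0 : EuclideanSpace ℝ (Fin n)) (k + 1)) = univ := by
      refine eq_univ_of_forall fun y => mem_iUnion.2 ?_
      obtain ⟨k, hk⟩ := exists_nat_gt ‖y‖
      exact ⟨k, by rw [mem_ball_zero_iff]; linarith⟩
    have hdir : Directed (· ⊆ ·)
        (fun k : ℕ => Metric.ball (0 : EuclideanSpace ℝ (Fin n)) (k + 1)) :=
      Monotone.directed_le fun a b hab => Metric.ball_subset_ball (by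
        have : (a : ℝ) ≤ b := by exact_mod_cast hab
        linarith)
    have h := setLIntegral_iUnion_of_directed (μ := volume) (fun y => g y ^ p) hdir
    rw [hU, Measure.restrict_univ] at h
    rw [h, show (⨆ k : ℕ, ∫⁻ y in Metric.ball (0 : EuclideanSpace ℝ (Fin n)) (k + 1), g y ^ p)
      ^ (1 / p) = ⨆ k : ℕ, (∫⁻ y in Metric.ball (0 : EuclideanSpace ℝ (Fin n)) (k + 1),
        g y ^ p) ^ (1 / p) from (ENNReal.orderIsoRpow (1 / p) (by positivity)).map_iSup _]
    refine iSup_le fun k => ?_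
    refine le_trans (le_of_eq ?_)
      (le_morreyFun p p g 0 (r := (k : ℝ) + 1) (by positivity))
    rw [sub_self, ENNReal.rpow_zero, one_mul]

/-- The functional `∫ min (g^p₀, s g^p₁)`, equivalent to a power of the `K`-functional of
`(L^p₀, L^p₁)`. -/
def powerK {n : ℕ} (p₀ p₁ : ℝ) (s : ℝ) (g : EuclideanSpace ℝ (Fin n) → ℝ≥0∞) : ℝ≥0∞ :=
  ∫⁻ y, min (g y ^ p₀) (ENNReal.ofReal s * g y ^ p₁)

theorem powerK_mono {n : ℕ} (p₀ p₁ : ℝ) {s t : ℝ} (hst : s ≤ t)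
    (g : EuclideanSpace ℝ (Fin n) → ℝ≥0∞) : powerK p₀ p₁ s g ≤ powerK p₀ p₁ t g :=
  lintegral_mono fun y => by gcongr

theorem powerK_two_mul {n : ℕ} (p₀ p₁ : ℝ) (s : ℝ)
    (g : EuclideanSpace ℝ (Fin n) → ℝ≥0∞) :
    powerK p₀ p₁ (2 * s) g ≤ 2 * powerK p₀ p₁ s g := by
  unfold powerK
  rw [← lintegral_const_mul' _ _ (by simp)]
  refine lintegral_mono fun y => ?_
  rw [ENNReal.ofReal_mul (by norm_num), ENNReal.ofReal_ofNat, mul_min, mul_assoc]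
  exact min_le_min_right _ (le_mul_of_one_le_left' (by norm_num))

/-- Let `2^m ≤ c < 2^(m+1)`. The single term `k = -m` gives the lower bound. Shifting the summation
index by `m + 1` compares the sum with the one for `c = 1` and gives the upper bound. -/
theorem two_rpow_mul_min_scale {η : ℝ} (hη₀ : 0 < η) (hη₁ : η < 1) {c : ℝ} (hc : 0 < c) :
    ENNReal.ofReal (c ^ η) ≤
      2 * ∑' k : ℤ, ENNReal.ofReal ((2 : ℝ) ^ (-(k * η)) * min 1 (2 ^ (k : ℝ) * c)) ∧
    ∑' k : ℤ, ENNReal.ofReal ((2 : ℝ) ^ (-(k * η)) * min 1 (2 ^ (k : ℝ) * c)) ≤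
      2 * (∑' k : ℤ, ENNReal.ofReal ((2 : ℝ) ^ (-(k * η)) * min 1 (2 ^ (k : ℝ)))) *
        ENNReal.ofReal (c ^ η) := by
  obtain ⟨m, hm1, hm2⟩ := exists_mem_Ico_zpow (y := (2 : ℝ)) hc (by norm_num)
  rw [← Real.rpow_intCast] at hm1 hm2
  have h2 : (2 : ℝ) ^ ((m + 1 : ℤ) : ℝ) = 2 * 2 ^ (m : ℝ) := (two_zpow_discrete m).symm
  have h2η : (2 : ℝ) ^ η ≤ 2 := by
    calc (2 : ℝ) ^ η ≤ 2 ^ (1 : ℝ) := Real.rpow_le_rpow_of_exponent_le (by norm_num) hη₁.le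
      _ = 2 := Real.rpow_one 2
  constructor
  · refine le_trans ?_ (mul_le_mul_right (ENNReal.le_tsum (-m)) _)
    rw [← ENNReal.ofReal_ofNat, ← ENNReal.ofReal_mul (by norm_num)]
    refine ENNReal.ofReal_le_ofReal ?_
    have : (1 : ℝ) ≤ 2 ^ ((-m : ℤ) : ℝ) * c := by
      push_cast
      rw [Real.rpow_neg (by norm_num)]
      rwa [← div_eq_inv_mul, one_le_div (by positivity)]
    rw [min_eq_left this, mul_one]
    calc c ^ η ≤ (2 * 2 ^ (m : ℝ)) ^ η := by rw [← h2]; gcongr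
      _ = 2 ^ η * 2 ^ (m * η) := by
        rw [Real.mul_rpow (by norm_num) (by positivity), ← Real.rpow_mul (by norm_num)]
      _ ≤ 2 * 2 ^ (m * η) := by gcongr
      _ = _ := by push_cast; ring_nf
  · rw [← (Equiv.addRight (m + 1)).tsum_eq
      (fun k : ℤ => ENNReal.ofReal ((2 : ℝ) ^ (-(k * η)) * min 1 (2 ^ (k : ℝ)))),
      ← ENNReal.tsum_mul_left, ← ENNReal.tsum_mul_right]
    refine ENNReal.tsum_le_tsum fun k => ?_
    rw [← ENNReal.ofReal_ofNat, ← ENNReal.ofReal_mul (by norm_num),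
      ← ENNReal.ofReal_mul (by positivity)]
    refine ENNReal.ofReal_le_ofReal ?_
    simp only [Equiv.coe_addRight]
    have e1 : (2 : ℝ) ^ ((k + (m + 1) : ℤ) : ℝ) = 2 ^ (k : ℝ) * (2 * 2 ^ (m : ℝ)) := by
      rw [← h2, ← Real.rpow_add (by norm_num)]; push_cast; ring_nf
    have e2 : (2 : ℝ) ^ (-(((k + (m + 1) : ℤ) : ℝ) * η)) =
        2 ^ (-(k * η)) * ((2 * 2 ^ (m : ℝ)) ^ η)⁻¹ := by
      rw [← h2, ← Real.rpow_mul (by norm_num), ← Real.rpow_neg (by norm_num),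
        ← Real.rpow_add (by norm_num)]
      push_cast; ring_nf
    rw [e1, e2]
    have hpos : (0 : ℝ) < (2 * 2 ^ (m : ℝ)) ^ η := by positivity
    have hX : (2 * 2 ^ (m : ℝ)) ^ η ≤ 2 * c ^ η := by
      calc (2 * 2 ^ (m : ℝ)) ^ η = 2 ^ η * (2 ^ (m : ℝ)) ^ η :=
            Real.mul_rpow (by norm_num) (by positivity)
        _ ≤ 2 * c ^ η := by gcongr
    have hY : 1 ≤ 2 * c ^ η * ((2 * 2 ^ (m : ℝ)) ^ η)⁻¹ := by
      rwa [← div_eq_mul_inv, one_le_div hpos]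
    have hmin : min 1 (2 ^ (k : ℝ) * c) ≤ min 1 (2 ^ (k : ℝ) * (2 * 2 ^ (m : ℝ))) := by
      refine min_le_min_left _ ?_
      rw [← h2]
      gcongr
    calc _ ≤ (2 : ℝ) ^ (-(k * η)) * min 1 (2 ^ (k : ℝ) * (2 * 2 ^ (m : ℝ))) := by gcongr
      _ ≤ (2 : ℝ) ^ (-(k * η)) * min 1 (2 ^ (k : ℝ) * (2 * 2 ^ (m : ℝ))) *
          (2 * c ^ η * ((2 * 2 ^ (m : ℝ)) ^ η)⁻¹) := le_mul_of_one_le_right (by positivity) hY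
      _ = _ := by ring

/-- Factor out `a^p₀` and apply the scaling estimate with `c = a^(p₁ - p₀)`. The relation for `p`
says precisely that `a^p₀ c^η = a^p`. -/
theorem tsum_min_rpow_equiv {p₀ p₁ p η : ℝ} (hp₀ : 0 < p₀) (hp₁ : 0 < p₁) (hp : 0 < p)
    (hη₀ : 0 < η) (hη₁ : η < 1) (hpη : p = (1 - η) * p₀ + η * p₁) {a : ℝ≥0∞} (ha : a ≠ ∞) :
    a ^ p ≤ 2 * ∑' k : ℤ, ENNReal.ofReal ((2 : ℝ) ^ (-(k * η))) *
      min (a ^ p₀) (ENNReal.ofReal (2 ^ (k : ℝ)) * a ^ p₁) ∧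
    ∑' k : ℤ, ENNReal.ofReal ((2 : ℝ) ^ (-(k * η))) *
      min (a ^ p₀) (ENNReal.ofReal (2 ^ (k : ℝ)) * a ^ p₁) ≤
      2 * (∑' k : ℤ, ENNReal.ofReal ((2 : ℝ) ^ (-(k * η)) * min 1 (2 ^ (k : ℝ)))) * a ^ p := by
  rcases eq_or_ne a 0 with rfl | ha0
  · simp [hp₀, hp₁, hp]
  obtain ⟨x, rfl⟩ : ∃ x : ℝ, a = ENNReal.ofReal x := ⟨a.toReal, (ENNReal.ofReal_toReal ha).symm⟩
  have hx : 0 < x := ENNReal.ofReal_pos.1 (pos_iff_ne_zero.2 ha0)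
  have e : ∀ k : ℤ, ENNReal.ofReal ((2 : ℝ) ^ (-(k * η))) *
      min (ENNReal.ofReal x ^ p₀) (ENNReal.ofReal (2 ^ (k : ℝ)) * ENNReal.ofReal x ^ p₁) =
      ENNReal.ofReal (x ^ p₀) *
        ENNReal.ofReal ((2 : ℝ) ^ (-(k * η)) * min 1 (2 ^ (k : ℝ) * x ^ (p₁ - p₀))) := fun k => by
    rw [ENNReal.ofReal_rpow_of_pos hx, ENNReal.ofReal_rpow_of_pos hx,
      ← ENNReal.ofReal_mul (by positivity), ← ENNReal.ofReal_min,
      ← ENNReal.ofReal_mul (by positivity), ← ENNReal.ofReal_mul (by positivity)]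
    congr 1
    rw [mul_left_comm, mul_min_of_nonneg _ _ (by positivity : 0 ≤ x ^ p₀), mul_one,
      Real.rpow_sub hx]
    congr 2
    field_simp
  have e2 : ENNReal.ofReal x ^ p =
      ENNReal.ofReal (x ^ p₀) * ENNReal.ofReal ((x ^ (p₁ - p₀)) ^ η) := by
    rw [ENNReal.ofReal_rpow_of_pos hx, ← ENNReal.ofReal_mul (by positivity),
      ← Real.rpow_mul hx.le, ← Real.rpow_add hx, hpη]
    ring_nf
  simp only [e, ENNReal.tsum_mul_left, e2]
  obtain ⟨h1, h2⟩ := two_rpow_mul_min_scale hη₀ hη₁ (c := x ^ (p₁ - p₀)) (by positivity)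
  constructor
  · calc _ ≤ ENNReal.ofReal (x ^ p₀) * (2 * _) := by gcongr
      _ = _ := by ring
  · calc _ ≤ ENNReal.ofReal (x ^ p₀) * (2 * _ * _) := by gcongr
      _ = _ := by ring

theorem tsum_powerK_equiv {n : ℕ} {p₀ p₁ p η : ℝ} (hp₀ : 0 < p₀) (hp₁ : 0 < p₁) (hp : 0 < p)
    (hη₀ : 0 < η) (hη₁ : η < 1) (hpη : p = (1 - η) * p₀ + η * p₁)
    {g : EuclideanSpace ℝ (Fin n) → ℝ≥0∞} (hg : Measurable g) (hgt : ∀ y, g y ≠ ∞) :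
    ∫⁻ y, g y ^ p ≤ 2 * ∑' k : ℤ, ENNReal.ofReal ((2 : ℝ) ^ (-(k * η))) *
      powerK p₀ p₁ (2 ^ (k : ℝ)) g ∧
    ∑' k : ℤ, ENNReal.ofReal ((2 : ℝ) ^ (-(k * η))) * powerK p₀ p₁ (2 ^ (k : ℝ)) g ≤
      2 * (∑' k : ℤ, ENNReal.ofReal ((2 : ℝ) ^ (-(k * η)) * min 1 (2 ^ (k : ℝ)))) *
        ∫⁻ y, g y ^ p := by
  have e : ∑' k : ℤ, ENNReal.ofReal ((2 : ℝ) ^ (-(k * η))) * powerK p₀ p₁ (2 ^ (k : ℝ)) g =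
      ∫⁻ y, ∑' k : ℤ, ENNReal.ofReal ((2 : ℝ) ^ (-(k * η))) *
      min (g y ^ p₀) (ENNReal.ofReal (2 ^ (k : ℝ)) * g y ^ p₁) := by
    rw [lintegral_tsum fun k => by fun_prop]
    refine tsum_congr fun k => ?_
    rw [powerK, lintegral_const_mul' _ _ ENNReal.ofReal_ne_top]
  rw [e]
  constructor
  · rw [← lintegral_const_mul' _ _ (by simp)]
    exact lintegral_mono fun y => (tsum_min_rpow_equiv hp₀ hp₁ hp hη₀ hη₁ hpη (hgt y)).1
  · rw [← lintegral_const_mul _ (hg.pow_const p)]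
    exact lintegral_mono fun y => (tsum_min_rpow_equiv hp₀ hp₁ hp hη₀ hη₁ hpη (hgt y)).2

/-- Pointwise `|f|` is at most twice the larger of `|f₀|` and `|f₁|`. Whichever it is, the matching
entry of the minimum is controlled. -/
theorem powerK_le_of_decomposition {n : ℕ} {p₀ p₁ : ℝ} (hp₀ : 0 < p₀) (hp₁ : 0 < p₁)
    (s : ℝ) {f f₀ f₁ : FunSpace n} (hf : f = f₀ + f₁) :
    powerK p₀ p₁ s (fun y => ‖f y‖ₑ) ≤ (2 * morreyNorm p₀ p₀ f₀) ^ p₀ +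
      ENNReal.ofReal s * (2 * morreyNorm p₁ p₁ f₁) ^ p₁ := by
  have e : ∀ {p : ℝ}, 0 < p → ∀ f : FunSpace n,
      (2 * morreyNorm p p f) ^ p = ∫⁻ y, (2 * ‖f y‖ₑ) ^ p := fun {p} hp f => by
    rw [morreyNorm_eq, ← morreyFun_const_mul hp p 2 f.aestronglyMeasurable.enorm,
      morreyFun_self hp, ← ENNReal.rpow_mul, one_div_mul_cancel hp.ne', ENNReal.rpow_one]
  rw [e hp₀, e hp₁, ← lintegral_const_mul' _ _ ENNReal.ofReal_ne_top, ← lintegral_add_left'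
    ((f₀.aestronglyMeasurable.enorm.const_mul 2).pow_const p₀)]
  refine lintegral_mono_ae ?_
  filter_upwards [AEEqFun.coeFn_add f₀ f₁] with y hy
  have hle : ‖f y‖ₑ ≤ ‖f₀ y‖ₑ + ‖f₁ y‖ₑ := by
    rw [hf, hy]; exact enorm_add_le _ _
  rcases le_total ‖f₁ y‖ₑ ‖f₀ y‖ₑ with h | h
  · refine (min_le_left _ _).trans (le_add_right ?_)
    gcongr
    rw [two_mul]
    exact hle.trans (by gcongr)
  · refine (min_le_right _ _).trans (le_add_left ?_)
    gcongr
    rw [two_mul]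
    exact hle.trans (by gcongr)

/-- Cut `f` according to which entry of the minimum is smaller. Each piece then integrates to at
most `powerK`, up to the factor `s⁻¹` for the second. -/
theorem exists_decomposition_powerK {n : ℕ} {p₀ p₁ : ℝ} (hp₀ : 0 < p₀) (hp₁ : 0 < p₁)
    {s : ℝ} (hs : 0 < s) (f : FunSpace n) :
    ∃ g₀ g₁ : EuclideanSpace ℝ (Fin n) → ℝ≥0∞, Measurable g₀ ∧ Measurable g₁ ∧
      (∀ y, ‖f y‖ₑ ≤ g₀ y + g₁ y) ∧
      morreyFun p₀ p₀ g₀ ≤ powerK p₀ p₁ s (fun y => ‖f y‖ₑ) ^ (1 / p₀) ∧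
      morreyFun p₁ p₁ g₁ ≤
        (ENNReal.ofReal s⁻¹ * powerK p₀ p₁ s (fun y => ‖f y‖ₑ)) ^ (1 / p₁) := by
  have hm : Measurable (fun y => ‖f y‖ₑ) := f.stronglyMeasurable.measurable.enorm
  set S := {y | ‖f y‖ₑ ^ p₀ ≤ ENNReal.ofReal s * ‖f y‖ₑ ^ p₁}
  have hS : MeasurableSet S := measurableSet_le (hm.pow_const _) ((hm.pow_const _).const_mul _)
  refine ⟨S.indicator fun y => ‖f y‖ₑ, Sᶜ.indicator fun y => ‖f y‖ₑ, hm.indicator hS,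
    hm.indicator hS.compl, fun y => ?_, ?_, ?_⟩
  · exact (congrFun (indicator_self_add_compl S fun y => ‖f y‖ₑ) y).ge
  · rw [morreyFun_self hp₀]
    gcongr
    refine lintegral_mono fun y => ?_
    by_cases hy : y ∈ S
    · simp only [indicator_of_mem hy]
      exact (min_eq_left hy).ge
    · simp [indicator_of_notMem hy, hp₀]
  · rw [morreyFun_self hp₁]
    gcongr
    rw [powerK, ← lintegral_const_mul' _ _ ENNReal.ofReal_ne_top]
    refine lintegral_mono fun y => ?_
    by_cases hy : y ∈ S
    · simp [indicator_of_notMem (show y ∉ Sᶜ from fun h => h hy), hp₁]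
    · simp only [indicator_of_mem (show y ∈ Sᶜ from hy)]
      rw [min_eq_right (not_le.1 hy).le, ← mul_assoc, ← ENNReal.ofReal_mul (by positivity),
        inv_mul_cancel₀ hs.ne']
      simp

/-- The value of `t` balances the cut decomposition: `‖f₀‖ ≤ l^(1/p₀)` and `t ‖f₁‖ ≤ t (l/s)^(1/p₁)
= l^(1/p₀)`. Conversely, for any decomposition one of the two terms bounding `powerK` is at least
`l/2`, and taking its root gives the lower bound. -/
theorem peetreK_lebesgue_equiv {n : ℕ} {p₀ p₁ : ℝ} (hp₀ : 1 ≤ p₀) (hp₁ : 1 ≤ p₁)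
    (f : FunSpace n) {s l : ℝ} (hs : 0 < s) (hl : 0 < l)
    (h : powerK p₀ p₁ s (fun y => ‖f y‖ₑ) = ENNReal.ofReal l) :
    peetreK (morreySpace n p₀ p₀) (morreySpace n p₁ p₁) (morreyNorm p₀ p₀) (morreyNorm p₁ p₁)
      (l ^ (1 / p₀) * (s / l) ^ (1 / p₁)) f ≤ 4 * ENNReal.ofReal (l ^ (1 / p₀)) ∧
    ENNReal.ofReal (l ^ (1 / p₀)) ≤ 4 * peetreK (morreySpace n p₀ p₀) (morreySpace n p₁ p₁)
      (morreyNorm p₀ p₀) (morreyNorm p₁ p₁) (l ^ (1 / p₀) * (s / l) ^ (1 / p₁)) f := by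
  have hp₀' : 0 < p₀ := by linarith
  have hp₁' : 0 < p₁ := by linarith
  have hsl : (s / l) ^ (1 / p₁) * (s⁻¹ * l) ^ (1 / p₁) = 1 := by
    rw [← Real.mul_rpow (by positivity) (by positivity)]
    have : s / l * (s⁻¹ * l) = 1 := by field_simp
    rw [this, Real.one_rpow]
  constructor
  · obtain ⟨g₀, g₁, m₀, m₁, hfg, e₀, e₁⟩ := exists_decomposition_powerK hp₀' hp₁' hs f
    rw [h, ENNReal.ofReal_rpow_of_pos hl] at e₀
    rw [h, ← ENNReal.ofReal_mul (by positivity), ENNReal.ofReal_rpow_of_pos (by positivity)] at e₁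
    have := (morrey_peetreK_le hp₀' hp₁' p₀ p₁ f m₀ m₁ (Filter.Eventually.of_forall hfg)
      (e₀.trans_lt ENNReal.ofReal_lt_top) (e₁.trans_lt ENNReal.ofReal_lt_top)).2
      (l ^ (1 / p₀) * (s / l) ^ (1 / p₁))
    refine this.trans ?_
    calc _ ≤ 2 * (ENNReal.ofReal (l ^ (1 / p₀)) +
          ENNReal.ofReal (l ^ (1 / p₀) * (s / l) ^ (1 / p₁)) *
            ENNReal.ofReal ((s⁻¹ * l) ^ (1 / p₁))) := by gcongr
      _ = _ := by
        rw [← ENNReal.ofReal_mul (by positivity), mul_assoc, hsl, mul_one]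
        ring
  · rw [← ENNReal.div_le_iff' (by simp) (by simp)]
    refine le_peetreK _ _ _ _ _ fun f₀ h₀ f₁ h₁ hf => ?_
    rw [ENNReal.div_le_iff' (by simp) (by simp)]
    have hle := powerK_le_of_decomposition hp₀' hp₁' s hf
    rw [h] at hle
    obtain ⟨a, ha, ea⟩ : ∃ a : ℝ, 0 ≤ a ∧ morreyNorm p₀ p₀ f₀ = ENNReal.ofReal a :=
      ⟨_, ENNReal.toReal_nonneg, (ENNReal.ofReal_toReal h₀.2.ne).symm⟩
    obtain ⟨b, hb, eb⟩ : ∃ b : ℝ, 0 ≤ b ∧ morreyNorm p₁ p₁ f₁ = ENNReal.ofReal b :=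
      ⟨_, ENNReal.toReal_nonneg, (ENNReal.ofReal_toReal h₁.2.ne).symm⟩
    have t2 : (2 : ℝ≥0∞) = ENNReal.ofReal 2 := by simp
    have t4 : (4 : ℝ≥0∞) = ENNReal.ofReal 4 := by simp
    rw [ea, eb, t2, ← ENNReal.ofReal_mul (by norm_num), ← ENNReal.ofReal_mul (by norm_num),
      ENNReal.ofReal_rpow_of_nonneg (by positivity) hp₀'.le,
      ENNReal.ofReal_rpow_of_nonneg (by positivity) hp₁'.le, ← ENNReal.ofReal_mul hs.le,
      ← ENNReal.ofReal_add (by positivity) (by positivity),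
      ENNReal.ofReal_le_ofReal_iff (by positivity)] at hle
    rw [ea, eb, t4, ← ENNReal.ofReal_mul (by positivity),
      ← ENNReal.ofReal_add (by positivity) (by positivity), ← ENNReal.ofReal_mul (by norm_num)]
    refine ENNReal.ofReal_le_ofReal ?_
    have root : ∀ {P c x : ℝ}, 1 ≤ P → 0 ≤ c → 0 ≤ x → c / 2 ≤ (2 * x) ^ P →
        c ^ (1 / P) ≤ 4 * x := fun {P c x} hP hc hx hcx => by
      have hP0 : 0 < P := by linarith
      calc c ^ (1 / P) ≤ (2 * (2 * x) ^ P) ^ (1 / P) := by gcongr; linarith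
        _ = 2 ^ (1 / P) * (2 * x) := by
          rw [Real.mul_rpow (by norm_num) (by positivity), ← Real.rpow_mul (by positivity),
            mul_one_div_cancel hP0.ne', Real.rpow_one]
        _ ≤ 2 ^ (1 : ℝ) * (2 * x) := by
          gcongr
          · norm_num
          · rw [div_le_one hP0]; exact hP
        _ = 4 * x := by rw [Real.rpow_one]; ring
    have pos : 0 ≤ l ^ (1 / p₀) * (s / l) ^ (1 / p₁) * b := by positivity
    rcases le_total (l / 2) ((2 * a) ^ p₀) with hA | hA
    · linarith [root hp₀ hl.le ha hA]
    · have hB : s⁻¹ * l / 2 ≤ (2 * b) ^ p₁ := by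
        have : l / 2 ≤ s * (2 * b) ^ p₁ := by linarith
        rw [mul_div_assoc, inv_mul_le_iff₀ hs]
        exact this
      have hB' := root hp₁ (by positivity) hb hB
      have : l ^ (1 / p₀) ≤ 4 * (l ^ (1 / p₀) * (s / l) ^ (1 / p₁) * b) := by
        calc l ^ (1 / p₀) = l ^ (1 / p₀) * ((s / l) ^ (1 / p₁) * (s⁻¹ * l) ^ (1 / p₁)) := by
              rw [hsl, mul_one]
          _ ≤ l ^ (1 / p₀) * ((s / l) ^ (1 / p₁) * (4 * b)) := by gcongr
          _ = _ := by ring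
      linarith

/-- Positivity of `p` is not assumed; it follows from that of `1/p`. -/
theorem interp_exponent {p₀ p₁ p θ : ℝ} (hp₀ : 1 ≤ p₀) (hp₁ : 1 ≤ p₁) (hθ₀ : 0 < θ) (hθ₁ : θ < 1)
    (hp : 1 / p = (1 - θ) / p₀ + θ / p₁) : 1 ≤ p := by
  have h1 : (1 - θ) / p₀ ≤ 1 - θ := div_le_self (by linarith) hp₀
  have h2 : θ / p₁ ≤ θ := div_le_self hθ₀.le hp₁
  have h3 : 0 < (1 - θ) / p₀ := div_pos (by linarith) (by linarith)
  have h4 : 0 < θ / p₁ := div_pos hθ₀ (by linarith)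
  have h5 : 0 < 1 / p := by linarith
  have h6 : 0 < p := one_div_pos.1 h5
  rw [← div_le_one h6]
  linarith

/-- With `l' = a l` the quotient of the two expressions is `a^(1/p₀) (2/a)^(1/p₁)`. Both bases lie
in `[1, 2]` and their product is `2`, so lowering both exponents to `1/(p₀ + p₁)` gives the lower
bound. No assumption `p₀ ≠ p₁` is needed. -/
theorem geometric_of_concave {p₀ p₁ s l l' : ℝ} (hp₀ : 1 ≤ p₀) (hp₁ : 1 ≤ p₁) (hs : 0 < s)
    (hl : 0 < l) (h1 : l ≤ l') (h2 : l' ≤ 2 * l) :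
    2 ^ (1 / (p₀ + p₁)) * (l ^ (1 / p₀) * (s / l) ^ (1 / p₁)) ≤
      l' ^ (1 / p₀) * (2 * s / l') ^ (1 / p₁) ∧
    l' ^ (1 / p₀) * (2 * s / l') ^ (1 / p₁) ≤ 4 * (l ^ (1 / p₀) * (s / l) ^ (1 / p₁)) := by
  have hp₀' : 0 < p₀ := by linarith
  have hp₁' : 0 < p₁ := by linarith
  obtain ⟨a, rfl⟩ : ∃ a, l' = a * l := ⟨l' / l, by field_simp⟩
  have ha1 : 1 ≤ a := by
    by_contra h
    nlinarith
  have ha2 : a ≤ 2 := le_of_mul_le_mul_right h2 hl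
  have hb1 : 1 ≤ 2 / a := by rw [le_div_iff₀ (by linarith)]; linarith
  have hb2 : 2 / a ≤ 2 := div_le_self (by norm_num) ha1
  have e : (a * l) ^ (1 / p₀) * (2 * s / (a * l)) ^ (1 / p₁) =
      (a ^ (1 / p₀) * (2 / a) ^ (1 / p₁)) * (l ^ (1 / p₀) * (s / l) ^ (1 / p₁)) := by
    rw [Real.mul_rpow (by linarith) hl.le, show 2 * s / (a * l) = (2 / a) * (s / l) by
      field_simp, Real.mul_rpow (by linarith) (by positivity)]
    ring
  rw [e]
  constructor
  · gcongr
    calc (2 : ℝ) ^ (1 / (p₀ + p₁)) = a ^ (1 / (p₀ + p₁)) * (2 / a) ^ (1 / (p₀ + p₁)) := by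
          rw [← Real.mul_rpow (by linarith) (by linarith)]
          congr 1
          field_simp
      _ ≤ _ := by
          have c₀ : 1 / (p₀ + p₁) ≤ 1 / p₀ := one_div_le_one_div_of_le hp₀' (by linarith)
          have c₁ : 1 / (p₀ + p₁) ≤ 1 / p₁ := one_div_le_one_div_of_le hp₁' (by linarith)
          exact mul_le_mul (Real.rpow_le_rpow_of_exponent_le ha1 c₀)
            (Real.rpow_le_rpow_of_exponent_le hb1 c₁) (by positivity) (by positivity)
  · gcongr
    have up : ∀ {P x : ℝ}, 1 ≤ P → 1 ≤ x → x ≤ 2 → x ^ (1 / P) ≤ 2 := fun {P x} hP hx1 hx2 => by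
      calc x ^ (1 / P) ≤ x ^ (1 : ℝ) := by
            refine Real.rpow_le_rpow_of_exponent_le hx1 ?_
            rw [div_le_one (by linarith)]; exact hP
        _ ≤ 2 := by rwa [Real.rpow_one]
    calc _ ≤ (2 : ℝ) * 2 := by
          gcongr
          · exact up hp₀ ha1 ha2
          · exact up hp₁ hb1 hb2
      _ = 4 := by norm_num

/-- Interpolating Lebesgue spaces with the natural third parameter. -/
theorem lebesgueInterpNorm_equiv {n : ℕ} {p₀ p₁ p θ : ℝ} (hp₀ : 1 ≤ p₀) (hp₁ : 1 ≤ p₁)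
    (hθ₀ : 0 < θ) (hθ₁ : θ < 1) (hpθ : 1 / p = (1 - θ) / p₀ + θ / p₁) :
    ∃ C : ℝ, 0 < C ∧ ∀ f : FunSpace n,
      ((∃ x₀ ∈ morreySpace n p₀ p₀, ∃ x₁ ∈ morreySpace n p₁ p₁, f = x₀ + x₁) ∨
        morreyNorm p p f < ∞) →
      (∃ x₀ ∈ morreySpace n p₀ p₀, ∃ x₁ ∈ morreySpace n p₁ p₁, f = x₀ + x₁) ∧
      morreyInterpNorm p₀ p₀ p₁ p₁ θ (ENNReal.ofReal p) f ≤ ENNReal.ofReal C * morreyNorm p p f ∧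
      morreyNorm p p f ≤
        ENNReal.ofReal C * morreyInterpNorm p₀ p₀ p₁ p₁ θ (ENNReal.ofReal p) f := by
  have hp := interp_exponent hp₀ hp₁ hθ₀ hθ₁ hpθ
  have hp₀' : 0 < p₀ := by linarith
  have hp₁' : 0 < p₁ := by linarith
  have hp' : 0 < p := by linarith
  have hq : 0 < ENNReal.ofReal p := ENNReal.ofReal_pos.2 hp'
  -- Multiplying the relation for `1/p` by `p` splits `1` into `1 - η = p(1 - θ)/p₀` and `η =
  -- pθ/p₁`. Hence `p` is the convex combination of `p₀` and `p₁` with weight `η`.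
  set η := p * θ / p₁ with hη
  have hsplit : 1 = p * (1 - θ) / p₀ + η := by
    have := congrArg (p * ·) hpθ
    simp only [mul_one_div_cancel hp'.ne'] at this
    exact this.trans (by rw [hη]; ring)
  have hη₀ : 0 < η := by positivity
  have hη₁ : η < 1 := by
    have : 0 < p * (1 - θ) / p₀ := div_pos (mul_pos hp' (by linarith)) hp₀'
    linarith
  have hpη : p = (1 - η) * p₀ + η * p₁ := by
    have h1 : 1 - η = p * (1 - θ) / p₀ := by linarith
    rw [h1, hη, div_mul_cancel₀ _ hp₀'.ne', div_mul_cancel₀ _ hp₁'.ne']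
    ring
  obtain ⟨C, hC, hd⟩ := realInterpNorm_discrete (V := FunSpace n) hθ₀ hθ₁ hq
    (l := 2 ^ (1 / (p₀ + p₁))) (L := 4) (Real.one_lt_rpow (by norm_num) (by positivity))
  set D := ∑' k : ℤ, ENNReal.ofReal ((2 : ℝ) ^ (-(k * η)) * min 1 (2 ^ (k : ℝ))) with hD
  have hDt : D < ∞ := tsum_two_rpow_mul_min_lt_top hη₀ hη₁
  refine ⟨C * 4 * (2 + 2 * D.toReal), by positivity, fun f hf => ?_⟩
  set g : EuclideanSpace ℝ (Fin n) → ℝ≥0∞ := fun y => ‖f y‖ₑ with hg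
  have hgm : Measurable g := f.stronglyMeasurable.measurable.enorm
  have hgt : ∀ y, g y ≠ ∞ := fun y => enorm_ne_top
  obtain ⟨T1, T2⟩ := tsum_powerK_equiv hp₀' hp₁' hp' hη₀ hη₁ hpη hgm hgt
  have hNf : morreyNorm p p f = (∫⁻ y, g y ^ p) ^ (1 / p) := by
    rw [morreyNorm_eq, morreyFun_self hp']
  have fin : ∀ k : ℤ, powerK p₀ p₁ (2 ^ (k : ℝ)) g < ∞ := fun k => by
    rcases hf with ⟨x₀, h₀, x₁, h₁, hx⟩ | hf
    · refine (powerK_le_of_decomposition hp₀' hp₁' _ hx).trans_lt (ENNReal.add_lt_top.2 ⟨?_, ?_⟩)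
      · exact ENNReal.rpow_lt_top_of_nonneg hp₀'.le
          (ENNReal.mul_lt_top ENNReal.ofNat_lt_top h₀.2).ne
      · exact ENNReal.mul_lt_top ENNReal.ofReal_lt_top (ENNReal.rpow_lt_top_of_nonneg hp₁'.le
          (ENNReal.mul_lt_top ENNReal.ofNat_lt_top h₁.2).ne)
    · rw [hNf, ENNReal.rpow_lt_top_iff_of_pos (by positivity)] at hf
      have h1 := (ENNReal.le_tsum k).trans_lt (T2.trans_lt
        (ENNReal.mul_lt_top (ENNReal.mul_lt_top ENNReal.ofNat_lt_top hDt) hf))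
      refine lt_top_iff_ne_top.2 fun htop => h1.ne ?_
      rw [htop, ENNReal.mul_top]
      exact (ENNReal.ofReal_pos.2 (by positivity)).ne'
  refine ⟨?_, ?_⟩
  · obtain ⟨g₀, g₁, m₀, m₁, hfg, e₀, e₁⟩ := exists_decomposition_powerK hp₀' hp₁' one_pos f
    have f1 := fin 0
    simp only [Int.cast_zero, Real.rpow_zero] at f1
    refine (morrey_peetreK_le hp₀' hp₁' p₀ p₁ f m₀ m₁ (Filter.Eventually.of_forall hfg)
      (e₀.trans_lt ?_) (e₁.trans_lt ?_)).1
    · exact ENNReal.rpow_lt_top_of_nonneg (by positivity) f1.ne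
    · exact ENNReal.rpow_lt_top_of_nonneg (by positivity)
        (ENNReal.mul_lt_top ENNReal.ofReal_lt_top f1).ne
  -- The sample points below involve division by `l k`. If one of these numbers vanishes, then `f =
  -- 0`.
  by_cases hzero : ∃ k : ℤ, powerK p₀ p₁ (2 ^ (k : ℝ)) g = 0
  · obtain ⟨k, hk⟩ := hzero
    have hf0 : f = 0 := by
      unfold powerK at hk
      rw [lintegral_eq_zero_iff (by fun_prop)] at hk
      refine AEEqFun.ext ?_
      filter_upwards [hk, AEEqFun.coeFn_zero (α := EuclideanSpace ℝ (Fin n)) (β := ℂ)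
        (μ := volume)] with y hy h0
      rw [h0]
      have hpos : ENNReal.ofReal (2 ^ (k : ℝ)) ≠ 0 := (ENNReal.ofReal_pos.2 (by positivity)).ne'
      have hgy : g y = 0 := by
        simp only [Pi.zero_apply] at hy
        rcases min_eq_bot.1 hy with h | h
        · exact (ENNReal.rpow_eq_zero_iff_of_pos hp₀').1 h
        · exact (ENNReal.rpow_eq_zero_iff_of_pos hp₁').1
            ((mul_eq_zero.1 h).resolve_left hpos)
      simpa [hg] using hgy
    obtain ⟨z₀, n₀⟩ := zero_mem_morreySpace (n := n) hp₀' p₀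
    obtain ⟨z₁, n₁⟩ := zero_mem_morreySpace (n := n) hp₁' p₁
    have K0 : ∀ t, peetreK (morreySpace n p₀ p₀) (morreySpace n p₁ p₁) (morreyNorm p₀ p₀)
        (morreyNorm p₁ p₁) t f = 0 := fun t => by
      have := peetreK_le (morreySpace n p₀ p₀) (morreySpace n p₁ p₁) (morreyNorm p₀ p₀)
        (morreyNorm p₁ p₁) t z₀ z₁ (show f = 0 + 0 by rw [hf0, add_zero])
      rw [n₀, n₁, mul_zero, add_zero] at this
      exact le_antisymm this bot_le
    have I0 : morreyInterpNorm p₀ p₀ p₁ p₁ θ (ENNReal.ofReal p) f = 0 := by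
      simp [morreyInterpNorm, realInterpNorm, K0, ENNReal.toReal_ofReal hp'.le, hp']
    rw [I0, show morreyNorm p p f = 0 by rw [hf0]; exact (zero_mem_morreySpace hp' p).2]
    simp
  · push Not at hzero
    set l : ℤ → ℝ := fun k => (powerK p₀ p₁ (2 ^ (k : ℝ)) g).toReal with hl
    have hl0 : ∀ k, 0 < l k := fun k => ENNReal.toReal_pos (hzero k) (fin k).ne
    have hll : ∀ k : ℤ, powerK p₀ p₁ (2 ^ (k : ℝ)) g = ENNReal.ofReal (l k) := fun k =>
      (ENNReal.ofReal_toReal (fin k).ne).symm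
    have hl1 : ∀ k, l k ≤ l (k + 1) := fun k =>
      ENNReal.toReal_mono (fin _).ne (powerK_mono p₀ p₁ (by
        rw [← two_zpow_discrete]
        have : (0 : ℝ) < 2 ^ (k : ℝ) := by positivity
        linarith) g)
    have hl2 : ∀ k, l (k + 1) ≤ 2 * l k := fun k => by
      have := powerK_two_mul p₀ p₁ (2 ^ (k : ℝ)) g
      rw [two_zpow_discrete, hll, hll, ← ENNReal.ofReal_ofNat,
        ← ENNReal.ofReal_mul (by norm_num)] at this
      exact (ENNReal.ofReal_le_ofReal_iff (by linarith [hl0 k])).1 this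
    -- The interpolation norm is sampled at the balanced values of `t` belonging to `s = 2^k`, not
    -- at powers of two. `geometric_of_concave` makes this sequence admissible for the
    -- discretization.
    set τ : ℤ → ℝ := fun k => l k ^ (1 / p₀) * (2 ^ (k : ℝ) / l k) ^ (1 / p₁) with hτ
    have hτ0 : ∀ k, 0 < τ k := fun k => by have := hl0 k; positivity
    have hgeo := fun k : ℤ => geometric_of_concave hp₀ hp₁
      (show (0 : ℝ) < 2 ^ (k : ℝ) by positivity) (hl0 k) (hl1 k) (hl2 k)
    obtain ⟨up, lo⟩ := hd (morreySpace n p₀ p₀) (morreySpace n p₁ p₁) (morreyNorm p₀ p₀)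
      (morreyNorm p₁ p₁) τ f hτ0
      (fun k => by have := (hgeo k).1; rwa [two_zpow_discrete] at this)
      (fun k => by have := (hgeo k).2; rwa [two_zpow_discrete] at this)
    -- `b k` is the size of `τ^(-θ) K(τ)` at `τ = τ k` up to the factor `4`, and `b k ^ p` is
    -- exactly `2^(-kη)` times `powerK` at `2^k`.
    set b : ℤ → ℝ≥0∞ := fun k => ENNReal.ofReal (l k ^ (1 / p) * 2 ^ (-(k * (θ / p₁)))) with hb
    have hbτ : ∀ k, b k = ENNReal.ofReal (τ k ^ (-θ)) * ENNReal.ofReal (l k ^ (1 / p₀)) :=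
      fun k => by
      have h := hl0 k
      rw [← ENNReal.ofReal_mul (by positivity)]
      simp only [hb, hτ]
      congr 1
      rw [Real.mul_rpow (by positivity) (by positivity), ← Real.rpow_mul h.le,
        ← Real.rpow_mul (by positivity), Real.div_rpow (by positivity) h.le,
        ← Real.rpow_mul (by norm_num), div_eq_mul_inv (2 ^ _) (l k ^ _), ← Real.rpow_neg h.le, hpθ]
      have : l k ^ ((1 - θ) / p₀ + θ / p₁) =
          l k ^ (1 / p₀ * -θ) * l k ^ (-(1 / p₁ * -θ)) * l k ^ (1 / p₀) := by
        rw [← Real.rpow_add h, ← Real.rpow_add h]; congr 1; ring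
      rw [this, show -((k : ℝ) * (θ / p₁)) = k * (1 / p₁ * -θ) by ring]
      ring
    have w1 : ∀ k, ENNReal.ofReal (τ k ^ (-θ)) * peetreK (morreySpace n p₀ p₀)
        (morreySpace n p₁ p₁) (morreyNorm p₀ p₀) (morreyNorm p₁ p₁) (τ k) f ≤ 4 * b k :=
      fun k => by
      rw [hbτ, mul_left_comm]
      gcongr
      exact (peetreK_lebesgue_equiv hp₀ hp₁ f (by positivity) (hl0 k) (hll k)).1
    have w2 : ∀ k, b k ≤ 4 * (ENNReal.ofReal (τ k ^ (-θ)) * peetreK (morreySpace n p₀ p₀)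
        (morreySpace n p₁ p₁) (morreyNorm p₀ p₀) (morreyNorm p₁ p₁) (τ k) f) := fun k => by
      rw [hbτ, mul_left_comm]
      gcongr
      exact (peetreK_lebesgue_equiv hp₀ hp₁ f (by positivity) (hl0 k) (hll k)).2
    have hbs : lqNorm (ENNReal.ofReal p) b =
        (∑' k : ℤ, ENNReal.ofReal ((2 : ℝ) ^ (-(k * η))) * powerK p₀ p₁ (2 ^ (k : ℝ)) g)
          ^ (1 / p) := by
      unfold lqNorm
      rw [if_neg ENNReal.ofReal_ne_top, ENNReal.toReal_ofReal hp'.le]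
      congr 1
      refine tsum_congr fun k => ?_
      have h := hl0 k
      rw [hll, hb, ENNReal.ofReal_rpow_of_nonneg (by positivity) hp'.le,
        ← ENNReal.ofReal_mul (by positivity), Real.mul_rpow (by positivity) (by positivity),
        ← Real.rpow_mul h.le, ← Real.rpow_mul (by norm_num), one_div_mul_cancel hp'.ne',
        Real.rpow_one, mul_comm, hη]
      congr 3
      ring
    -- The form `2 + x` keeps the constant at least `1`, so that it dominates its own `p`-th root.
    have root : ∀ x : ℝ, 0 ≤ x → (ENNReal.ofReal (2 + x)) ^ (1 / p) ≤ ENNReal.ofReal (2 + x) :=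
      fun x hx => by
      calc _ ≤ (ENNReal.ofReal (2 + x)) ^ (1 : ℝ) := by
            refine ENNReal.rpow_le_rpow_of_exponent_le ?_ ?_
            · exact ENNReal.one_le_ofReal.2 (by linarith)
            · rw [div_le_one hp']; exact hp
        _ = _ := ENNReal.rpow_one _
    have hD0 : 0 ≤ D.toReal := ENNReal.toReal_nonneg
    have hDD : 2 * D ≤ ENNReal.ofReal (2 + 2 * D.toReal) := by
      rw [ENNReal.ofReal_add (by norm_num) (by positivity), ENNReal.ofReal_mul (by norm_num),
        ENNReal.ofReal_toReal hDt.ne, ENNReal.ofReal_ofNat]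
      exact le_add_self
    have e4 : ENNReal.ofReal (C * 4 * (2 + 2 * D.toReal)) =
        ENNReal.ofReal C * (4 * ENNReal.ofReal (2 + 2 * D.toReal)) := by
      rw [ENNReal.ofReal_mul (by positivity), ENNReal.ofReal_mul hC.le, ENNReal.ofReal_ofNat,
        mul_assoc]
    rw [e4, hNf]
    constructor
    · calc _ ≤ _ := up
        _ ≤ ENNReal.ofReal C * (4 * lqNorm (ENNReal.ofReal p) b) := by
          gcongr
          rw [← lqNorm_const_mul hq]
          exact lqNorm_mono w1
        _ ≤ ENNReal.ofReal C * (4 * (ENNReal.ofReal (2 + 2 * D.toReal) *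
              (∫⁻ y, g y ^ p) ^ (1 / p))) := by
          gcongr
          rw [hbs]
          calc _ ≤ (ENNReal.ofReal (2 + 2 * D.toReal) * ∫⁻ y, g y ^ p) ^ (1 / p) := by
                gcongr
                exact T2.trans (by gcongr)
            _ ≤ _ := by
                rw [ENNReal.mul_rpow_of_nonneg _ _ (by positivity)]
                gcongr
                exact root _ (by positivity)
        _ = _ := by ring
    · calc _ ≤ (ENNReal.ofReal (2 + 0) * ∑' k : ℤ, ENNReal.ofReal ((2 : ℝ) ^ (-(k * η))) *
            powerK p₀ p₁ (2 ^ (k : ℝ)) g) ^ (1 / p) := by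
            gcongr
            simpa using T1
        _ ≤ ENNReal.ofReal (2 + 0) * lqNorm (ENNReal.ofReal p) b := by
          rw [ENNReal.mul_rpow_of_nonneg _ _ (by positivity), hbs]
          gcongr
          exact root 0 le_rfl
        _ ≤ ENNReal.ofReal (2 + 2 * D.toReal) * (4 *
            (ENNReal.ofReal C * morreyInterpNorm p₀ p₀ p₁ p₁ θ (ENNReal.ofReal p) f)) := by
          gcongr
          · positivity
          · refine (lqNorm_mono w2).trans ?_
            rw [lqNorm_const_mul hq]
            gcongr
            exact lo
        _ = _ := by ring

/-! ### Sparse sets and averages over them -/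

/-- A set of real numbers that is `γ`-dimensional at all scales `≥ 1`. -/
theorem exists_sparse_real {γ : ℝ} (hγ₀ : 0 ≤ γ) (hγ₁ : γ ≤ 1) :
    ∃ A : Set ℝ, MeasurableSet A ∧
      (∀ x R : ℝ, 1 ≤ R → ∃ Z : Finset ℝ, (Z.card : ℝ) ≤ 3 * R ^ γ ∧
        A ∩ Icc x (x + R) ⊆ ⋃ z ∈ Z, Icc z (z + 1)) ∧
      (∀ R : ℝ, 1 ≤ R → ENNReal.ofReal (1 / 2 * R ^ γ) ≤ volume (A ∩ Icc 0 R)) := by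
  rcases hγ₀.eq_or_lt with rfl | hγ₀
  · refine ⟨Icc 0 1, measurableSet_Icc, fun x R hR => ⟨{0}, by simp, ?_⟩, fun R hR => ?_⟩
    · simp only [Finset.mem_singleton, iUnion_iUnion_eq_left, zero_add]
      exact inter_subset_left
    · rw [inter_eq_self_of_subset_left (Icc_subset_Icc le_rfl hR), Real.volume_Icc]
      exact ENNReal.ofReal_le_ofReal (by norm_num)
  -- Unit intervals are placed at the points `k^s`, about `R^γ` of which lie in `[0, R]`.
  -- Superadditivity of `x^s` gives `(k - k₀)^s ≤ k^s - k₀^s`, so no other window of length `R` is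
  -- essentially more crowded.
  set s := 1 / γ with hs
  have hs1 : 1 ≤ s := by rw [hs, le_div_iff₀ hγ₀]; linarith
  have hs0 : 0 < s := by linarith
  have hroot : ∀ {x y : ℝ}, 0 ≤ x → 0 ≤ y → (x ^ s ≤ y ↔ x ≤ y ^ γ) := fun {x y} hx hy => by
    have : γ = s⁻¹ := by rw [hs]; field_simp
    rw [this, Real.le_rpow_inv_iff_of_pos hx hy hs0]
  have hsuper : ∀ a b : ℕ, a ≤ b → ((b - a : ℕ) : ℝ) ^ s + (a : ℝ) ^ s ≤ (b : ℝ) ^ s :=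
    fun a b hab => by
    have := Real.add_rpow_le_rpow_add (a := ((b - a : ℕ) : ℝ)) (b := a) (by positivity)
      (by positivity) hs1
    rwa [← Nat.cast_add, Nat.sub_add_cancel hab] at this
  refine ⟨⋃ k : ℕ, Ico ((k : ℝ) ^ s) ((k : ℝ) ^ s + 1),
    MeasurableSet.iUnion fun k => measurableSet_Ico, fun x R hR => ?_, fun R hR => ?_⟩
  · by_cases hne : ∃ k : ℕ, x - 1 ≤ (k : ℝ) ^ s ∧ (k : ℝ) ^ s ≤ x + R
    swap
    · refine ⟨∅, by simp; positivity, fun y hy => ?_⟩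
      obtain ⟨h1, h2⟩ := hy
      obtain ⟨k, hk⟩ := mem_iUnion.1 h1
      exact absurd ⟨k, by linarith [hk.2, h2.1], by linarith [hk.1, h2.2]⟩ hne
    classical
    set k₀ := Nat.find hne
    have hk₀ := Nat.find_spec hne
    set m := ⌊(R + 1) ^ γ⌋₊
    have hm : (m : ℝ) ≤ (R + 1) ^ γ := Nat.floor_le (by positivity)
    refine ⟨(Finset.range (m + 1)).image fun j => ((k₀ + j : ℕ) : ℝ) ^ s, ?_, fun y hy => ?_⟩
    · calc (((Finset.range (m + 1)).image fun j => ((k₀ + j : ℕ) : ℝ) ^ s).card : ℝ)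
          ≤ ((m + 1 : ℕ) : ℝ) := by
            exact_mod_cast Finset.card_image_le.trans (by simp)
        _ ≤ (R + 1) ^ γ + 1 := by push_cast; linarith
        _ ≤ (R ^ γ + 1 ^ γ) + 1 := by
            gcongr
            exact Real.rpow_add_le_add_rpow (by linarith) (by norm_num) hγ₀.le hγ₁
        _ ≤ 3 * R ^ γ := by
            have := Real.one_le_rpow hR hγ₀.le
            rw [Real.one_rpow]
            linarith
    · obtain ⟨h1, h2⟩ := hy
      obtain ⟨k, hk⟩ := mem_iUnion.1 h1
      have hk1 : x - 1 ≤ (k : ℝ) ^ s ∧ (k : ℝ) ^ s ≤ x + R :=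
        ⟨by linarith [hk.2, h2.1], by linarith [hk.1, h2.2]⟩
      have hkk : k₀ ≤ k := Nat.find_min' hne hk1
      have hd : ((k - k₀ : ℕ) : ℝ) ≤ (R + 1) ^ γ := by
        rw [← hroot (by positivity) (by linarith)]
        linarith [hsuper k₀ k hkk, hk₀.1]
      refine mem_iUnion₂.2 ⟨(k : ℝ) ^ s, ?_, hk.1, hk.2.le⟩
      refine Finset.mem_image.2 ⟨k - k₀, Finset.mem_range.2 (Nat.lt_succ_of_le (Nat.le_floor hd)), ?_⟩
      rw [Nat.add_sub_cancel' hkk]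
  -- Only the `k` with `k^s ≤ R - 1` are counted, so that the whole unit interval at `k^s` stays
  -- inside `[0, R]`.
  · set m := ⌊(R - 1) ^ γ⌋₊
    have hm : (m : ℝ) ≤ (R - 1) ^ γ := Nat.floor_le (Real.rpow_nonneg (by linarith) _)
    have hsub : (⋃ k ∈ Finset.range (m + 1), Ico ((k : ℝ) ^ s) ((k : ℝ) ^ s + 1)) ⊆
        (⋃ k : ℕ, Ico ((k : ℝ) ^ s) ((k : ℝ) ^ s + 1)) ∩ Icc 0 R := by
      refine iUnion₂_subset fun k hk y hy => ⟨mem_iUnion.2 ⟨k, hy⟩, ?_, ?_⟩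
      · exact (Real.rpow_nonneg (by positivity) _).trans hy.1
      · have hkm : (k : ℝ) ≤ m := by exact_mod_cast Nat.lt_succ_iff.1 (Finset.mem_range.1 hk)
        have := (hroot (x := k) (y := R - 1) (by positivity) (by linarith)).2 (hkm.trans hm)
        linarith [hy.2]
    refine le_trans ?_ (measure_mono hsub)
    rw [measure_biUnion_finset ?_ fun k _ => measurableSet_Ico]
    · simp only [Real.volume_Ico, add_sub_cancel_left, ENNReal.ofReal_one, Finset.sum_const,
        Finset.card_range, nsmul_eq_mul, mul_one]
      rw [← ENNReal.ofReal_natCast]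
      refine ENNReal.ofReal_le_ofReal ?_
      have h1 : (R - 1 + 1) ^ γ ≤ (R - 1) ^ γ + 1 ^ γ :=
        Real.rpow_add_le_add_rpow (by linarith) (by norm_num) hγ₀.le hγ₁
      have h2 : (R - 1) ^ γ < m + 1 := Nat.lt_floor_add_one _
      have h3 : (0 : ℝ) ≤ m := by positivity
      rw [sub_add_cancel, Real.one_rpow] at h1
      push_cast
      linarith
    · have key : ∀ a b : ℕ, a < b → Disjoint (Ico ((a : ℝ) ^ s) ((a : ℝ) ^ s + 1))
          (Ico ((b : ℝ) ^ s) ((b : ℝ) ^ s + 1)) := fun a b hab => by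
        refine disjoint_left.2 fun y hy hy' => ?_
        have h1 : (1 : ℝ) ≤ ((b - a : ℕ) : ℝ) ^ s :=
          Real.one_le_rpow (by exact_mod_cast Nat.sub_pos_of_lt hab) hs0.le
        linarith [hsuper a b hab.le, hy.2, hy'.1]
      intro a _ b _ hab
      rcases lt_or_gt_of_ne hab with h | h
      · exact key a b h
      · exact (key b a h).symm

theorem volume_coord {n : ℕ} (S : Fin n → Set ℝ) :
    volume {x : EuclideanSpace ℝ (Fin n) | ∀ i, x i ∈ S i} = ∏ i, volume (S i) := by
  rw [← volume_pi_pi,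
    ← (EuclideanSpace.volume_preserving_symm_measurableEquiv_toLp (Fin n)).measure_preimage_equiv]
  congr 1
  ext x
  simp

theorem coord_box_subset_ball {n : ℕ} (z : EuclideanSpace ℝ (Fin n)) {R : ℝ} (hR : 0 < R) :
    {y : EuclideanSpace ℝ (Fin n) | ∀ i, y i ∈ Icc (z i) (z i + R)} ⊆
      Metric.ball z ((n + 1) * R) := by
  intro y hy
  rw [Metric.mem_ball, EuclideanSpace.dist_eq, Real.sqrt_lt' (by positivity)]
  calc ∑ i, dist (y i) (z i) ^ 2 ≤ ∑ _i : Fin n, R ^ 2 := by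
        refine Finset.sum_le_sum fun i _ => ?_
        have h := hy i
        rw [Real.dist_eq, sq_abs]
        exact pow_le_pow_left₀ (by linarith [h.1]) (by linarith [h.2]) 2
    _ = n * R ^ 2 := by simp
    _ < ((n + 1) * R) ^ 2 := by
        have h1 : (0 : ℝ) ≤ n := by positivity
        have h2 : 0 < R ^ 2 := by positivity
        rw [mul_pow]
        gcongr
        nlinarith

theorem ball_subset_coord_box {n : ℕ} (z : EuclideanSpace ℝ (Fin n)) (r : ℝ) :
    Metric.ball z r ⊆ {y : EuclideanSpace ℝ (Fin n) | ∀ i, y i ∈ Icc (z i - r) (z i - r + 2 * r)} := by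
  intro y hy i
  have h1 : ‖(y - z) i‖ ≤ ‖y - z‖ := PiLp.norm_apply_le _ i
  rw [Metric.mem_ball, dist_eq_norm] at hy
  rw [PiLp.sub_apply, Real.norm_eq_abs] at h1
  have := abs_le.1 (h1.trans hy.le)
  constructor <;> linarith [this.1, this.2]

/-- If `|E ∩ B| ≲ r^(n(1 - p/u))` for all balls `B` of radius `r`, then `1_E` has finite Morrey
norm. -/
theorem morreyFun_indicator_lt_top {n : ℕ} {p u γ C : ℝ} (hp : 0 < p) (hγ : γ = 1 - p / u)
    {E : Set (EuclideanSpace ℝ (Fin n))} (hE : MeasurableSet E) (hC : 0 < C)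
    (h : ∀ x r, 0 < r → volume (E ∩ Metric.ball x r) ≤ ENNReal.ofReal (C * r ^ (n * γ))) :
    morreyFun p u (E.indicator fun _ => 1) < ∞ := by
  refine lt_of_le_of_lt (b := volume (Metric.ball (0 : EuclideanSpace ℝ (Fin n)) 1) ^
    (1 / u - 1 / p) * ENNReal.ofReal (C ^ (1 / p))) ?_ ?_
  · refine iSup_le fun x => iSup_le fun r => iSup_le fun hr => ?_
    have e : ∫⁻ y in Metric.ball x r, (E.indicator (fun _ => (1 : ℝ≥0∞)) y) ^ p =
        volume (E ∩ Metric.ball x r) := by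
      have : ∀ y, (E.indicator (fun _ => (1 : ℝ≥0∞)) y) ^ p = E.indicator (fun _ => 1) y :=
        fun y => by
        by_cases hy : y ∈ E <;> simp [hy, hp]
      simp only [this]
      rw [lintegral_indicator hE, Measure.restrict_restrict hE]
      simp
    rw [e, volume_ball_rpow x hr]
    calc _ ≤ ENNReal.ofReal (r ^ (n * (1 / u - 1 / p))) *
          volume (Metric.ball (0 : EuclideanSpace ℝ (Fin n)) 1) ^ (1 / u - 1 / p) *
          (ENNReal.ofReal (C * r ^ (n * γ))) ^ (1 / p) := by
          gcongr
          exact h x r hr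
      _ = _ := by
          rw [ENNReal.ofReal_rpow_of_pos (by positivity),
            Real.mul_rpow hC.le (by positivity), ← Real.rpow_mul hr.le,
            ENNReal.ofReal_mul (by positivity)]
          have e1 : n * γ * (1 / p) = -(n * (1 / u - 1 / p)) := by
            rw [hγ]; field_simp; ring
          have e2 : ENNReal.ofReal (r ^ (n * (1 / u - 1 / p))) *
              ENNReal.ofReal (r ^ (n * γ * (1 / p))) = 1 := by
            rw [← ENNReal.ofReal_mul (by positivity), e1, Real.rpow_neg hr.le,
              mul_inv_cancel₀ (by positivity), ENNReal.ofReal_one]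
          calc _ = (ENNReal.ofReal (r ^ (n * (1 / u - 1 / p))) *
              ENNReal.ofReal (r ^ (n * γ * (1 / p)))) *
              (volume (Metric.ball (0 : EuclideanSpace ℝ (Fin n)) 1) ^ (1 / u - 1 / p) *
                ENNReal.ofReal (C ^ (1 / p))) := by ring
            _ = _ := by rw [e2, one_mul]
  · exact ENNReal.mul_lt_top (lt_top_iff_ne_top.2 (ENNReal.rpow_ne_top_of_ne_zero
      (volume_ball_pos _ one_pos) (volume_ball_ne_top _ _))) ENNReal.ofReal_lt_top

theorem setLIntegral_biUnion_finset_le {α ι : Type*} [MeasurableSpace α] {μ : Measure α}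
    (s : Finset ι) (S : ι → Set α) (g : α → ℝ≥0∞) :
    ∫⁻ y in ⋃ i ∈ s, S i, g y ∂μ ≤ ∑ i ∈ s, ∫⁻ y in S i, g y ∂μ := by
  classical
  induction s using Finset.induction_on with
  | empty => simp
  | insert a s ha ih =>
    rw [Finset.set_biUnion_insert, Finset.sum_insert ha]
    exact (lintegral_union_le g _ _).trans (by gcongr)

/-- A set that is `nγ`-dimensional at all scales `≥ 1`, together with its truncations `Q R` to the
cubes `[0, R]^n`, and the resulting bounds in terms of Morrey norms. -/
theorem exists_sparse_set (n : ℕ) {γ : ℝ} (hγ₀ : 0 ≤ γ) (hγ₁ : γ ≤ 1) :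
    ∃ (E : Set (EuclideanSpace ℝ (Fin n))) (Q : ℝ → Set (EuclideanSpace ℝ (Fin n))) (c : ℝ),
      MeasurableSet E ∧ (∀ R, MeasurableSet (Q R)) ∧ (∀ R, Q R ⊆ E) ∧ 0 < c ∧
      (∀ R, 1 ≤ R → Q R ⊆ Metric.ball 0 ((n + 1) * R)) ∧
      (∀ p u : ℝ, 0 < p → γ = 1 - p / u → morreyFun p u (E.indicator fun _ => 1) < ∞) ∧
      (∀ R, 1 ≤ R → ENNReal.ofReal (c * R ^ (n * γ)) ≤ volume (Q R)) ∧
      (∀ p u : ℝ, 1 ≤ p → ∃ C : ℝ, 0 < C ∧ ∀ R, 1 ≤ R →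
        ∀ g : EuclideanSpace ℝ (Fin n) → ℝ≥0∞, AEMeasurable g →
          ∫⁻ y in Q R, g y ≤ ENNReal.ofReal (C * R ^ (n * γ)) * morreyFun p u g ∧
          ∫⁻ y in Q R, g y ≤ ENNReal.ofReal
            (C * R ^ (n * γ + n * (1 / p - 1 / u - γ / p))) * morreyFun p u g) := by
  obtain ⟨A, hA, hcov, hlow⟩ := exists_sparse_real hγ₀ hγ₁
  set ω := volume (Metric.ball (0 : EuclideanSpace ℝ (Fin n)) 1) with hω
  have hω0 : ω ≠ 0 := volume_ball_pos _ one_pos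
  have hωt : ω ≠ ∞ := volume_ball_ne_top _ _
  set E : Set (EuclideanSpace ℝ (Fin n)) := {x | ∀ i, x i ∈ A} with hE
  set Q : ℝ → Set (EuclideanSpace ℝ (Fin n)) := fun R => {x | ∀ i, x i ∈ A ∩ Icc 0 R} with hQ
  have mcoord : ∀ S : Set ℝ, MeasurableSet S →
      MeasurableSet {x : EuclideanSpace ℝ (Fin n) | ∀ i, x i ∈ S} := fun S hS => by
    rw [ofPred_forall]
    exact MeasurableSet.iInter fun i => (by fun_prop : Measurable
      fun x : EuclideanSpace ℝ (Fin n) => x i) hS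
  have hEm : MeasurableSet E := mcoord A hA
  have hQm : ∀ R, MeasurableSet (Q R) := fun R => mcoord _ (hA.inter measurableSet_Icc)
  have hvol1 : ∀ x R, 1 ≤ R → volume (A ∩ Icc x (x + R)) ≤ ENNReal.ofReal (3 * R ^ γ) :=
    fun x R hR => by
    obtain ⟨Z, hZ, hsub⟩ := hcov x R hR
    calc _ ≤ volume (⋃ z ∈ Z, Icc z (z + 1)) := measure_mono hsub
      _ ≤ ∑ z ∈ Z, volume (Icc z (z + 1)) := measure_biUnion_finset_le _ _
      _ = ENNReal.ofReal Z.card := by simp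
      _ ≤ _ := ENNReal.ofReal_le_ofReal hZ
  have hvol : ∀ x R, 0 < R → volume (A ∩ Icc x (x + R)) ≤ ENNReal.ofReal (3 * R ^ γ) :=
    fun x R hR => by
    rcases le_total 1 R with h | h
    · exact hvol1 x R h
    -- Below scale 1 the set may be solid, but there `R ≤ R^γ`, so the same bound holds.
    · calc _ ≤ volume (Icc x (x + R)) := measure_mono inter_subset_right
        _ = ENNReal.ofReal R := by rw [Real.volume_Icc, add_sub_cancel_left]
        _ ≤ _ := by
          refine ENNReal.ofReal_le_ofReal ?_
          have : R ^ (1 : ℝ) ≤ R ^ γ := Real.rpow_le_rpow_of_exponent_ge hR h hγ₁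
          rw [Real.rpow_one] at this
          linarith
  have hQup : ∀ R, 1 ≤ R → volume (Q R) ≤ ENNReal.ofReal (3 ^ n * R ^ (n * γ)) := fun R hR => by
    rw [hQ, volume_coord fun _ => A ∩ Icc 0 R]
    have := hvol1 0 R hR
    rw [zero_add] at this
    calc _ ≤ ∏ _i : Fin n, ENNReal.ofReal (3 * R ^ γ) := Finset.prod_le_prod' fun i _ => this
      _ = _ := by
        rw [Finset.prod_const, Finset.card_univ, Fintype.card_fin,
          ← ENNReal.ofReal_pow (by positivity), mul_pow, ← Real.rpow_natCast (R ^ γ),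
          ← Real.rpow_mul (by linarith), mul_comm γ]
  have hQball : ∀ R, 1 ≤ R → Q R ⊆ Metric.ball 0 ((n + 1) * R) := fun R hR => by
    refine Subset.trans ?_ (coord_box_subset_ball 0 (by linarith))
    intro y hy i
    simpa using (hy i).2
  refine ⟨E, Q, (1 / 2) ^ n, hEm, hQm, fun R x hx i => (hx i).1, by positivity, hQball,
    fun p u hp hγ => ?_, fun R hR => ?_, fun p u hp => ?_⟩
  · refine morreyFun_indicator_lt_top hp hγ hEm (C := (3 * 2 ^ γ) ^ n) (by positivity)
      fun x r hr => ?_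
    calc _ ≤ volume {y : EuclideanSpace ℝ (Fin n) |
          ∀ i, y i ∈ A ∩ Icc (x i - r) (x i - r + 2 * r)} :=
          measure_mono fun y hy i => ⟨hy.1 i, ball_subset_coord_box x r hy.2 i⟩
      _ = ∏ i, volume (A ∩ Icc (x i - r) (x i - r + 2 * r)) := volume_coord _
      _ ≤ ∏ _i : Fin n, ENNReal.ofReal (3 * (2 * r) ^ γ) :=
          Finset.prod_le_prod' fun i _ => hvol _ _ (by linarith)
      _ = _ := by
        rw [Finset.prod_const, Finset.card_univ, Fintype.card_fin,
          ← ENNReal.ofReal_pow (by positivity), Real.mul_rpow (by norm_num) hr.le, ← mul_assoc,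
          mul_pow, ← Real.rpow_natCast (r ^ γ), ← Real.rpow_mul hr.le, mul_comm γ]
  · rw [hQ, volume_coord fun _ => A ∩ Icc 0 R]
    calc _ = ∏ _i : Fin n, ENNReal.ofReal (1 / 2 * R ^ γ) := by
          rw [Finset.prod_const, Finset.card_univ, Fintype.card_fin,
            ← ENNReal.ofReal_pow (by positivity), mul_pow, ← Real.rpow_natCast (R ^ γ),
            ← Real.rpow_mul (by linarith), mul_comm γ]
      _ ≤ _ := Finset.prod_le_prod' fun i _ => hlow R hR
  · have hp0 : 0 < p := by linarith
    have hp1 : 0 ≤ 1 - 1 / p := by rw [sub_nonneg, div_le_one hp0]; exact hp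
    set W := (ω ^ (1 / p - 1 / u)).toReal with hW
    have hW0 : 0 ≤ W := ENNReal.toReal_nonneg
    have hWe : ω ^ (1 / p - 1 / u) = ENNReal.ofReal W :=
      (ENNReal.ofReal_toReal (ENNReal.rpow_ne_top_of_ne_zero hω0 hωt)).symm
    set B := ((n : ℝ) + 1) ^ (n * (1 / p - 1 / u)) * W with hB
    have hB0 : 0 ≤ B := by positivity
    have holder : ∀ (S : Set (EuclideanSpace ℝ (Fin n))) (z : EuclideanSpace ℝ (Fin n)) (R : ℝ),
        0 < R → S ⊆ Metric.ball z ((n + 1) * R) →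
        ∀ g : EuclideanSpace ℝ (Fin n) → ℝ≥0∞, AEMeasurable g →
        ∫⁻ y in S, g y ≤ volume S ^ (1 - 1 / p) *
          (ENNReal.ofReal (B * R ^ (n * (1 / p - 1 / u))) * morreyFun p u g) :=
      fun S z R hR hS g hg => by
      have h := setLIntegral_le_morreyFun hp u hg z (r := (n + 1) * R) (by positivity) hS
      rw [volume_ball_rpow z (by positivity), hWe, ← ENNReal.ofReal_mul (by positivity),
        Real.mul_rpow (by positivity) hR.le] at h
      rwa [hB, mul_right_comm]
    -- The first two summands are the constants of the two estimates; the last one only secures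
    -- positivity.
    refine ⟨3 ^ n * B + (3 ^ n) ^ (1 - 1 / p) * B + 1, by positivity, fun R hR g hg => ⟨?_, ?_⟩⟩
    -- First bound: cover `Q R` by at most `(3 R^γ)^n` unit cubes and apply Hölder in each. This
    -- works for every `p`, `u` but does not see the ratio.
    · obtain ⟨Z, hZ, hsub⟩ := hcov 0 R hR
      rw [zero_add] at hsub
      classical
      set cube : (Fin n → ℝ) → Set (EuclideanSpace ℝ (Fin n)) :=
        fun z => {y | ∀ i, y i ∈ Icc (z i) (z i + 1)} with hcube
      have hQsub : Q R ⊆ ⋃ z ∈ Fintype.piFinset (fun _ : Fin n => Z), cube z := fun y hy => by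
        have hy' : ∀ i, ∃ z ∈ Z, y i ∈ Icc z (z + 1) := fun i => by
          simpa only [mem_iUnion, exists_prop] using hsub (hy i)
        choose z hz hzy using hy'
        exact mem_iUnion₂.2 ⟨z, Fintype.mem_piFinset.2 hz, hzy⟩
      have one : ∀ z, ∫⁻ y in cube z, g y ≤ ENNReal.ofReal B * morreyFun p u g := fun z => by
        have hv : volume (cube z) = 1 := by
          rw [hcube, volume_coord fun i => Icc (z i) (z i + 1)]
          simp
        have := holder (cube z) (WithLp.toLp 2 z) 1 one_pos
          (coord_box_subset_ball (WithLp.toLp 2 z) one_pos) g hg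
        rwa [hv, ENNReal.one_rpow, one_mul, Real.one_rpow, mul_one] at this
      calc _ ≤ ∫⁻ y in ⋃ z ∈ Fintype.piFinset (fun _ : Fin n => Z), cube z, g y :=
            lintegral_mono_set hQsub
        _ ≤ ∑ z ∈ Fintype.piFinset (fun _ : Fin n => Z), ∫⁻ y in cube z, g y :=
            setLIntegral_biUnion_finset_le _ _ _
        _ ≤ ∑ z ∈ Fintype.piFinset (fun _ : Fin n => Z), ENNReal.ofReal B * morreyFun p u g :=
            Finset.sum_le_sum fun z _ => one z
        _ = ENNReal.ofReal ((Z.card : ℝ) ^ n * B) * morreyFun p u g := by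
            rw [Finset.sum_const, Fintype.card_piFinset_const, nsmul_eq_mul, ← mul_assoc,
              ENNReal.ofReal_mul (q := B) (pow_nonneg (Nat.cast_nonneg _) _), ← Nat.cast_pow,
              ENNReal.ofReal_natCast]
        _ ≤ _ := by
            refine mul_le_mul_left (ENNReal.ofReal_le_ofReal ?_) _
            calc (Z.card : ℝ) ^ n * B ≤ (3 * R ^ γ) ^ n * B :=
                mul_le_mul_of_nonneg_right (pow_le_pow_left₀ (Nat.cast_nonneg _) hZ n) hB0
              _ = 3 ^ n * B * R ^ (n * γ) := by
                rw [mul_pow, ← Real.rpow_natCast (R ^ γ), ← Real.rpow_mul (by linarith),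
                  mul_comm γ]
                ring
              _ ≤ _ := by
                gcongr
                have : 0 ≤ ((3 : ℝ) ^ n) ^ (1 - 1 / p) * B := by positivity
                linarith
    -- Second bound: a single use of Hölder on the ball containing `Q R`. The extra exponent `n(1/p
    -- - 1/u - γ/p)` is negative precisely when `γ > 1 - p/u` (for `n ≥ 1`), that is, when the space
    -- is too small for the set.
    · refine (holder (Q R) 0 R (by linarith) (hQball R hR) g hg).trans ?_
      have hR0 : 0 < R := by linarith
      rw [← mul_assoc]
      gcongr
      calc _ ≤ (ENNReal.ofReal (3 ^ n * R ^ (n * γ))) ^ (1 - 1 / p) *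
            ENNReal.ofReal (B * R ^ (n * (1 / p - 1 / u))) := by
            gcongr
            exact hQup R hR
        _ = ENNReal.ofReal ((3 ^ n) ^ (1 - 1 / p) * B *
            R ^ (n * γ + n * (1 / p - 1 / u - γ / p))) := by
            rw [ENNReal.ofReal_rpow_of_pos (by positivity), ← ENNReal.ofReal_mul (by positivity),
              Real.mul_rpow (by positivity) (by positivity), ← Real.rpow_mul hR0.le]
            congr 1
            have : R ^ (n * γ + n * (1 / p - 1 / u - γ / p)) =
                R ^ (n * γ * (1 - 1 / p)) * R ^ (n * (1 / p - 1 / u)) := by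
              rw [← Real.rpow_add hR0]; congr 1; ring
            rw [this]
            ring
        _ ≤ _ := by
            refine ENNReal.ofReal_le_ofReal ?_
            gcongr
            have : 0 ≤ (3 : ℝ) ^ n * B := by positivity
            linarith

/-! ### Different ratios: the indicator of a sparse set -/

theorem eq_top_of_two_rpow_le {X : ℝ≥0∞} {α c : ℝ} (hα : 0 < α) (hc : 0 < c)
    (h : ∀ k : ℕ, ENNReal.ofReal (2 ^ (k * α) * c) ≤ X) : X = ∞ := by
  by_contra hX
  have h1 : (1 : ℝ) < 2 ^ α := Real.one_lt_rpow (by norm_num) hα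
  obtain ⟨k, hk⟩ := pow_unbounded_of_one_lt (X.toReal / c) h1
  have h2 := (ENNReal.ofReal_le_iff_le_toReal hX).1 (h k)
  rw [div_lt_iff₀ hc, ← Real.rpow_natCast, ← Real.rpow_mul (by norm_num), mul_comm α] at hk
  linarith

section

variable {V : Type*} [AddCommGroup V]

theorem two_rpow_le_realInterpNorm {θ : ℝ} (hθ₀ : 0 < θ) (hθ₁ : θ < 1) {q : ℝ≥0∞} (hq : 0 < q) :
    ∃ C : ℝ, 0 < C ∧ ∀ (X₀ X₁ : Set V) (N₀ N₁ : V → ℝ≥0∞) (x : V),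
      realInterpNorm X₀ X₁ N₀ N₁ θ q x ≤ ENNReal.ofReal C * lqNorm q (fun k : ℤ =>
        ENNReal.ofReal (2 ^ (-(k * θ))) * peetreK X₀ X₁ N₀ N₁ (2 ^ (k : ℝ)) x) ∧
      lqNorm q (fun k : ℤ => ENNReal.ofReal (2 ^ (-(k * θ))) *
        peetreK X₀ X₁ N₀ N₁ (2 ^ (k : ℝ)) x) ≤
        ENNReal.ofReal C * realInterpNorm X₀ X₁ N₀ N₁ θ q x := by
  obtain ⟨C, hC, hd⟩ := realInterpNorm_discrete (V := V) hθ₀ hθ₁ hq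
    (l := 2) (L := 2) (by norm_num)
  refine ⟨C, hC, fun X₀ X₁ N₀ N₁ x => ?_⟩
  have := hd X₀ X₁ N₀ N₁ (fun k => 2 ^ (k : ℝ)) x (fun k => by positivity)
    (fun k => (two_zpow_discrete k).le) (fun k => (two_zpow_discrete k).ge)
  have e : ∀ k : ℤ, ((2 : ℝ) ^ (k : ℝ)) ^ (-θ) = 2 ^ (-(k * θ)) := fun k => by
    rw [← Real.rpow_mul (by norm_num), mul_neg]
  simpa only [e] using this

/-- In the first case `t^(-θ) K(t)` blows up as `t → 0`, in the second as `t → ∞`. Either way the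
samples at powers of two are unbounded, which is fatal for every `q`. -/
theorem realInterpNorm_eq_top_of_le_peetreK {X₀ X₁ : Set V} {N₀ N₁ : V → ℝ≥0∞} {θ : ℝ}
    (hθ₀ : 0 < θ) (hθ₁ : θ < 1) {q : ℝ≥0∞} (hq : 0 < q) {x : V} {c : ℝ} (hc : 0 < c)
    (h : (∀ t, 0 < t → ENNReal.ofReal c ≤ peetreK X₀ X₁ N₀ N₁ t x) ∨
      (∀ t, 0 < t → ENNReal.ofReal (c * t) ≤ peetreK X₀ X₁ N₀ N₁ t x)) :
    realInterpNorm X₀ X₁ N₀ N₁ θ q x = ∞ := by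
  obtain ⟨C, -, hd⟩ := two_rpow_le_realInterpNorm (V := V) hθ₀ hθ₁ hq
  have hlo := (hd X₀ X₁ N₀ N₁ x).2
  suffices htop : lqNorm q (fun k : ℤ => ENNReal.ofReal (2 ^ (-(k * θ))) *
      peetreK X₀ X₁ N₀ N₁ (2 ^ (k : ℝ)) x) = ∞ by
    by_contra hne
    rw [htop, top_le_iff] at hlo
    exact ENNReal.mul_ne_top ENNReal.ofReal_ne_top hne hlo
  rcases h with h | h
  · refine eq_top_of_two_rpow_le hθ₀ hc fun k => le_trans ?_ (le_lqNorm hq _ (-(k : ℤ)))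
    rw [ENNReal.ofReal_mul (by positivity)]
    push_cast
    rw [neg_mul, neg_neg]
    gcongr
    exact h _ (by positivity)
  · refine eq_top_of_two_rpow_le (α := 1 - θ) (by linarith) hc fun k =>
      le_trans ?_ (le_lqNorm hq _ (k : ℤ))
    refine le_trans (le_of_eq ?_) (mul_le_mul_right (h _ (by positivity)) _)
    rw [← ENNReal.ofReal_mul (by positivity)]
    congr 1
    have : (2 : ℝ) ^ ((k : ℝ) * (1 - θ)) = 2 ^ (-((k : ℝ) * θ)) * 2 ^ (k : ℝ) := by
      rw [← Real.rpow_add (by norm_num)]; congr 1; ring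
    push_cast
    rw [this]
    ring

end

/-- If the set `E` is too sparse for the space of `f₁`, then `f₀` carries a fixed part of `1_E`. -/
theorem le_morreyNorm_of_sparse {n : ℕ} (hn : 1 ≤ n) {γ c : ℝ} (hc : 0 < c)
    {E : Set (EuclideanSpace ℝ (Fin n))} {Q : ℝ → Set (EuclideanSpace ℝ (Fin n))}
    (hQm : ∀ R, MeasurableSet (Q R)) (hQE : ∀ R, Q R ⊆ E)
    (hlow : ∀ R, 1 ≤ R → ENNReal.ofReal (c * R ^ (n * γ)) ≤ volume (Q R))
    {p₀ u₀ p₁ u₁ : ℝ} (hp₁ : 1 ≤ p₁)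
    (h₀ : ∃ C : ℝ, 0 < C ∧ ∀ R, 1 ≤ R →
        ∀ g : EuclideanSpace ℝ (Fin n) → ℝ≥0∞, AEMeasurable g →
          ∫⁻ y in Q R, g y ≤ ENNReal.ofReal (C * R ^ (n * γ)) * morreyFun p₀ u₀ g)
    (h₁ : ∃ C : ℝ, 0 < C ∧ ∀ R, 1 ≤ R →
        ∀ g : EuclideanSpace ℝ (Fin n) → ℝ≥0∞, AEMeasurable g →
          ∫⁻ y in Q R, g y ≤ ENNReal.ofReal
            (C * R ^ (n * γ + n * (1 / p₁ - 1 / u₁ - γ / p₁))) * morreyFun p₁ u₁ g)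
    (hγ : 1 - p₁ / u₁ < γ) :
    ∃ a : ℝ, 0 < a ∧ ∀ f f₀ f₁ : FunSpace n,
      (fun y => ‖f y‖ₑ) =ᵐ[volume] (E.indicator fun _ => (1 : ℝ≥0∞)) → f = f₀ + f₁ →
      morreyNorm p₁ u₁ f₁ < ∞ → ENNReal.ofReal a ≤ morreyNorm p₀ u₀ f₀ := by
  obtain ⟨C₀, hC₀, h₀⟩ := h₀
  obtain ⟨C₁, hC₁, h₁⟩ := h₁
  refine ⟨c / C₀, by positivity, fun f f₀ f₁ hfE hf hf₁ => ?_⟩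
  by_cases hinf : morreyNorm p₀ u₀ f₀ = ∞
  · rw [hinf]; exact le_top
  set δ := (n : ℝ) * -(1 / p₁ - 1 / u₁ - γ / p₁) with hδ
  have hδ0 : 0 < δ := by
    have hp₁' : 0 < p₁ := by linarith
    have hn' : (0 : ℝ) < n := by exact_mod_cast hn
    have : -(1 / p₁ - 1 / u₁ - γ / p₁) = (γ - (1 - p₁ / u₁)) / p₁ := by
      field_simp; ring
    rw [hδ, this]
    exact mul_pos hn' (div_pos (by linarith) hp₁')
  -- Integrate `|f| ≤ |f₀| + |f₁|` over `Q R` and divide by `R^(nγ)`. The contribution of `f₁`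
  -- carries `R^(-δ)` and disappears as `R → ∞`.
  have key : ∀ R : ℝ, 1 ≤ R → c ≤ C₀ * (morreyNorm p₀ u₀ f₀).toReal +
      C₁ * R ^ (-δ) * (morreyNorm p₁ u₁ f₁).toReal := fun R hR => by
    have hR0 : 0 < R := by linarith
    have hvol : volume (Q R) = ∫⁻ y in Q R, ‖f y‖ₑ := by
      rw [← setLIntegral_one]
      refine setLIntegral_congr_fun_ae (hQm R) ?_
      filter_upwards [hfE] with y hy hyQ
      rw [hy, indicator_of_mem (hQE R hyQ)]
    have h2 := hlow R hR
    rw [hvol, hf] at h2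
    have h3 := h2.trans ((setLIntegral_enorm_add_le f₀ f₁ (Q R)).trans (add_le_add
      (h₀ R hR _ f₀.aestronglyMeasurable.enorm) (h₁ R hR _ f₁.aestronglyMeasurable.enorm)))
    rw [← morreyNorm_eq, ← morreyNorm_eq, ← ENNReal.ofReal_toReal hinf,
      ← ENNReal.ofReal_toReal hf₁.ne, ← ENNReal.ofReal_mul (by positivity),
      ← ENNReal.ofReal_mul (by positivity), ← ENNReal.ofReal_add (by positivity) (by positivity),
      ENNReal.ofReal_le_ofReal_iff (by positivity)] at h3
    have e : R ^ ((n : ℝ) * γ + n * (1 / p₁ - 1 / u₁ - γ / p₁)) =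
        R ^ ((n : ℝ) * γ) * R ^ (-δ) := by
      rw [← Real.rpow_add hR0, hδ]; congr 1; ring
    rw [e] at h3
    have hpos : 0 < R ^ ((n : ℝ) * γ) := by positivity
    refine le_of_mul_le_mul_right (h3.trans (le_of_eq ?_)) hpos
    ring
  have hlim : Filter.Tendsto (fun R : ℝ => C₀ * (morreyNorm p₀ u₀ f₀).toReal +
      C₁ * R ^ (-δ) * (morreyNorm p₁ u₁ f₁).toReal) Filter.atTop
      (nhds (C₀ * (morreyNorm p₀ u₀ f₀).toReal + C₁ * 0 * (morreyNorm p₁ u₁ f₁).toReal)) :=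
    (((tendsto_rpow_neg_atTop hδ0).const_mul C₁).mul_const _).const_add _
  have hc' := ge_of_tendsto hlim (Filter.eventually_atTop.2 ⟨1, key⟩)
  rw [ENNReal.ofReal_le_iff_le_toReal hinf, div_le_iff₀ hC₀]
  linarith

/-- `p/u` is the mean of the two ratios with positive weights `p(1 - θ)/p₀` and `pθ/p₁`. If it were
at least both, it would equal both. -/
theorem exists_ratio_lt {p₀ u₀ p₁ u₁ p u θ : ℝ} (hp₀ : 0 < p₀) (hp₁ : 0 < p₁) (hp0 : p ≠ 0)
    (hθ₀ : 0 < θ) (hθ₁ : θ < 1)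
    (hp : 1 / p = (1 - θ) / p₀ + θ / p₁) (hu : 1 / u = (1 - θ) / u₀ + θ / u₁)
    (hne : p₀ / u₀ ≠ p₁ / u₁) : p / u < p₀ / u₀ ∨ p / u < p₁ / u₁ := by
  by_contra hcon
  push Not at hcon
  have e : (1 - θ) / p₀ * (p / u - p₀ / u₀) + θ / p₁ * (p / u - p₁ / u₁) = 0 := by
    have h1 : (1 - θ) / p₀ * (p / u - p₀ / u₀) + θ / p₁ * (p / u - p₁ / u₁) =
        ((1 - θ) / p₀ + θ / p₁) * (p / u) - ((1 - θ) / u₀ + θ / u₁) := by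
      field_simp
      ring
    rw [h1, ← hp, ← hu]
    field_simp
    ring
  have a₀ : 0 < (1 - θ) / p₀ := div_pos (by linarith) hp₀
  have a₁ : 0 < θ / p₁ := div_pos hθ₀ hp₁
  have b₀ : 0 ≤ p / u - p₀ / u₀ := by linarith [hcon.1]
  have b₁ : 0 ≤ p / u - p₁ / u₁ := by linarith [hcon.2]
  have c₀ := mul_nonneg a₀.le b₀
  have c₁ := mul_nonneg a₁.le b₁
  have d₀ : p / u - p₀ / u₀ = 0 := by
    have : (1 - θ) / p₀ * (p / u - p₀ / u₀) = 0 := by linarith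
    exact (mul_eq_zero.1 this).resolve_left a₀.ne'
  have d₁ : p / u - p₁ / u₁ = 0 := by
    have : θ / p₁ * (p / u - p₁ / u₁) = 0 := by linarith
    exact (mul_eq_zero.1 this).resolve_left a₁.ne'
  exact hne (by linarith)

theorem interp_le {p₀ u₀ p₁ u₁ p u θ : ℝ} (hp₀ : 1 ≤ p₀) (hpu₀ : p₀ ≤ u₀) (hp₁ : 1 ≤ p₁)
    (hpu₁ : p₁ ≤ u₁) (hθ₀ : 0 < θ) (hθ₁ : θ < 1)
    (hp : 1 / p = (1 - θ) / p₀ + θ / p₁) (hu : 1 / u = (1 - θ) / u₀ + θ / u₁) : p ≤ u := by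
  have h1 := interp_exponent hp₀ hp₁ hθ₀ hθ₁ hp
  have h2 := interp_exponent (by linarith) (by linarith) hθ₀ hθ₁ hu
  rw [← one_div_le_one_div (by linarith) (by linarith), hp, hu]
  have : 0 ≤ 1 - θ := by linarith
  gcongr

/-- Different ratios `pᵢ / uᵢ`: the Morrey space is not contained in the interpolation space. -/
theorem exists_morrey_interpNorm_eq_top_of_ratio_ne {n : ℕ} (hn : 1 ≤ n) {p₀ u₀ p₁ u₁ p u θ : ℝ}
    (hp₀ : 1 ≤ p₀) (hpu₀ : p₀ ≤ u₀) (hp₁ : 1 ≤ p₁) (hpu₁ : p₁ ≤ u₁)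
    (hθ₀ : 0 < θ) (hθ₁ : θ < 1)
    (hp : 1 / p = (1 - θ) / p₀ + θ / p₁) (hu : 1 / u = (1 - θ) / u₀ + θ / u₁)
    (hne : p₀ / u₀ ≠ p₁ / u₁) {q : ℝ≥0∞} (hq : 0 < q) :
    ∃ f ∈ morreySpace n p u, morreyInterpNorm p₀ u₀ p₁ u₁ θ q f = ∞ := by
  have hp1 := interp_exponent hp₀ hp₁ hθ₀ hθ₁ hp
  have hp0 : 0 < p := by linarith
  have hpu := interp_le hp₀ hpu₀ hp₁ hpu₁ hθ₀ hθ₁ hp hu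
  have hu0 : 0 < u := by linarith
  have hle : p / u ≤ 1 := by rw [div_le_one hu0]; exact hpu
  have hge : 0 < p / u := by positivity
  obtain ⟨E, Q, c, hE, hQm, hQE, hc, -, hnorm, hlow, hint⟩ :=
    exists_sparse_set n (γ := 1 - p / u) (by linarith) (by linarith)
  have hEfin := hnorm p u hp0 rfl
  have hmeas : Measurable (E.indicator fun _ => (1 : ℝ≥0∞)) := measurable_const.indicator hE
  obtain ⟨f, hf⟩ := exists_funSpace hmeas
    (Filter.Eventually.of_forall fun y => by by_cases hy : y ∈ E <;> simp [hy])
  refine ⟨f, ?_, ?_⟩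
  · rw [mem_morreySpace_iff hp0, morreyNorm_eq, morreyFun_congr_ae hp0 u hf]
    exact hEfin
  obtain ⟨C₀, hC₀, i₀⟩ := hint p₀ u₀ hp₀
  obtain ⟨C₁, hC₁, i₁⟩ := hint p₁ u₁ hp₁
  rcases exists_ratio_lt (by linarith) (by linarith) hp0.ne' hθ₀ hθ₁ hp hu hne with h | h
  -- Here the summand `f₀` is negligible along `E`, so the two spaces exchange roles. The norm of
  -- `f₁` is bounded below, and `K(t)` by `a t`.
  · obtain ⟨a, ha, H⟩ := le_morreyNorm_of_sparse (p₀ := p₁) (u₀ := u₁) (u₁ := u₀) hn hc hQm hQE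
      hlow hp₀ ⟨C₁, hC₁, fun R hR g hg => (i₁ R hR g hg).1⟩
      ⟨C₀, hC₀, fun R hR g hg => (i₀ R hR g hg).2⟩ (by linarith)
    refine realInterpNorm_eq_top_of_le_peetreK hθ₀ hθ₁ hq ha (Or.inr fun t ht => ?_)
    refine le_peetreK _ _ _ _ _ fun f₀ h₀ f₁ h₁ hf' => ?_
    have := H f f₁ f₀ hf (by rw [hf', add_comm]) h₀.2
    rw [mul_comm, ENNReal.ofReal_mul ht.le]
    exact le_add_left (by gcongr)
  · obtain ⟨a, ha, H⟩ := le_morreyNorm_of_sparse (p₀ := p₀) (u₀ := u₀) (u₁ := u₁) hn hc hQm hQE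
      hlow hp₁ ⟨C₀, hC₀, fun R hR g hg => (i₀ R hR g hg).1⟩
      ⟨C₁, hC₁, fun R hR g hg => (i₁ R hR g hg).2⟩ (by linarith)
    refine realInterpNorm_eq_top_of_le_peetreK hθ₀ hθ₁ hq ha (Or.inl fun t ht => ?_)
    refine le_peetreK _ _ _ _ _ fun f₀ h₀ f₁ h₁ hf' => ?_
    exact le_add_right (H f f₀ f₁ hf hf' h₁.2)

/-! ### Equal ratios: lower bounds for K from dyadic sets -/

theorem interp_sub_eq {u₀ u₁ u θ : ℝ} (hu : 1 / u = (1 - θ) / u₀ + θ / u₁) :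
    1 / u₀ - 1 / u = θ * (1 / u₀ - 1 / u₁) := by
  rw [hu]; ring

/-- A lower bound for the `K`-functional of a function that is large on a dyadic family of sets. -/
theorem le_peetreK_of_dyadic {n : ℕ} (hn : 1 ≤ n) {p₀ u₀ p₁ u₁ u θ κ c : ℝ}
    (hp₀ : 1 ≤ p₀) (hp₁ : 1 ≤ p₁)
    (hu : 1 / u = (1 - θ) / u₀ + θ / u₁) (hne : u₀ ≠ u₁)
    (hκ : κ = 1 / (n * (1 / u₀ - 1 / u₁))) (hc : 0 < c) :
    ∃ C : ℝ, 0 < C ∧ ∀ (f : FunSpace n) (m : ℤ) (a : ℝ) (S : Set (EuclideanSpace ℝ (Fin n))),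
      MeasurableSet S → 0 ≤ a → S ⊆ Metric.ball 0 (2 ^ (m * κ)) →
      ENNReal.ofReal (c * 2 ^ (m * κ * n)) ≤ volume S →
      (∀ᵐ y, y ∈ S → ENNReal.ofReal (a * 2 ^ (-(m * κ * (n / u)))) ≤ ‖f y‖ₑ) →
      ENNReal.ofReal (a * 2 ^ (m * θ)) ≤ ENNReal.ofReal C *
        peetreK (morreySpace n p₀ u₀) (morreySpace n p₁ u₁) (morreyNorm p₀ u₀)
          (morreyNorm p₁ u₁) (2 ^ (m : ℝ)) f := by
  set ω := volume (Metric.ball (0 : EuclideanSpace ℝ (Fin n)) 1) with hω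
  have hω0 : ω ≠ 0 := volume_ball_pos _ one_pos
  have hωt : ω ≠ ∞ := volume_ball_ne_top _ _
  have hn' : (0 : ℝ) < n := by exact_mod_cast hn
  have hW : ∀ v : ℝ, ∃ W : ℝ, 0 ≤ W ∧ ω ^ v = ENNReal.ofReal W := fun v =>
    ⟨_, ENNReal.toReal_nonneg, (ENNReal.ofReal_toReal
      (ENNReal.rpow_ne_top_of_ne_zero hω0 hωt)).symm⟩
  obtain ⟨W₀, hW₀, eW₀⟩ := hW (1 - 1 / u₀)
  obtain ⟨W₁, hW₁, eW₁⟩ := hW (1 - 1 / u₁)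
  refine ⟨(W₀ + W₁ + 1) / c, by positivity, fun f m a S hS ha hSb hvol hfS => ?_⟩
  set r : ℝ := 2 ^ (m * κ) with hr
  have hr0 : 0 < r := by positivity
  have hnot : 1 / u₀ - 1 / u₁ ≠ 0 := by
    intro h
    apply hne
    have : 1 / u₀ = 1 / u₁ := by linarith
    simpa using this
  have hrpow : ∀ e : ℝ, r ^ e = 2 ^ (m * κ * e) := fun e => by
    rw [hr, ← Real.rpow_mul (by norm_num)]
  have holder : ∀ (p v W : ℝ), 1 ≤ p → ω ^ (1 - 1 / v) = ENNReal.ofReal W →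
      ∀ g : EuclideanSpace ℝ (Fin n) → ℝ≥0∞, AEMeasurable g →
      ∫⁻ y in S, g y ≤ ENNReal.ofReal (r ^ (n * (1 - 1 / v))) * ENNReal.ofReal W *
        morreyFun p v g := fun p v W hp hWv g hg => by
    have hp0 : 0 < p := by linarith
    have hp1 : 0 ≤ 1 - 1 / p := by rw [sub_nonneg, div_le_one hp0]; exact hp
    refine (setLIntegral_le_morreyFun hp v hg 0 hr0 hSb).trans ?_
    calc _ ≤ volume (Metric.ball (0 : EuclideanSpace ℝ (Fin n)) r) ^ (1 - 1 / p) *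
          (volume (Metric.ball (0 : EuclideanSpace ℝ (Fin n)) r) ^ (1 / p - 1 / v) *
            morreyFun p v g) := by gcongr
      _ = _ := by
          rw [← mul_assoc, ← ENNReal.rpow_add _ _ (volume_ball_pos _ hr0)
            (volume_ball_ne_top _ _), show 1 - 1 / p + (1 / p - 1 / v) = 1 - 1 / v by ring,
            volume_ball_rpow _ hr0, ← hω, hWv]
  have hint : ENNReal.ofReal (a * c * r ^ (n - n / u)) ≤ ∫⁻ y in S, ‖f y‖ₑ := by
    calc _ = ENNReal.ofReal (a * 2 ^ (-(m * κ * (n / u)))) *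
          ENNReal.ofReal (c * 2 ^ (m * κ * n)) := by
          rw [← ENNReal.ofReal_mul (by positivity), hrpow]
          congr 1
          rw [show (m : ℝ) * κ * (n - n / u) = -(m * κ * (n / u)) + m * κ * n by ring,
            Real.rpow_add (by norm_num)]
          ring
      _ ≤ ENNReal.ofReal (a * 2 ^ (-(m * κ * (n / u)))) * volume S := by gcongr
      _ = ∫⁻ _ in S, ENNReal.ofReal (a * 2 ^ (-(m * κ * (n / u)))) :=
          (setLIntegral_const _ _).symm
      _ ≤ _ := setLIntegral_mono_ae' hS hfS
  rw [ENNReal.ofReal_div_of_pos hc, div_eq_mul_inv, mul_right_comm, ← div_eq_mul_inv,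
    ENNReal.le_div_iff_mul_le (Or.inl (ENNReal.ofReal_pos.2 hc).ne') (Or.inl ENNReal.ofReal_ne_top)]
  have hW01 : ENNReal.ofReal (W₀ + W₁ + 1) ≠ 0 := (ENNReal.ofReal_pos.2 (by positivity)).ne'
  rw [← ENNReal.div_le_iff' hW01 ENNReal.ofReal_ne_top]
  refine le_peetreK _ _ _ _ _ fun f₀ h₀ f₁ h₁ hf => ?_
  rw [ENNReal.div_le_iff' hW01 ENNReal.ofReal_ne_top]
  rw [hf] at hint
  have h2 := hint.trans ((setLIntegral_enorm_add_le f₀ f₁ S).trans (add_le_add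
    (holder p₀ u₀ W₀ hp₀ eW₀ _ f₀.aestronglyMeasurable.enorm)
    (holder p₁ u₁ W₁ hp₁ eW₁ _ f₁.aestronglyMeasurable.enorm)))
  rw [← morreyNorm_eq, ← morreyNorm_eq] at h2
  -- The radius satisfies `r^(n(1/u₀ - 1/u₁)) = 2^m`. Therefore the Hölder constants of the two
  -- spaces differ exactly by `t = 2^m`, and the two bounds combine into `‖f₀‖ + t ‖f₁‖`.
  have e₁ : r ^ (n * (1 - 1 / u₁)) = r ^ (n * (1 - 1 / u₀)) * 2 ^ (m : ℝ) := by
    rw [hrpow, hrpow, ← Real.rpow_add (by norm_num)]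
    congr 1
    have : κ * n * (1 / u₀ - 1 / u₁) = 1 := by
      rw [hκ]; field_simp
    linear_combination (m : ℝ) * this
  have e₀ : r ^ (n - n / u) = r ^ (n * (1 - 1 / u₀)) * 2 ^ (m * θ) := by
    rw [hrpow, hrpow, ← Real.rpow_add (by norm_num)]
    congr 1
    have : κ * n * (1 / u₀ - 1 / u₁) = 1 := by
      rw [hκ]; field_simp
    have h3 := interp_sub_eq hu
    linear_combination (m : ℝ) * θ * this + (m : ℝ) * κ * n * h3
  rw [e₀, e₁] at h2
  have hX : 0 < r ^ (n * (1 - 1 / u₀)) := by positivity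
  have hX' : ENNReal.ofReal (r ^ (n * (1 - 1 / u₀))) ≠ 0 := (ENNReal.ofReal_pos.2 hX).ne'
  rw [← ENNReal.mul_le_mul_iff_right hX' ENNReal.ofReal_ne_top]
  calc _ = ENNReal.ofReal (a * c * (r ^ (n * (1 - 1 / u₀)) * 2 ^ (m * θ))) := by
        rw [← ENNReal.ofReal_mul (by positivity), ← ENNReal.ofReal_mul (by positivity)]
        congr 1; ring
    _ ≤ _ := h2
    _ ≤ ENNReal.ofReal (r ^ (n * (1 - 1 / u₀))) * ENNReal.ofReal (W₀ + W₁ + 1) *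
          morreyNorm p₀ u₀ f₀ + ENNReal.ofReal (r ^ (n * (1 - 1 / u₀)) * 2 ^ (m : ℝ)) *
          ENNReal.ofReal (W₀ + W₁ + 1) * morreyNorm p₁ u₁ f₁ := by
        gcongr <;> linarith
    _ = _ := by
        rw [ENNReal.ofReal_mul hX.le]
        ring

/-! ### Radial functions with a power and a logarithm -/

theorem lintegral_le_dyadic {n : ℕ} (hn : 1 ≤ n) {F : EuclideanSpace ℝ (Fin n) → ℝ≥0∞}
    {b : ℤ → ℝ≥0∞}
    (h : ∀ (j : ℤ) (x : EuclideanSpace ℝ (Fin n)), (2 : ℝ) ^ j ≤ ‖x‖ → ‖x‖ < 2 ^ (j + 1) →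
      F x ≤ b j) :
    ∫⁻ x, F x ≤ ∑' j : ℤ, b j * (ENNReal.ofReal (2 ^ ((j + 1) * n : ℝ)) *
      volume (Metric.ball (0 : EuclideanSpace ℝ (Fin n)) 1)) := by
  have : Nonempty (Fin n) := ⟨⟨0, hn⟩⟩
  set A : ℤ → Set (EuclideanSpace ℝ (Fin n)) := fun j => {x | (2 : ℝ) ^ j ≤ ‖x‖ ∧ ‖x‖ < 2 ^ (j + 1)}
  have hAm : ∀ j, MeasurableSet (A j) := fun j =>
    (measurableSet_le measurable_const measurable_norm).inter
      (measurableSet_lt measurable_norm measurable_const)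
  have hU : (univ : Set (EuclideanSpace ℝ (Fin n))) =ᵐ[volume] ⋃ j, A j := by
    have h0 : ∀ᵐ x : EuclideanSpace ℝ (Fin n), x ≠ 0 := by
      simp [ae_iff]
    filter_upwards [h0] with x hx
    refine eq_iff_iff.2 ⟨fun _ => ?_, fun _ => trivial⟩
    obtain ⟨j, hj1, hj2⟩ := exists_mem_Ico_zpow (y := (2 : ℝ)) (norm_pos_iff.2 hx) (by norm_num)
    exact mem_iUnion.2 ⟨j, hj1, hj2⟩
  rw [← setLIntegral_univ, setLIntegral_congr hU]
  refine (lintegral_iUnion_le A F).trans (ENNReal.tsum_le_tsum fun j => ?_)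
  calc ∫⁻ x in A j, F x ≤ ∫⁻ _ in A j, b j :=
        setLIntegral_mono' (hAm j) fun x hx => h j x hx.1 hx.2
    _ = b j * volume (A j) := setLIntegral_const _ _
    _ ≤ b j * volume (Metric.ball (0 : EuclideanSpace ℝ (Fin n)) (2 ^ (j + 1))) := by
        gcongr
        intro x hx
        rw [mem_ball_zero_iff]
        exact hx.2
    _ = _ := by
        rw [volume_ball_scale _ (by positivity)]
        congr 3
        rw [Real.rpow_mul (by norm_num)]
        congr 1
        exact_mod_cast (Real.rpow_intCast 2 (j + 1)).symm

theorem enorm_rpow_neg_le {n : ℕ} {a : ℝ} (ha : 0 ≤ a) {r : ℝ} {x : EuclideanSpace ℝ (Fin n)}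
    (hr : 0 < r) (hx : r ≤ ‖x‖) : ‖x‖ₑ ^ (-a) ≤ ENNReal.ofReal (r ^ (-a)) := by
  rw [← ofReal_norm, ENNReal.ofReal_rpow_of_pos (by linarith)]
  exact ENNReal.ofReal_le_ofReal (Real.rpow_le_rpow_of_nonpos hr hx (by linarith))

theorem lintegral_unit_ball_enorm_rpow_lt_top {n : ℕ} (hn : 1 ≤ n) {a : ℝ} (ha0 : 0 ≤ a)
    (ha : a < n) :
    ∫⁻ y in Metric.ball (0 : EuclideanSpace ℝ (Fin n)) 1, ‖y‖ₑ ^ (-a) < ∞ := by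
  rw [← lintegral_indicator measurableSet_ball]
  refine (lintegral_le_dyadic hn (b := fun j => if j < 0 then ENNReal.ofReal (2 ^ (-(j * a)))
    else 0) fun j x h1 h2 => ?_).trans_lt ?_
  · split_ifs with hj
    · refine (indicator_le_self _ _ x).trans ((enorm_rpow_neg_le ha0 (by positivity) h1).trans
        (le_of_eq ?_))
      rw [← Real.rpow_intCast, ← Real.rpow_mul (by norm_num), mul_neg]
    · rw [indicator_of_notMem]
      rw [mem_ball_zero_iff, not_lt]
      refine le_trans ?_ h1
      exact one_le_zpow₀ (by norm_num) (not_lt.1 hj)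
  · have hx1 : (2 : ℝ) ^ (-(n - a)) < 1 :=
      Real.rpow_lt_one_of_one_lt_of_neg (by norm_num) (by linarith)
    refine lt_of_le_of_lt (ENNReal.tsum_le_tsum fun j => ?_) (b := ∑' j : ℤ,
      (ENNReal.ofReal (2 ^ n) * volume (Metric.ball (0 : EuclideanSpace ℝ (Fin n)) 1)) *
        ENNReal.ofReal (2 ^ (-(n - a))) ^ j.natAbs) ?_
    · split_ifs with hj
      · rw [← mul_assoc, ← ENNReal.ofReal_mul (by positivity), mul_right_comm,
          ← ENNReal.ofReal_pow (by positivity), ← ENNReal.ofReal_mul (by positivity)]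
        refine mul_le_mul_left (ENNReal.ofReal_le_ofReal ?_) _
        have e : ((2 : ℝ) ^ (-(n - a))) ^ j.natAbs = 2 ^ (j * (n - a)) := by
          rw [← Real.rpow_natCast, ← Real.rpow_mul (by norm_num), Nat.cast_natAbs,
            abs_of_neg hj]
          push_cast
          congr 1; ring
        rw [e, ← Real.rpow_natCast 2 n, ← Real.rpow_add (by norm_num),
          ← Real.rpow_add (by norm_num)]
        refine le_of_eq ?_
        congr 1
        ring
      · simp
    · rw [ENNReal.tsum_mul_left]
      exact ENNReal.mul_lt_top (ENNReal.mul_lt_top ENNReal.ofReal_lt_top measure_ball_lt_top)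
        (tsum_pow_natAbs_lt_top hx1)

theorem lintegral_ball_enorm_rpow {n : ℕ} {a r : ℝ} (hr : 0 < r) :
    ∫⁻ y in Metric.ball (0 : EuclideanSpace ℝ (Fin n)) r, ‖y‖ₑ ^ (-a) =
      ENNReal.ofReal (r ^ (n - a)) *
        ∫⁻ y in Metric.ball (0 : EuclideanSpace ℝ (Fin n)) 1, ‖y‖ₑ ^ (-a) := by
  have h := lintegral_ball_comp_smul (n := n) hr (g := fun y => ‖y‖ₑ ^ (-a)) (by fun_prop) 0 1
  rw [smul_zero, mul_one] at h
  have e : ∀ y : EuclideanSpace ℝ (Fin n), ‖r • y‖ₑ ^ (-a) =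
      ENNReal.ofReal (r ^ (-a)) * ‖y‖ₑ ^ (-a) := fun y => by
    rw [enorm_smul, Real.enorm_of_nonneg hr.le, ENNReal.mul_rpow_of_ne_top ENNReal.ofReal_ne_top
      enorm_ne_top, ENNReal.ofReal_rpow_of_pos hr]
  simp only [e] at h
  rw [lintegral_const_mul' _ _ ENNReal.ofReal_ne_top] at h
  have h1 : ENNReal.ofReal (r ^ (n : ℝ)) * ENNReal.ofReal (r ^ (-(n : ℝ))) = 1 := by
    rw [← ENNReal.ofReal_mul (by positivity), ← Real.rpow_add hr]; simp
  calc _ = (ENNReal.ofReal (r ^ (n : ℝ)) * ENNReal.ofReal (r ^ (-(n : ℝ)))) *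
        ∫⁻ y in Metric.ball (0 : EuclideanSpace ℝ (Fin n)) r, ‖y‖ₑ ^ (-a) := by rw [h1, one_mul]
    _ = ENNReal.ofReal (r ^ (n : ℝ)) * (ENNReal.ofReal (r ^ (-(n : ℝ))) *
        ∫⁻ y in Metric.ball (0 : EuclideanSpace ℝ (Fin n)) r, ‖y‖ₑ ^ (-a)) := mul_assoc _ _ _
    _ = _ := by
      rw [← h, ← mul_assoc, ← ENNReal.ofReal_mul (by positivity), ← Real.rpow_add hr]
      rfl

/-- Centred balls are the worst up to a constant: on the part of `B(x, r)` outside `B(0, r)` the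
integrand is at most `r^(-a)`. Integrability at the origin is `a = np/u < n`. -/
theorem morreyFun_enorm_rpow_lt_top {n : ℕ} (hn : 1 ≤ n) {p u : ℝ} (hp : 0 < p) (hpu : p < u) :
    morreyFun (n := n) p u (fun y => ‖y‖ₑ ^ (-(n / u))) < ∞ := by
  have hu : 0 < u := by linarith
  have hn' : (0 : ℝ) < n := by exact_mod_cast hn
  set a : ℝ := n / u * p with ha
  have ha0 : 0 ≤ a := by positivity
  have han : a < n := by
    rw [ha, div_mul_eq_mul_div, div_lt_iff₀ hu]
    gcongr
  set ω := volume (Metric.ball (0 : EuclideanSpace ℝ (Fin n)) 1) with hω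
  set D := ∫⁻ y in Metric.ball (0 : EuclideanSpace ℝ (Fin n)) 1, ‖y‖ₑ ^ (-a) with hD
  have hDt : D < ∞ := lintegral_unit_ball_enorm_rpow_lt_top hn ha0 han
  have hωt : ω < ∞ := measure_ball_lt_top
  refine lt_of_le_of_lt (b := ω ^ (1 / u - 1 / p) * (D + ω) ^ (1 / p)) ?_ ?_
  · refine iSup_le fun x => iSup_le fun r => iSup_le fun hr => ?_
    have e : ∀ y : EuclideanSpace ℝ (Fin n), (‖y‖ₑ ^ (-(n / u))) ^ p = ‖y‖ₑ ^ (-a) := fun y => by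
      rw [← ENNReal.rpow_mul, ha, neg_mul]
    simp only [e]
    have hI : ∫⁻ y in Metric.ball x r, ‖y‖ₑ ^ (-a) ≤ ENNReal.ofReal (r ^ (n - a)) * (D + ω) := by
      calc _ ≤ ∫⁻ y in Metric.ball 0 r ∪ Metric.ball x r \ Metric.ball 0 r, ‖y‖ₑ ^ (-a) := by
            refine lintegral_mono_set ?_
            intro y hy
            by_cases h : y ∈ Metric.ball 0 r
            · exact Or.inl h
            · exact Or.inr ⟨hy, h⟩
        _ ≤ (∫⁻ y in Metric.ball (0 : EuclideanSpace ℝ (Fin n)) r, ‖y‖ₑ ^ (-a)) +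
              ∫⁻ y in Metric.ball x r \ Metric.ball 0 r, ‖y‖ₑ ^ (-a) := lintegral_union_le _ _ _
        _ ≤ ENNReal.ofReal (r ^ (n - a)) * D + ∫⁻ _ in Metric.ball x r \ Metric.ball 0 r,
              ENNReal.ofReal (r ^ (-a)) := by
            refine add_le_add (lintegral_ball_enorm_rpow hr).le ?_
            refine setLIntegral_mono' (measurableSet_ball.diff measurableSet_ball) fun y hy => ?_
            refine enorm_rpow_neg_le ha0 hr ?_
            simpa using hy.2
        _ ≤ ENNReal.ofReal (r ^ (n - a)) * D + ENNReal.ofReal (r ^ (-a)) *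
              volume (Metric.ball x r) := by
            rw [setLIntegral_const]
            gcongr
            exact sdiff_subset
        _ = _ := by
            rw [volume_ball_scale x hr, ← mul_assoc, ← ENNReal.ofReal_mul (by positivity),
              ← Real.rpow_add hr, neg_add_eq_sub, mul_add]
    calc _ ≤ volume (Metric.ball x r) ^ (1 / u - 1 / p) *
          (ENNReal.ofReal (r ^ (n - a)) * (D + ω)) ^ (1 / p) := by gcongr
      _ = _ := by
          rw [volume_ball_rpow x hr, ENNReal.mul_rpow_of_nonneg _ _ (by positivity),
            ENNReal.ofReal_rpow_of_pos (by positivity), ← Real.rpow_mul hr.le]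
          have e2 : ENNReal.ofReal (r ^ (n * (1 / u - 1 / p))) *
              ENNReal.ofReal (r ^ ((n - a) * (1 / p))) = 1 := by
            rw [← ENNReal.ofReal_mul (by positivity), ← Real.rpow_add hr]
            have : n * (1 / u - 1 / p) + (n - a) * (1 / p) = 0 := by
              rw [ha]; field_simp; ring
            rw [this, Real.rpow_zero, ENNReal.ofReal_one]
          calc _ = (ENNReal.ofReal (r ^ (n * (1 / u - 1 / p))) *
              ENNReal.ofReal (r ^ ((n - a) * (1 / p)))) * (ω ^ (1 / u - 1 / p) *
                (D + ω) ^ (1 / p)) := by ring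
            _ = _ := by rw [e2, one_mul]
  · refine ENNReal.mul_lt_top (lt_top_iff_ne_top.2 (ENNReal.rpow_ne_top_of_ne_zero
      (volume_ball_pos _ one_pos) (volume_ball_ne_top _ _))) ?_
    exact ENNReal.rpow_lt_top_of_nonneg (by positivity) (ENNReal.add_lt_top.2 ⟨hDt, hωt⟩).ne

theorem tsum_natAbs_rpow_lt_top {τ : ℝ} (hτ : 1 < τ) :
    ∑' j : ℤ, ENNReal.ofReal ((1 + |(j : ℝ)|) ^ (-τ)) < ∞ := by
  have e : ∀ j : ℤ, ENNReal.ofReal ((1 + |(j : ℝ)|) ^ (-τ)) =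
      (fun m : ℕ => ENNReal.ofReal ((1 + (m : ℝ)) ^ (-τ))) j.natAbs := fun j => by
    simp only [Nat.cast_natAbs, Int.cast_abs]
  simp only [e]
  refine (tsum_natAbs_le fun m : ℕ => ENNReal.ofReal ((1 + (m : ℝ)) ^ (-τ))).trans_lt
    (ENNReal.mul_lt_top ENNReal.ofNat_lt_top ?_)
  have hs : Summable fun m : ℕ => ((m : ℝ)) ^ (-τ) := Real.summable_nat_rpow.2 (by linarith)
  have hs' := (summable_nat_add_iff 1).2 hs
  have hs'' : Summable fun m : ℕ => (1 + (m : ℝ)) ^ (-τ) := by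
    refine hs'.congr fun m => ?_
    push_cast
    rw [add_comm]
  rw [← ENNReal.ofReal_tsum_of_nonneg (fun m => by positivity) hs'']
  exact ENNReal.ofReal_lt_top

theorem tsum_nat_rpow_eq_top {τ : ℝ} (hτ : τ ≤ 1) :
    ∑' m : ℕ, ENNReal.ofReal ((1 + (m : ℝ)) ^ (-τ)) = ∞ := by
  by_contra h1
  have h2 := ENNReal.summable_toReal h1
  have h3 : Summable fun m : ℕ => ((m + 1 : ℕ) : ℝ) ^ (-τ) := by
    refine h2.congr fun m => ?_
    rw [ENNReal.toReal_ofReal (by positivity)]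
    push_cast
    rw [add_comm]
  have h4 := Real.summable_nat_rpow.1
    ((summable_nat_add_iff (f := fun m : ℕ => (m : ℝ) ^ (-τ)) 1).1 h3)
  linarith

theorem tsum_natAbs_rpow_eq_top {τ : ℝ} (hτ : τ ≤ 1) :
    ∑' j : ℤ, ENNReal.ofReal ((1 + |(j : ℝ)|) ^ (-τ)) = ∞ := by
  rw [← top_le_iff, ← tsum_nat_rpow_eq_top hτ]
  refine le_trans (le_of_eq ?_) (ENNReal.tsum_comp_le_tsum_of_injective Nat.cast_injective
    (fun j : ℤ => ENNReal.ofReal ((1 + |(j : ℝ)|) ^ (-τ))))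
  exact tsum_congr fun m => by simp

/-- The radial function `|x|^(-n/u) (1 + |log₂ |x||)^(-σ)`. -/
def radialFun (n : ℕ) (u σ : ℝ) (x : EuclideanSpace ℝ (Fin n)) : ℝ≥0∞ :=
  ‖x‖ₑ ^ (-(n / u)) * ENNReal.ofReal ((1 + |Real.logb 2 ‖x‖|) ^ (-σ))

theorem measurable_radialFun (n : ℕ) (u σ : ℝ) : Measurable (radialFun n u σ) := by
  have : Measurable fun x : EuclideanSpace ℝ (Fin n) => Real.logb 2 ‖x‖ :=
    (Real.measurable_log.comp measurable_norm).div_const _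
  unfold radialFun
  exact (measurable_enorm.pow_const _).mul
    ((measurable_const.add (measurable_norm.comp this)).pow_const _).ennreal_ofReal

/-- For `p < u` the logarithmic factor is at most `1` and can be dropped. For `p = u` every dyadic
shell has the same mass up to that factor, which leaves a convergent sum of `(1 + |j|)^(-σp)`. -/
theorem morreyFun_radialFun_lt_top {n : ℕ} (hn : 1 ≤ n) {p u σ : ℝ} (hp : 0 < p) (hσ : 0 ≤ σ)
    (h : p < u ∨ (p = u ∧ 1 < σ * p)) : morreyFun p u (radialFun n u σ) < ∞ := by
  rcases h with h | ⟨rfl, h⟩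
  · refine (morreyFun_mono hp u fun x => ?_).trans_lt (morreyFun_enorm_rpow_lt_top hn hp h)
    refine mul_le_of_le_one_right' (ENNReal.ofReal_le_one.2 ?_)
    exact Real.rpow_le_one_of_one_le_of_nonpos (by linarith [abs_nonneg (Real.logb 2 ‖x‖)])
      (by linarith)
  · rw [morreyFun_self hp]
    refine ENNReal.rpow_lt_top_of_nonneg (by positivity) (ne_of_lt ?_)
    refine (lintegral_le_dyadic hn (b := fun j => ENNReal.ofReal
      (2 ^ (-(j * n : ℝ)) * ((1 + |(j : ℝ)|) / 2) ^ (-(σ * p)))) fun j x h1 h2 => ?_).trans_lt ?_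
    · have hj0 : (0 : ℝ) < 2 ^ j := by positivity
      have hx0 : 0 < ‖x‖ := by linarith
      have hl1 : (j : ℝ) ≤ Real.logb 2 ‖x‖ := by
        rw [Real.le_logb_iff_rpow_le (by norm_num) hx0, Real.rpow_intCast]; exact h1
      have hl2 : Real.logb 2 ‖x‖ ≤ (j : ℝ) + 1 := by
        rw [Real.logb_le_iff_le_rpow (by norm_num) hx0]
        have : (2 : ℝ) ^ ((j : ℝ) + 1) = 2 ^ (j + 1) := by
          exact_mod_cast Real.rpow_intCast 2 (j + 1)
        rw [this]; exact h2.le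
      have hlog : (1 + |(j : ℝ)|) / 2 ≤ 1 + |Real.logb 2 ‖x‖| := by
        rcases abs_cases (j : ℝ) with ⟨e1, _⟩ | ⟨e1, _⟩ <;>
        rcases abs_cases (Real.logb 2 ‖x‖) with ⟨e2, _⟩ | ⟨e2, _⟩ <;> rw [e1, e2] <;> linarith
      rw [radialFun, ENNReal.mul_rpow_of_nonneg _ _ hp.le, ← ENNReal.rpow_mul,
        ENNReal.ofReal_mul (by positivity)]
      refine mul_le_mul' ?_ ?_
      · rw [show -(n / p) * p = -(n : ℝ) by field_simp]
        refine (enorm_rpow_neg_le (by positivity) hj0 h1).trans (le_of_eq ?_)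
        rw [← Real.rpow_intCast, ← Real.rpow_mul (by norm_num), mul_neg]
      · rw [ENNReal.ofReal_rpow_of_pos (by positivity), ← Real.rpow_mul (by positivity), neg_mul]
        refine ENNReal.ofReal_le_ofReal ?_
        exact Real.rpow_le_rpow_of_nonpos (by positivity) hlog (by linarith)
    · have e : ∀ j : ℤ, ENNReal.ofReal (2 ^ (-(j * n : ℝ)) *
          ((1 + |(j : ℝ)|) / 2) ^ (-(σ * p))) * (ENNReal.ofReal (2 ^ ((j + 1) * n : ℝ)) *
          volume (Metric.ball (0 : EuclideanSpace ℝ (Fin n)) 1)) =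
          (ENNReal.ofReal (2 ^ (n : ℝ) * (1 / 2) ^ (-(σ * p))) *
            volume (Metric.ball (0 : EuclideanSpace ℝ (Fin n)) 1)) *
            ENNReal.ofReal ((1 + |(j : ℝ)|) ^ (-(σ * p))) := fun j => by
        rw [← mul_assoc, ← ENNReal.ofReal_mul (by positivity), mul_right_comm
          (ENNReal.ofReal _) (volume _), ← ENNReal.ofReal_mul (by positivity)]
        congr 2
        rw [div_eq_mul_one_div, Real.mul_rpow (by positivity) (by norm_num),
          show (j + 1) * n = (j * n : ℝ) + n by ring, Real.rpow_add (by norm_num),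
          Real.rpow_neg (by norm_num)]
        field_simp
      simp only [e]
      rw [ENNReal.tsum_mul_left]
      exact ENNReal.mul_lt_top (ENNReal.mul_lt_top ENNReal.ofReal_lt_top measure_ball_lt_top)
        (tsum_natAbs_rpow_lt_top h)

theorem volume_dyadic_annulus {n : ℕ} (hn : 1 ≤ n) {r : ℝ} (hr : 0 < r) :
    ENNReal.ofReal ((volume (Metric.ball (0 : EuclideanSpace ℝ (Fin n)) 1)).toReal / 2 *
      r ^ (n : ℝ)) ≤ volume (Metric.ball (0 : EuclideanSpace ℝ (Fin n)) r \ Metric.ball 0 (r / 2)) := by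
  set w := (volume (Metric.ball (0 : EuclideanSpace ℝ (Fin n)) 1)).toReal
  have hw : volume (Metric.ball (0 : EuclideanSpace ℝ (Fin n)) 1) = ENNReal.ofReal w :=
    (ENNReal.ofReal_toReal (volume_ball_ne_top _ _)).symm
  have hw0 : 0 ≤ w := ENNReal.toReal_nonneg
  rw [measure_sdiff (Metric.ball_subset_ball (by linarith)) measurableSet_ball.nullMeasurableSet
    (volume_ball_ne_top _ _), volume_ball_scale _ hr, volume_ball_scale _ (by positivity : 0 < r / 2),
    hw, ← ENNReal.ofReal_mul (by positivity), ← ENNReal.ofReal_mul (by positivity),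
    ← ENNReal.ofReal_sub _ (by positivity)]
  refine ENNReal.ofReal_le_ofReal ?_
  have h1 : (r / 2) ^ (n : ℝ) ≤ r ^ (n : ℝ) / 2 := by
    rw [Real.div_rpow hr.le (by norm_num)]
    gcongr
    calc (2 : ℝ) = 2 ^ (1 : ℝ) := (Real.rpow_one 2).symm
      _ ≤ 2 ^ (n : ℝ) := Real.rpow_le_rpow_of_exponent_le (by norm_num) (by exact_mod_cast hn)
  nlinarith

/-- A radial function in the Morrey space that is not in the interpolation space, for small `q`. -/
theorem exists_morrey_interpNorm_eq_top_of_radial {n : ℕ} (hn : 1 ≤ n) {p₀ u₀ p₁ u₁ p u θ : ℝ}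
    (hp₀ : 1 ≤ p₀) (hp₁ : 1 ≤ p₁) (hθ₀ : 0 < θ) (hθ₁ : θ < 1) (hp : 0 < p) (hu0 : 0 < u)
    (hu : 1 / u = (1 - θ) / u₀ + θ / u₁) (hne : u₀ ≠ u₁) {q : ℝ≥0∞} (hq : 0 < q) (hqt : q ≠ ∞)
    (h : p < u ∨ (p = u ∧ q.toReal < p)) :
    ∃ f ∈ morreySpace n p u, morreyInterpNorm p₀ u₀ p₁ u₁ θ q f = ∞ := by
  have hq' : 0 < q.toReal := ENNReal.toReal_pos hq.ne' hqt
  set r := q.toReal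
  -- The function must stay in `M^u_p` while `(1 + |m|)^(-σq)` is not summable. No damping is needed
  -- for `p < u`; for `p = u` the borderline `σ = 1/q` works because `q < p`.
  obtain ⟨σ, hσ0, hσr, hσ⟩ : ∃ σ : ℝ, 0 ≤ σ ∧ σ * r ≤ 1 ∧ (p < u ∨ (p = u ∧ 1 < σ * p)) := by
    rcases h with h | ⟨h1, h2⟩
    · exact ⟨0, le_rfl, by simp, Or.inl h⟩
    · refine ⟨1 / r, by positivity, by rw [one_div_mul_cancel hq'.ne'], Or.inr ⟨h1, ?_⟩⟩
      rw [one_div_mul_eq_div, one_lt_div hq']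
      exact h2
  have hfin := morreyFun_radialFun_lt_top hn hp hσ0 hσ
  obtain ⟨f, hf⟩ := exists_funSpace (measurable_radialFun n u σ)
    (ae_lt_top_of_morreyFun hp u (measurable_radialFun n u σ).aemeasurable hfin)
  refine ⟨f, ?_, ?_⟩
  · rw [mem_morreySpace_iff hp, morreyNorm_eq, morreyFun_congr_ae hp u hf]
    exact hfin
  set κ : ℝ := 1 / (n * (1 / u₀ - 1 / u₁)) with hκ
  have hw0 : 0 < (volume (Metric.ball (0 : EuclideanSpace ℝ (Fin n)) 1)).toReal :=
    ENNReal.toReal_pos (volume_ball_pos _ one_pos) (volume_ball_ne_top _ _)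
  obtain ⟨C, hC, hK⟩ := le_peetreK_of_dyadic hn hp₀ hp₁ hu hne hκ (half_pos hw0)
  obtain ⟨C', hC', hd⟩ := two_rpow_le_realInterpNorm (V := FunSpace n) hθ₀ hθ₁ hq
  have hlo := (hd (morreySpace n p₀ u₀) (morreySpace n p₁ u₁) (morreyNorm p₀ u₀)
    (morreyNorm p₁ u₁) f).2
  -- On the annulus of outer radius `2^(mκ)` one has `|log₂ |x|| ≤ |m||κ| + 1`, hence the factor `2
  -- + |κ|`.
  set a : ℤ → ℝ := fun m => ((2 + |κ|) * (1 + |(m : ℝ)|)) ^ (-σ) with ha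
  have key : ∀ m : ℤ, ENNReal.ofReal (a m) ≤ ENNReal.ofReal C *
      (ENNReal.ofReal (2 ^ (-(m * θ))) * peetreK (morreySpace n p₀ u₀) (morreySpace n p₁ u₁)
        (morreyNorm p₀ u₀) (morreyNorm p₁ u₁) (2 ^ (m : ℝ)) f) := fun m => by
    have hR : (0 : ℝ) < 2 ^ (m * κ) := by positivity
    have h1 := hK f m (a m) (Metric.ball 0 (2 ^ (m * κ)) \ Metric.ball 0 (2 ^ (m * κ) / 2))
      (measurableSet_ball.diff measurableSet_ball) (by positivity) sdiff_subset (by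
        have := volume_dyadic_annulus hn hR
        rwa [← Real.rpow_mul (by norm_num)] at this) ?_
    · calc ENNReal.ofReal (a m) =
            ENNReal.ofReal (2 ^ (-(m * θ))) * ENNReal.ofReal (a m * 2 ^ (m * θ)) := by
            rw [← ENNReal.ofReal_mul (by positivity)]
            congr 1
            rw [Real.rpow_neg (by norm_num)]
            field_simp
        _ ≤ ENNReal.ofReal (2 ^ (-(m * θ))) * (ENNReal.ofReal C * _) := by gcongr
        _ = _ := by ring
    · filter_upwards [hf] with y hy hyS
      rw [hy, radialFun, mul_comm (a m), ENNReal.ofReal_mul (by positivity)]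
      have y1 : ‖y‖ < 2 ^ (m * κ) := by simpa using hyS.1
      have y2 : 2 ^ (m * κ) / 2 ≤ ‖y‖ := by simpa using hyS.2
      have y0 : 0 < ‖y‖ := by linarith
      refine mul_le_mul' ?_ ?_
      · rw [← ofReal_norm, ENNReal.ofReal_rpow_of_pos y0]
        refine ENNReal.ofReal_le_ofReal ?_
        rw [← mul_neg, Real.rpow_mul (by norm_num)]
        exact Real.rpow_le_rpow_of_nonpos y0 y1.le (by
          rw [neg_nonpos]; positivity)
      · refine ENNReal.ofReal_le_ofReal ?_
        refine Real.rpow_le_rpow_of_nonpos (by positivity) ?_ (by linarith)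
        have l1 : Real.logb 2 ‖y‖ ≤ m * κ := by
          rw [Real.logb_le_iff_le_rpow (by norm_num) y0]; exact y1.le
        have l2 : m * κ - 1 ≤ Real.logb 2 ‖y‖ := by
          rw [Real.le_logb_iff_rpow_le (by norm_num) y0, Real.rpow_sub (by norm_num),
            Real.rpow_one]
          exact y2
        have l3 : |Real.logb 2 ‖y‖| ≤ |(m : ℝ)| * |κ| + 1 := by
          rw [← abs_mul, abs_le]
          constructor
          · linarith [neg_abs_le ((m : ℝ) * κ)]
          · linarith [le_abs_self ((m : ℝ) * κ)]
        nlinarith [abs_nonneg κ, abs_nonneg (m : ℝ)]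
  have hsum : lqNorm q (fun m => ENNReal.ofReal (a m)) = ∞ := by
    unfold lqNorm
    rw [if_neg hqt]
    refine (ENNReal.rpow_eq_top_iff_of_pos (by positivity)).2 ?_
    have e : ∀ m : ℤ, ENNReal.ofReal (a m) ^ q.toReal = ENNReal.ofReal ((2 + |κ|) ^ (-(σ * r))) *
        ENNReal.ofReal ((1 + |(m : ℝ)|) ^ (-(σ * r))) := fun m => by
      rw [ha, ENNReal.ofReal_rpow_of_pos (by positivity), ← Real.rpow_mul (by positivity), neg_mul,
        Real.mul_rpow (by positivity) (by positivity), ENNReal.ofReal_mul (by positivity)]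
    simp only [e]
    rw [ENNReal.tsum_mul_left, tsum_natAbs_rpow_eq_top hσr, ENNReal.mul_top]
    exact (ENNReal.ofReal_pos.2 (by positivity)).ne'
  have hle := lqNorm_mono (q := q) key
  rw [hsum, lqNorm_const_mul hq, top_le_iff] at hle
  have htop : lqNorm q (fun m : ℤ => ENNReal.ofReal (2 ^ (-(m * θ))) *
      peetreK (morreySpace n p₀ u₀) (morreySpace n p₁ u₁)
        (morreyNorm p₀ u₀) (morreyNorm p₁ u₁) (2 ^ (m : ℝ)) f) = ∞ := by
    by_contra hne'
    exact ENNReal.mul_ne_top ENNReal.ofReal_ne_top hne' hle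
  rw [htop, top_le_iff] at hlo
  by_contra hne'
  exact ENNReal.mul_ne_top ENNReal.ofReal_ne_top hne' hlo

/-! ### Equal ratios and large q: superpositions of dilates -/

theorem tsum_rpow_le_rpow_tsum {ι : Type*} {p : ℝ} (hp : 1 ≤ p) (b : ι → ℝ≥0∞) :
    ∑' k, b k ^ p ≤ (∑' k, b k) ^ p := by
  have e : ∀ x : ℝ≥0∞, x ^ p = x * x ^ (p - 1) := fun x => by
    conv_lhs => rw [show p = 1 + (p - 1) by ring]
    rw [ENNReal.rpow_add_of_nonneg _ _ zero_le_one (by linarith), ENNReal.rpow_one]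
  calc ∑' k, b k ^ p ≤ ∑' k, b k * (∑' k, b k) ^ (p - 1) := by
        refine ENNReal.tsum_le_tsum fun k => ?_
        rw [e]
        exact mul_le_mul' le_rfl (ENNReal.rpow_le_rpow (ENNReal.le_tsum k) (by linarith))
    _ = _ := by rw [ENNReal.tsum_mul_right, ← e]

theorem tsum_linear_mul_pow_natAbs_lt_top {x : ℝ} (hx0 : 0 ≤ x) (hx : x < 1) :
    ∑' j : ℤ, ENNReal.ofReal ((1 + |(j : ℝ)|) * x ^ j.natAbs) < ∞ := by
  have e : ∀ j : ℤ, ENNReal.ofReal ((1 + |(j : ℝ)|) * x ^ j.natAbs) =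
      (fun m : ℕ => ENNReal.ofReal ((1 + (m : ℝ)) * x ^ m)) j.natAbs := fun j => by
    simp only [Nat.cast_natAbs, Int.cast_abs]
  simp only [e]
  refine (tsum_natAbs_le fun m : ℕ => ENNReal.ofReal ((1 + (m : ℝ)) * x ^ m)).trans_lt
    (ENNReal.mul_lt_top ENNReal.ofNat_lt_top ?_)
  have h1 : Summable fun m : ℕ => x ^ m := summable_geometric_of_lt_one hx0 hx
  have h2 : Summable fun m : ℕ => (m : ℝ) * x ^ m := by
    have := summable_pow_mul_geometric_of_norm_lt_one 1
      (show ‖x‖ < 1 by rwa [Real.norm_of_nonneg hx0])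
    simpa using this
  have h3 : Summable fun m : ℕ => (1 + (m : ℝ)) * x ^ m :=
    (h1.add h2).congr fun m => by ring
  rw [← ENNReal.ofReal_tsum_of_nonneg (fun m => by positivity) h3]
  exact ENNReal.ofReal_lt_top

/-- The coefficients change at most linearly in the distance of the indices, so summing them against
a geometric kernel centred at `m` reproduces the coefficient at `m` up to a constant. -/
theorem slow_variation {p : ℝ} (hp : 1 ≤ p) (k m : ℤ) :
    (1 + |(k : ℝ)|) ^ (-(1 / p)) ≤
      (1 + |(m : ℝ)|) ^ (-(1 / p)) * (1 + |((k - m : ℤ) : ℝ)|) := by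
  have hp0 : 0 < p := by linarith
  have h1 : (1 + |(m : ℝ)|) ≤ (1 + |(k : ℝ)|) * (1 + |((k - m : ℤ) : ℝ)|) := by
    have : |(m : ℝ)| ≤ |(k : ℝ)| + |((k - m : ℤ) : ℝ)| := by
      push_cast
      calc |(m : ℝ)| = |(k : ℝ) - ((k : ℝ) - m)| := by ring_nf
        _ ≤ _ := abs_sub _ _
    nlinarith [abs_nonneg (k : ℝ), abs_nonneg ((k - m : ℤ) : ℝ)]
  have h2 : (1 + |(m : ℝ)|) ^ (1 / p) ≤ (1 + |(k : ℝ)|) ^ (1 / p) *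
      (1 + |((k - m : ℤ) : ℝ)|) := by
    calc _ ≤ ((1 + |(k : ℝ)|) * (1 + |((k - m : ℤ) : ℝ)|)) ^ (1 / p) := by gcongr
      _ = (1 + |(k : ℝ)|) ^ (1 / p) * (1 + |((k - m : ℤ) : ℝ)|) ^ (1 / p) :=
          Real.mul_rpow (by positivity) (by positivity)
      _ ≤ (1 + |(k : ℝ)|) ^ (1 / p) * (1 + |((k - m : ℤ) : ℝ)|) ^ (1 : ℝ) := by
          gcongr
          · linarith [abs_nonneg ((k - m : ℤ) : ℝ)]
          · rw [div_le_one hp0]; exact hp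
      _ = _ := by rw [Real.rpow_one]
  rw [Real.rpow_neg (by positivity), Real.rpow_neg (by positivity), ← div_eq_inv_mul,
    inv_eq_one_div, div_le_div_iff₀ (by positivity) (by positivity)]
  linarith

/-- The dilate of `h` by `2^(kκ)`, normalized in the Morrey space with parameter `u`. -/
def morreyDilate {n : ℕ} (u κ : ℝ) (h : EuclideanSpace ℝ (Fin n) → ℝ≥0∞) (k : ℤ)
    (x : EuclideanSpace ℝ (Fin n)) : ℝ≥0∞ :=
  ENNReal.ofReal (2 ^ (-(k * κ * (n / u)))) * h ((2 : ℝ) ^ (-(k * κ)) • x)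

theorem measurable_morreyDilate {n : ℕ} (u κ : ℝ) {h : EuclideanSpace ℝ (Fin n) → ℝ≥0∞}
    (hh : Measurable h) (k : ℤ) : Measurable (morreyDilate u κ h k) :=
  (hh.comp (measurable_const_smul _)).const_mul _

theorem morreyFun_dilate_le {n : ℕ} {p : ℝ} (hp : 0 < p) (v u κ : ℝ)
    {h : EuclideanSpace ℝ (Fin n) → ℝ≥0∞} (hh : Measurable h) (k : ℤ) :
    morreyFun p v (morreyDilate u κ h k) ≤
      ENNReal.ofReal (2 ^ (k * (κ * n * (1 / v - 1 / u)))) * morreyFun p v h := by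
  have h1 := morreyFun_comp_smul_le hp v (b := (2 : ℝ) ^ (-(k * κ))) (by positivity) hh
  have h2 := morreyFun_const_mul hp v (ENNReal.ofReal (2 ^ (-(k * κ * (n / u)))))
    (hh.comp (measurable_const_smul ((2 : ℝ) ^ (-(k * κ))))).aemeasurable
  calc _ = _ := h2
    _ ≤ ENNReal.ofReal (2 ^ (-(k * κ * (n / u)))) * (ENNReal.ofReal
        (((2 : ℝ) ^ (-(k * κ))) ^ (-(n / v))) * morreyFun p v h) := by gcongr; exact h1
    _ = _ := by
        rw [← mul_assoc, ← ENNReal.ofReal_mul (by positivity), ← Real.rpow_mul (by norm_num),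
          ← Real.rpow_add (by norm_num)]
        congr 3
        ring

/-- The upper bound for the `K`-functional of a superposition of dilates. -/
theorem peetreK_dilates_le {n : ℕ} (hn : 1 ≤ n) {p₀ u₀ p₁ u₁ p u θ κ : ℝ}
    (hp₀ : 1 ≤ p₀) (hp₁ : 1 ≤ p₁) (hp : 1 ≤ p) (hθ₀ : 0 < θ) (hθ₁ : θ < 1)
    (hu : 1 / u = (1 - θ) / u₀ + θ / u₁) (hne : u₀ ≠ u₁)
    (hκ : κ = 1 / (n * (1 / u₀ - 1 / u₁)))
    {h : EuclideanSpace ℝ (Fin n) → ℝ≥0∞} (hh : Measurable h)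
    (h₀ : morreyFun p₀ u₀ h < ∞) (h₁ : morreyFun p₁ u₁ h < ∞) :
    ∃ (C : ℝ≥0∞) (f : FunSpace n), C ≠ ∞ ∧
      (fun y => ‖f y‖ₑ) =ᵐ[volume] (fun y => ∑' k : ℤ,
        ENNReal.ofReal ((1 + |(k : ℝ)|) ^ (-(1 / p))) * morreyDilate u κ h k y) ∧
      (∃ x₀ ∈ morreySpace n p₀ u₀, ∃ x₁ ∈ morreySpace n p₁ u₁, f = x₀ + x₁) ∧
      ∀ m : ℤ, ENNReal.ofReal (2 ^ (-(m * θ))) * peetreK (morreySpace n p₀ u₀)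
        (morreySpace n p₁ u₁) (morreyNorm p₀ u₀) (morreyNorm p₁ u₁) (2 ^ (m : ℝ)) f ≤
        C * ENNReal.ofReal ((1 + |(m : ℝ)|) ^ (-(1 / p))) := by
  have hp₀' : 0 < p₀ := by linarith
  have hp₁' : 0 < p₁ := by linarith
  have hn' : (0 : ℝ) < n := by exact_mod_cast hn
  have hnot : 1 / u₀ - 1 / u₁ ≠ 0 := by
    intro h
    apply hne
    have : 1 / u₀ = 1 / u₁ := by linarith
    simpa using this
  have hκ1 : κ * n * (1 / u₀ - 1 / u₁) = 1 := by rw [hκ]; field_simp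
  -- The normalized dilates grow like `2^(kθ)` in the first space and like `2^(k(θ - 1))` in the
  -- second.
  have E₀ : κ * n * (1 / u₀ - 1 / u) = θ := by
    linear_combination θ * hκ1 + κ * n * interp_sub_eq hu
  have E₁ : κ * n * (1 / u₁ - 1 / u) = θ - 1 := by
    linear_combination (θ - 1) * hκ1 + κ * n * interp_sub_eq hu
  set a : ℤ → ℝ := fun k => (1 + |(k : ℝ)|) ^ (-(1 / p)) with ha
  have ha0 : ∀ k, 0 ≤ a k := fun k => by positivity
  set x : ℝ := 2 ^ (-min θ (1 - θ)) with hx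
  have hx0 : 0 < x := by positivity
  have hx1 : x < 1 := two_rpow_neg_min_lt_one hθ₀ hθ₁
  set G := ∑' j : ℤ, ENNReal.ofReal ((1 + |(j : ℝ)|) * x ^ j.natAbs) with hG
  have hGt : G < ∞ := tsum_linear_mul_pow_natAbs_lt_top hx0.le hx1
  set T : ℤ → EuclideanSpace ℝ (Fin n) → ℝ≥0∞ :=
    fun k y => ENNReal.ofReal (a k) * morreyDilate u κ h k y with hT
  have hTm : ∀ k, Measurable (T k) := fun k => (measurable_morreyDilate u κ hh k).const_mul _
  have conv : ∀ m : ℤ, ∑' k : ℤ, ENNReal.ofReal (a k * x ^ (k - m).natAbs) ≤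
      ENNReal.ofReal (a m) * G := fun m => by
    rw [hG, ← (Equiv.subRight m).tsum_eq
      (fun j : ℤ => ENNReal.ofReal ((1 + |(j : ℝ)|) * x ^ j.natAbs)), ← ENNReal.tsum_mul_left]
    refine ENNReal.tsum_le_tsum fun k => ?_
    rw [← ENNReal.ofReal_mul (ha0 m), Equiv.subRight_apply, ← mul_assoc]
    refine ENNReal.ofReal_le_ofReal ?_
    gcongr
    exact slow_variation hp k m
  -- For `t = 2^m` the series is cut at `k = m`. Lower indices are summable in the first space and
  -- higher ones in the second, with geometric decay in `|k - m|`.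
  set g₀ : ℤ → EuclideanSpace ℝ (Fin n) → ℝ≥0∞ :=
    fun m y => ∑' k : ℤ, if k ≤ m then T k y else 0 with hg₀
  set g₁ : ℤ → EuclideanSpace ℝ (Fin n) → ℝ≥0∞ :=
    fun m y => ∑' k : ℤ, if k ≤ m then 0 else T k y with hg₁
  have m₀' : ∀ m k : ℤ, Measurable fun y => if k ≤ m then T k y else 0 := fun m k => by
    split_ifs
    · exact hTm k
    · exact measurable_const
  have m₁' : ∀ m k : ℤ, Measurable fun y => if k ≤ m then 0 else T k y := fun m k => by
    split_ifs
    · exact measurable_const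
    · exact hTm k
  have m₀ : ∀ m, Measurable (g₀ m) := fun m => Measurable.tsum fun k => m₀' m k
  have m₁ : ∀ m, Measurable (g₁ m) := fun m => Measurable.tsum fun k => m₁' m k
  have hadd : ∀ m y, ∑' k, T k y = g₀ m y + g₁ m y := fun m y => by
    simp only [hg₀, hg₁]
    rw [← ENNReal.tsum_add]
    refine tsum_congr fun k => ?_
    split_ifs <;> simp
  have xle : ∀ (s : ℝ) (j : ℤ), s ≤ -min θ (1 - θ) * |(j : ℝ)| → (2 : ℝ) ^ s ≤ x ^ j.natAbs :=
    fun s j hs => by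
    rw [hx, ← Real.rpow_natCast, ← Real.rpow_mul (by norm_num), Nat.cast_natAbs, Int.cast_abs]
    exact Real.rpow_le_rpow_of_exponent_le (by norm_num) hs
  have N₀ : ∀ m : ℤ, ENNReal.ofReal (2 ^ (-(m * θ))) * morreyFun p₀ u₀ (g₀ m) ≤
      ENNReal.ofReal (a m) * G * morreyFun p₀ u₀ h := fun m => by
    calc _ ≤ ENNReal.ofReal (2 ^ (-(m * θ))) * ∑' k : ℤ, morreyFun p₀ u₀
          (fun y => if k ≤ m then T k y else 0) := by
          gcongr
          exact morreyFun_tsum_le hp₀ u₀ fun k => (m₀' m k).aemeasurable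
      _ ≤ ∑' k : ℤ, ENNReal.ofReal (a k * x ^ (k - m).natAbs) * morreyFun p₀ u₀ h := by
          rw [← ENNReal.tsum_mul_left]
          refine ENNReal.tsum_le_tsum fun k => ?_
          split_ifs with hk
          · simp only [hT]
            rw [morreyFun_const_mul hp₀' u₀ _ (measurable_morreyDilate u κ hh k).aemeasurable]
            calc _ ≤ ENNReal.ofReal (2 ^ (-(m * θ))) * (ENNReal.ofReal (a k) *
                  (ENNReal.ofReal (2 ^ (k * θ)) * morreyFun p₀ u₀ h)) := by
                  gcongr
                  have := morreyFun_dilate_le hp₀' u₀ u κ hh k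
                  rwa [E₀] at this
              _ = ENNReal.ofReal (a k * 2 ^ (((k - m : ℤ) : ℝ) * θ)) * morreyFun p₀ u₀ h := by
                  rw [mul_left_comm, ← mul_assoc, ← mul_assoc, ← ENNReal.ofReal_mul (ha0 k),
                    ← ENNReal.ofReal_mul (by positivity), mul_assoc (a k),
                    ← Real.rpow_add (by norm_num)]
                  push_cast
                  congr 4
                  ring
              _ ≤ _ := by
                  gcongr
                  refine xle _ _ ?_
                  have hk' : ((k - m : ℤ) : ℝ) ≤ 0 := by exact_mod_cast sub_nonpos.2 hk
                  rw [abs_of_nonpos hk']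
                  nlinarith [min_le_left θ (1 - θ)]
          · rw [morreyFun_zero hp₀', mul_zero]
            exact bot_le
      _ ≤ _ := by
          rw [ENNReal.tsum_mul_right]
          gcongr
          exact conv m
  have N₁ : ∀ m : ℤ, ENNReal.ofReal (2 ^ (-(m * θ))) * (ENNReal.ofReal (2 ^ (m : ℝ)) *
      morreyFun p₁ u₁ (g₁ m)) ≤ ENNReal.ofReal (a m) * G * morreyFun p₁ u₁ h := fun m => by
    rw [← mul_assoc, ← ENNReal.ofReal_mul (by positivity), ← Real.rpow_add (by norm_num)]
    calc _ ≤ ENNReal.ofReal (2 ^ (-(m * θ) + m)) * ∑' k : ℤ, morreyFun p₁ u₁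
          (fun y => if k ≤ m then 0 else T k y) := by
          gcongr
          exact morreyFun_tsum_le hp₁ u₁ fun k => (m₁' m k).aemeasurable
      _ ≤ ∑' k : ℤ, ENNReal.ofReal (a k * x ^ (k - m).natAbs) * morreyFun p₁ u₁ h := by
          rw [← ENNReal.tsum_mul_left]
          refine ENNReal.tsum_le_tsum fun k => ?_
          split_ifs with hk
          · rw [morreyFun_zero hp₁', mul_zero]
            exact bot_le
          · simp only [hT]
            rw [morreyFun_const_mul hp₁' u₁ _ (measurable_morreyDilate u κ hh k).aemeasurable]
            calc _ ≤ ENNReal.ofReal (2 ^ (-(m * θ) + m)) * (ENNReal.ofReal (a k) *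
                  (ENNReal.ofReal (2 ^ (k * (θ - 1))) * morreyFun p₁ u₁ h)) := by
                  gcongr
                  have := morreyFun_dilate_le hp₁' u₁ u κ hh k
                  rwa [E₁] at this
              _ = ENNReal.ofReal (a k * 2 ^ (((k - m : ℤ) : ℝ) * (θ - 1))) *
                    morreyFun p₁ u₁ h := by
                  rw [mul_left_comm, ← mul_assoc, ← mul_assoc, ← ENNReal.ofReal_mul (ha0 k),
                    ← ENNReal.ofReal_mul (by positivity), mul_assoc (a k),
                    ← Real.rpow_add (by norm_num)]
                  push_cast
                  congr 4
                  ring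
              _ ≤ _ := by
                  gcongr
                  refine xle _ _ ?_
                  have hk' : 0 ≤ ((k - m : ℤ) : ℝ) := by
                    exact_mod_cast sub_nonneg.2 (not_le.1 hk).le
                  rw [abs_of_nonneg hk']
                  nlinarith [min_le_right θ (1 - θ)]
      _ ≤ _ := by
          rw [ENNReal.tsum_mul_right]
          gcongr
          exact conv m
  have fin : ∀ {c X Y : ℝ≥0∞}, 0 < c → c * X ≤ Y → Y < ∞ → X < ∞ := fun {c X Y} hc hX hY => by
    refine lt_top_iff_ne_top.2 fun htop => (hX.trans_lt hY).ne ?_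
    rw [htop, ENNReal.mul_top hc.ne']
  have pos : ∀ s : ℝ, 0 < ENNReal.ofReal ((2 : ℝ) ^ s) := fun s =>
    ENNReal.ofReal_pos.2 (by positivity)
  have F₀ : ∀ m, morreyFun p₀ u₀ (g₀ m) < ∞ := fun m => fin (pos _) (N₀ m)
    (ENNReal.mul_lt_top (ENNReal.mul_lt_top ENNReal.ofReal_lt_top hGt) h₀)
  have F₁ : ∀ m, morreyFun p₁ u₁ (g₁ m) < ∞ := fun m => fin (pos _) le_rfl (fin (pos _) (N₁ m)
    (ENNReal.mul_lt_top (ENNReal.mul_lt_top ENNReal.ofReal_lt_top hGt) h₁))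
  have hfin : ∀ᵐ y, ∑' k, T k y < ∞ := by
    filter_upwards [ae_lt_top_of_morreyFun hp₀' u₀ (m₀ 0).aemeasurable (F₀ 0),
      ae_lt_top_of_morreyFun hp₁' u₁ (m₁ 0).aemeasurable (F₁ 0)] with y hy₀ hy₁
    rw [hadd 0]
    exact ENNReal.add_lt_top.2 ⟨hy₀, hy₁⟩
  obtain ⟨f, hf⟩ := exists_funSpace (Measurable.tsum hTm) (by
    filter_upwards [hfin] with y hy
    simpa only [tsum_apply (Pi.summable.2 fun _ => ENNReal.summable)] using hy)
  have hf' : (fun y => ‖f y‖ₑ) =ᵐ[volume] fun y => ∑' k, T k y := by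
    filter_upwards [hf] with y hy
    simpa only [tsum_apply (Pi.summable.2 fun _ => ENNReal.summable)] using hy
  have main := fun m => morrey_peetreK_le hp₀' hp₁' u₀ u₁ f (m₀ m) (m₁ m) (by
    filter_upwards [hf'] with y hy
    rw [hy, hadd m]) (F₀ m) (F₁ m)
  refine ⟨2 * (G * (morreyFun p₀ u₀ h + morreyFun p₁ u₁ h)), f,
    (ENNReal.mul_lt_top ENNReal.ofNat_lt_top (ENNReal.mul_lt_top hGt
      (ENNReal.add_lt_top.2 ⟨h₀, h₁⟩))).ne, hf', (main 0).1, fun m => ?_⟩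
  calc _ ≤ ENNReal.ofReal (2 ^ (-(m * θ))) * (2 * (morreyFun p₀ u₀ (g₀ m) +
        ENNReal.ofReal (2 ^ (m : ℝ)) * morreyFun p₁ u₁ (g₁ m))) := by
        gcongr
        exact (main m).2 _
    _ = 2 * (ENNReal.ofReal (2 ^ (-(m * θ))) * morreyFun p₀ u₀ (g₀ m) +
        ENNReal.ofReal (2 ^ (-(m * θ))) * (ENNReal.ofReal (2 ^ (m : ℝ)) *
          morreyFun p₁ u₁ (g₁ m))) := by ring
    _ ≤ 2 * (ENNReal.ofReal (a m) * G * morreyFun p₀ u₀ h +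
        ENNReal.ofReal (a m) * G * morreyFun p₁ u₁ h) :=
        mul_le_mul' le_rfl (add_le_add (N₀ m) (N₁ m))
    _ = _ := by ring

/-- For `kκ ≤ 0` the dilate compresses by `b = 2^(-kκ) ≥ 1` and brings `Q b` into one fixed ball.
Its mass there is at least `c b^(np/u) b^(-n) b^(nγ) = c`, whatever `k` is. -/
theorem le_setLIntegral_morreyDilate {n : ℕ} {p u κ γ c : ℝ} (hp : 0 < p) (hγ : γ = 1 - p / u)
    {E : Set (EuclideanSpace ℝ (Fin n))} {Q : ℝ → Set (EuclideanSpace ℝ (Fin n))}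
    (hE : MeasurableSet E) (hQm : ∀ R, MeasurableSet (Q R)) (hQE : ∀ R, Q R ⊆ E)
    (hQb : ∀ R, 1 ≤ R → Q R ⊆ Metric.ball 0 ((n + 1) * R))
    (hQv : ∀ R, 1 ≤ R → ENNReal.ofReal (c * R ^ (n * γ)) ≤ volume (Q R))
    {k : ℤ} (hk : k * κ ≤ 0) :
    ENNReal.ofReal c ≤ ∫⁻ y in Metric.ball (0 : EuclideanSpace ℝ (Fin n)) (n + 1),
      morreyDilate u κ (E.indicator fun _ => 1) k y ^ p := by
  set b : ℝ := 2 ^ (-(k * κ)) with hb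
  have hb0 : 0 < b := by positivity
  have hb1 : 1 ≤ b := Real.one_le_rpow (by norm_num) (by linarith)
  have hm : Measurable (E.indicator fun _ => 1 : EuclideanSpace ℝ (Fin n) → ℝ≥0∞) :=
    measurable_const.indicator hE
  have e1 : ∀ y, morreyDilate u κ (E.indicator fun _ => 1) k y ^ p =
      ENNReal.ofReal (b ^ (n / u * p)) *
        (fun z => E.indicator (fun _ => (1 : ℝ≥0∞)) z ^ p) (b • y) := fun y => by
    simp only [morreyDilate]
    rw [ENNReal.mul_rpow_of_nonneg _ _ hp.le, ENNReal.ofReal_rpow_of_pos (by positivity), hb,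
      ← Real.rpow_mul (by norm_num), ← Real.rpow_mul (by norm_num)]
    congr 3
    ring
  have hmb : Measurable fun y => (fun z => E.indicator (fun _ => (1 : ℝ≥0∞)) z ^ p) (b • y) :=
    (hm.pow_const p).comp (measurable_const_smul b)
  rw [lintegral_congr e1, lintegral_const_mul _ hmb,
    lintegral_ball_comp_smul hb0 (hm.pow_const p)]
  have low : ENNReal.ofReal (c * b ^ (n * γ)) ≤
      ∫⁻ y in Metric.ball (b • (0 : EuclideanSpace ℝ (Fin n))) (b * (n + 1)),
        E.indicator (fun _ => (1 : ℝ≥0∞)) y ^ p := by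
    calc _ ≤ volume (Q b) := hQv b hb1
      _ = ∫⁻ y in Q b, 1 := by simp
      _ ≤ ∫⁻ y in Q b, E.indicator (fun _ => (1 : ℝ≥0∞)) y ^ p :=
          setLIntegral_mono' (hQm b) fun y hy => by simp [hQE b hy]
      _ ≤ _ := lintegral_mono_set (by rw [smul_zero, mul_comm]; exact hQb b hb1)
  calc ENNReal.ofReal c = ENNReal.ofReal (b ^ (n / u * p)) * (ENNReal.ofReal (b ^ (-(n : ℝ))) *
        ENNReal.ofReal (c * b ^ (n * γ))) := by
        rw [← ENNReal.ofReal_mul (by positivity), ← ENNReal.ofReal_mul (by positivity)]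
        congr 1
        have : b ^ ((n : ℝ) / u * p) * (b ^ (-(n : ℝ)) * b ^ (n * γ)) = 1 := by
          rw [← Real.rpow_add hb0, ← Real.rpow_add hb0, hγ]
          convert Real.rpow_zero b using 2
          ring
        linear_combination -c * this
    _ ≤ _ := by gcongr

theorem lqNorm_natAbs_rpow_lt_top {p : ℝ} (hp : 0 < p) {q : ℝ≥0∞}
    (hq : q = ∞ ∨ p < q.toReal) :
    lqNorm q (fun m : ℤ => ENNReal.ofReal ((1 + |(m : ℝ)|) ^ (-(1 / p)))) < ∞ := by
  unfold lqNorm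
  split_ifs with h
  · refine lt_of_le_of_lt (iSup_le fun m => ?_) ENNReal.one_lt_top
    refine ENNReal.ofReal_le_one.2 (Real.rpow_le_one_of_one_le_of_nonpos ?_ ?_)
    · linarith [abs_nonneg (m : ℝ)]
    · rw [neg_nonpos]; positivity
  · have hq' : p < q.toReal := hq.resolve_left h
    refine ENNReal.rpow_lt_top_of_nonneg (by have := hp.trans hq'; positivity) ?_
    have e : ∀ m : ℤ, ENNReal.ofReal ((1 + |(m : ℝ)|) ^ (-(1 / p))) ^ q.toReal =
        ENNReal.ofReal ((1 + |(m : ℝ)|) ^ (-(q.toReal / p))) := fun m => by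
      rw [ENNReal.ofReal_rpow_of_pos (by positivity), ← Real.rpow_mul (by positivity)]
      congr 2
      ring
    simp only [e]
    exact (tsum_natAbs_rpow_lt_top ((one_lt_div hp).2 hq')).ne

/-- Equal ratios `pᵢ / uᵢ` and `q > p`: the interpolation space is not contained in the Morrey
space. -/
theorem exists_mem_morreyInterpSpace_notMem {n : ℕ} (hn : 1 ≤ n) {p₀ u₀ p₁ u₁ p u θ : ℝ}
    (hp₀ : 1 ≤ p₀) (hpu₀ : p₀ ≤ u₀) (hp₁ : 1 ≤ p₁) (hp : 1 ≤ p) (hθ₀ : 0 < θ)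
    (hθ₁ : θ < 1) (hu : 1 / u = (1 - θ) / u₀ + θ / u₁) (hne : u₀ ≠ u₁)
    (h₀ : p₀ / u₀ = p / u) (h₁ : p₁ / u₁ = p / u) {q : ℝ≥0∞} (hq : 0 < q)
    (hqp : q = ∞ ∨ p < q.toReal) :
    ∃ f ∈ morreyInterpSpace n p₀ u₀ p₁ u₁ θ q, f ∉ morreySpace n p u := by
  have hp0 : 0 < p := by linarith
  have hγ₀ : 0 ≤ 1 - p / u := by
    rw [← h₀, sub_nonneg, div_le_one (by linarith)]; exact hpu₀
  have hγ₁ : 1 - p / u ≤ 1 := by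
    rw [← h₀]
    have : 0 ≤ p₀ / u₀ := div_nonneg (by linarith) (by linarith)
    linarith
  obtain ⟨E, Q, c, hE, hQm, hQE, hc, hQb, hEf, hQv, -⟩ := exists_sparse_set n hγ₀ hγ₁
  set h : EuclideanSpace ℝ (Fin n) → ℝ≥0∞ := E.indicator fun _ => 1 with hh
  have hm : Measurable h := measurable_const.indicator hE
  set κ : ℝ := 1 / (n * (1 / u₀ - 1 / u₁)) with hκ
  obtain ⟨C, f, hC, hf, hdec, hK⟩ := peetreK_dilates_le hn hp₀ hp₁ hp hθ₀ hθ₁ hu hne hκ hm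
    (hEf p₀ u₀ (by linarith) (by rw [h₀])) (hEf p₁ u₁ (by linarith) (by rw [h₁]))
  refine ⟨f, ⟨hdec, ?_⟩, fun hmem => ?_⟩
  · obtain ⟨C', -, hd⟩ := two_rpow_le_realInterpNorm (V := FunSpace n) hθ₀ hθ₁ hq
    refine (hd _ _ _ _ _).1.trans_lt (ENNReal.mul_lt_top ENNReal.ofReal_lt_top ?_)
    refine (lqNorm_mono hK).trans_lt ?_
    rw [lqNorm_const_mul hq]
    exact ENNReal.mul_lt_top hC.lt_top (lqNorm_natAbs_rpow_lt_top hp0 hqp)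
  · rw [mem_morreySpace_iff hp0, morreyNorm_eq, morreyFun_congr_ae hp0 u hf] at hmem
    set B := Metric.ball (0 : EuclideanSpace ℝ (Fin n)) (n + 1)
    have hB : (0 : ℝ) < n + 1 := by positivity
    -- `ι` lists the indices whose dilates are compressions: the nonnegative or the nonpositive
    -- integers, depending on the sign of `κ`.
    obtain ⟨ι, hι, hικ, hιa⟩ : ∃ ι : ℕ → ℤ, Function.Injective ι ∧ (∀ m, ι m * κ ≤ 0) ∧
        ∀ m, |(ι m : ℝ)| = m := by
      rcases le_total κ 0 with hs | hs
      · exact ⟨fun m => m, Nat.cast_injective, fun m => by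
          have : (0 : ℝ) ≤ m := by positivity
          push_cast; nlinarith, fun m => by simp⟩
      · exact ⟨fun m => -m, fun a b hab => by simpa using hab, fun m => by
          have : (0 : ℝ) ≤ m := by positivity
          push_cast; nlinarith, fun m => by simp⟩
    have low : ∞ ≤ ∫⁻ y in B, (∑' k : ℤ, ENNReal.ofReal ((1 + |(k : ℝ)|) ^ (-(1 / p))) *
        morreyDilate u κ h k y) ^ p := by
      -- The `p`-th powers of the coefficients form the harmonic series, each dilate contributes at
      -- least `c` on `B`, and a sum of `p`-th powers is at most the `p`-th power of the sum.
      calc ∞ = (∑' m : ℕ, ENNReal.ofReal ((1 + (m : ℝ)) ^ (-(1 : ℝ)))) * ENNReal.ofReal c := by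
            rw [tsum_nat_rpow_eq_top le_rfl, ENNReal.top_mul (ENNReal.ofReal_pos.2 hc).ne']
        _ ≤ ∑' m : ℕ, ∫⁻ y in B, (ENNReal.ofReal ((1 + |(ι m : ℝ)|) ^ (-(1 / p))) *
              morreyDilate u κ h (ι m) y) ^ p := by
            rw [← ENNReal.tsum_mul_right]
            refine ENNReal.tsum_le_tsum fun m => ?_
            simp only [ENNReal.mul_rpow_of_nonneg _ _ hp0.le]
            rw [lintegral_const_mul _ ((measurable_morreyDilate u κ hm _).pow_const p), hιa,
              ENNReal.ofReal_rpow_of_pos (by positivity), ← Real.rpow_mul (by positivity)]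
            rw [show -(1 / p) * p = -1 by field_simp]
            exact mul_le_mul' le_rfl
              (le_setLIntegral_morreyDilate hp0 rfl hE hQm hQE hQb hQv (hικ m))
        _ = ∫⁻ y in B, ∑' m : ℕ, (ENNReal.ofReal ((1 + |(ι m : ℝ)|) ^ (-(1 / p))) *
              morreyDilate u κ h (ι m) y) ^ p :=
            (lintegral_tsum fun m => (((measurable_morreyDilate u κ hm _).const_mul _).pow_const
              p).aemeasurable).symm
        _ ≤ _ := by
            refine lintegral_mono fun y => ?_
            exact (ENNReal.tsum_comp_le_tsum_of_injective hι (fun k : ℤ =>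
              (ENNReal.ofReal ((1 + |(k : ℝ)|) ^ (-(1 / p))) * morreyDilate u κ h k y) ^ p)).trans
              (tsum_rpow_le_rpow_tsum hp _)
    refine ((setLIntegral_rpow_le_morreyFun p u _ 0 hB).trans_lt (ENNReal.mul_lt_top
      (ENNReal.rpow_ne_top_of_ne_zero (volume_ball_pos _ hB)
        (volume_ball_ne_top _ _)).lt_top hmem)).ne ?_
    rw [top_le_iff.1 low]
    exact ENNReal.top_rpow_of_pos (by positivity)

/-! ### Assembly of the cases -/

/-- Equality of sets and equivalence of the quasi-norms from the two-sided estimate. -/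
theorem morreyInterpSpace_eq_of_equiv {n : ℕ} {p₀ u₀ p₁ u₁ p u θ : ℝ} (hp : 0 < p) {q : ℝ≥0∞}
    (h : ∃ C : ℝ, 0 < C ∧ ∀ f : FunSpace n,
      ((∃ x₀ ∈ morreySpace n p₀ u₀, ∃ x₁ ∈ morreySpace n p₁ u₁, f = x₀ + x₁) ∨
        morreyNorm p u f < ∞) →
      (∃ x₀ ∈ morreySpace n p₀ u₀, ∃ x₁ ∈ morreySpace n p₁ u₁, f = x₀ + x₁) ∧
      morreyInterpNorm p₀ u₀ p₁ u₁ θ q f ≤ ENNReal.ofReal C * morreyNorm p u f ∧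
      morreyNorm p u f ≤ ENNReal.ofReal C * morreyInterpNorm p₀ u₀ p₁ u₁ θ q f) :
    morreyInterpSpace n p₀ u₀ p₁ u₁ θ q = morreySpace n p u ∧
      ∃ C : ℝ, 0 < C ∧ ∀ f ∈ morreySpace n p u,
        morreyInterpNorm p₀ u₀ p₁ u₁ θ q f ≤ ENNReal.ofReal C * morreyNorm p u f ∧
        morreyNorm p u f ≤ ENNReal.ofReal C * morreyInterpNorm p₀ u₀ p₁ u₁ θ q f := by
  obtain ⟨C, hC, h⟩ := h
  refine ⟨Set.ext fun f => ⟨fun hf => ?_, fun hf => ?_⟩, C, hC, fun f hf => (h f (.inr hf.2)).2⟩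
  · exact (mem_morreySpace_iff hp u f).2 ((h f (.inl hf.1)).2.2.trans_lt
      (ENNReal.mul_lt_top ENNReal.ofReal_lt_top hf.2))
  · obtain ⟨h1, h2, -⟩ := h f (.inr hf.2)
    exact ⟨h1, h2.trans_lt (ENNReal.mul_lt_top ENNReal.ofReal_lt_top hf.2)⟩

theorem ratio_eq_of_interp {p₀ u₀ p₁ u₁ p u θ ρ : ℝ} (hp₀ : 0 < p₀) (hp₁ : 0 < p₁)
    (hp0 : 0 < p) (hp : 1 / p = (1 - θ) / p₀ + θ / p₁) (hu : 1 / u = (1 - θ) / u₀ + θ / u₁)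
    (h₀ : p₀ / u₀ = ρ) (h₁ : p₁ / u₁ = ρ) : p / u = ρ := by
  have e : 1 / u = ρ * (1 / p) := by
    rw [hu, hp, mul_add]
    congr 1
    · rw [← h₀]; field_simp
    · rw [← h₁]; field_simp
  rw [div_eq_mul_one_div, e]
  field_simp

end

theorem theorem2p55 (n : ℕ) (hn : 1 ≤ n) (p₀ u₀ p₁ u₁ p u θ : ℝ)
    (hp₀ : 1 ≤ p₀) (hpu₀ : p₀ ≤ u₀) (hp₁ : 1 ≤ p₁) (hpu₁ : p₁ ≤ u₁)
    (hθ₀ : 0 < θ) (hθ₁ : θ < 1)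
    (hp : 1 / p = (1 - θ) / p₀ + θ / p₁) (hu : 1 / u = (1 - θ) / u₀ + θ / u₁)
    (q : ℝ≥0∞) (hq : 0 < q) :
    (¬ ((p₀ = p₁ ∧ u₀ = u₁) ∨ (p₀ = u₀ ∧ p₁ = u₁ ∧ q = ENNReal.ofReal p)) →
      morreyInterpSpace n p₀ u₀ p₁ u₁ θ q ≠ morreySpace n p u) ∧
    (((p₀ = p₁ ∧ u₀ = u₁) ∨ (p₀ = u₀ ∧ p₁ = u₁ ∧ q = ENNReal.ofReal p)) →
      morreyInterpSpace n p₀ u₀ p₁ u₁ θ q = morreySpace n p u ∧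
      ∃ C : ℝ, 0 < C ∧ ∀ f ∈ morreySpace n p u,
        morreyInterpNorm p₀ u₀ p₁ u₁ θ q f ≤ ENNReal.ofReal C * morreyNorm p u f ∧
        morreyNorm p u f ≤ ENNReal.ofReal C * morreyInterpNorm p₀ u₀ p₁ u₁ θ q f) := by
  have hp1 : 1 ≤ p := interp_exponent hp₀ hp₁ hθ₀ hθ₁ hp
  have hp0 : 0 < p := by linarith
  have hpu : p ≤ u := interp_le hp₀ hpu₀ hp₁ hpu₁ hθ₀ hθ₁ hp hu
  have hu0 : 0 < u := by linarith
  constructor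
  · intro hnot heq
    have of_top : (∃ f ∈ morreySpace n p u, morreyInterpNorm p₀ u₀ p₁ u₁ θ q f = ∞) → False := by
      rintro ⟨f, hf, htop⟩
      rw [← heq] at hf
      exact hf.2.ne htop
    by_cases hr : p₀ / u₀ = p₁ / u₁
    swap
    · exact of_top (exists_morrey_interpNorm_eq_top_of_ratio_ne hn hp₀ hpu₀ hp₁ hpu₁ hθ₀ hθ₁
        hp hu hr hq)
    have hρ : p / u = p₁ / u₁ :=
      ratio_eq_of_interp (by linarith) (by linarith) hp0 hp hu hr rfl
    have hne : u₀ ≠ u₁ := fun hu01 => hnot (Or.inl ⟨by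
      rw [hu01] at hr
      exact (div_left_inj' (by linarith : u₁ ≠ 0)).1 hr, hu01⟩)
    -- The radial function settles all finite `q` when `p < u`, but only `q < p` when `p = u`.
    by_cases hcase : q ≠ ∞ ∧ (p < u ∨ (p = u ∧ q.toReal < p))
    · exact of_top (exists_morrey_interpNorm_eq_top_of_radial hn hp₀ hp₁ hθ₀ hθ₁ hp0 hu0 hu hne
        hq hcase.1 hcase.2)
    -- The only finite `q` left with `q ≤ p` is `q = p = u`. Then the common ratio is `1`, both
    -- endpoint spaces are Lebesgue spaces, and this is the excluded case (b).
    have hqp : q = ∞ ∨ p < q.toReal := by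
      by_contra! hcon
      refine hcase ⟨hcon.1, ?_⟩
      rcases hpu.lt_or_eq with hlt | heq'
      · exact Or.inl hlt
      refine Or.inr ⟨heq', lt_of_le_of_ne hcon.2 fun hqe => hnot (Or.inr ?_)⟩
      rw [heq', div_self hu0.ne'] at hρ
      have d₁ : p₁ = u₁ := ((div_eq_one_iff_eq (by linarith)).1 hρ.symm)
      have d₀ : p₀ = u₀ := ((div_eq_one_iff_eq (by linarith)).1 (hr.trans hρ.symm))
      exact ⟨d₀, d₁, by rw [← hqe, ENNReal.ofReal_toReal hcon.1]⟩
    obtain ⟨f, hf, hf'⟩ := exists_mem_morreyInterpSpace_notMem hn hp₀ hpu₀ hp₁ hp1 hθ₀ hθ₁ hu hne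
      (hr.trans hρ.symm) hρ.symm hq hqp
    rw [heq] at hf
    exact hf' hf
  · have inv : ∀ {a b : ℝ}, 1 / a = (1 - θ) / b + θ / b → a = b := fun {a b} hab => by
      rw [← add_div, sub_add_cancel] at hab
      simpa using hab
    rintro (⟨rfl, rfl⟩ | ⟨rfl, rfl, rfl⟩)
    · obtain rfl := inv hp
      obtain rfl := inv hu
      exact morreyInterpSpace_eq_of_equiv hp0 (morreyInterpNorm_self hp1 hθ₀ hθ₁ hq)
    · obtain rfl : u = p := by
        rw [← hp] at hu
        simpa using hu
      exact morreyInterpSpace_eq_of_equiv hp0 (lebesgueInterpNorm_equiv hp₀ hp₁ hθ₀ hθ₁ hp)
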